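/- All graphs are finite and simple. A graph is $\mathcal F$-free if it has no induced subgraph isomorphic to a member of $\mathcal F$. Let $P_k$ be the path on $k$ vertices; let $S_t$ be the star $K_{1,t}$ with every edge subdivided once, and let $L_t$ be obtained from $S_t$ by making its $t$ leaves pairwise adjacent (so $L_1=P_3$). Let $\omega(G)$ be the clique number of $G$. For a fixed graph $H$ without loops, Max Partial $H$-Coloring is the following problem: given a graph $G$ and a revenue function $\mathrm{rev}\colon V(G)\times V(H)\to\mathbb R$, find a partial function $\varphi\colon V(G)\rightharpoonup V(H)$ that is a homomorphism from $G[\mathrm{dom}\,\varphi]$ to $H$ and that maximizes $\sum_{u\in\mathrm{dom}\,\varphi}\mathrm{rev}(u,\varphi(u))$ among all such partial functions. Running time is the number of steps of a random access machine that stores natural and real numbers, and that adds, subtracts and compares numbers (without multiplication, without conversion between the two kinds, and with no real constants other than $0$ and $1$) at unit cost. The input graph is given by its number of vertices $n$ and its adjacency matrix. Then for all fixed $s,t\in\mathbb N$ and every fixed graph $H$ without loops, Max Partial $H$-Coloring can be solved on $\{P_6,L_s,S_t\}$-free graphs $G$ in time $n^{\mathcal O(\omega(G))}$, where $n=|V(G)|$.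 That is, there are one program and one constant $C$, depending only on $s$, $t$ and $H$, such that on every instance $(G,\mathrm{rev})$ with $G$ being $\{P_6,L_s,S_t\}$-free the program outputs an optimum solution within $C\cdot n^{C\cdot\omega(G)}$ steps (with $0^0=1$). In particular, for every fixed graph $H$ without loops, the same holds for $P_5$-free graphs, with a program and a constant $C$ that depend only on $H$. -/

import Mathlib

/-! ### Graphs -/

/-- The star `K_{1,t}` with every edge subdivided once. The centre is `none`, `some (i, false)` is
the subdivision vertex of the `i`-th edge, and `some (i, true)` is the `i`-th leaf. -/
def subdividedStar (t : ℕ) : SimpleGraph (Option (Fin t × Bool)) :=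
  SimpleGraph.fromRel fun a b =>
    match a, b with
    | none, some (_, false) => True
    | some (i, false), some (j, true) => i = j
    | _, _ => False

/-- The graph `L_t`: the subdivided star `S_t` with its leaves made pairwise adjacent
(so `L_1` is the path on three vertices). -/
def subdividedStarWithClique (t : ℕ) : SimpleGraph (Option (Fin t × Bool)) :=
  subdividedStar t ⊔
    SimpleGraph.fromRel fun a b => (∃ i, a = some (i, true)) ∧ (∃ j, b = some (j, true))

/-- `G` has no induced subgraph isomorphic to `F`. -/
def InducedFree {V W : Type*} (F : SimpleGraph W) (G : SimpleGraph V) : Prop :=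
  ¬ F.IsIndContained G

/-! ### Partial `H`-colorings. A partial function `V → W` is a function `V → Option W`. -/

/-- `φ` is a partial `H`-coloring of `G`: a homomorphism to `H` from the subgraph of `G` that is
induced by the domain of `φ`. -/
def IsPartialColoring {V W : Type*} (G : SimpleGraph V) (H : SimpleGraph W) (φ : V → Option W) :
    Prop :=
  ∀ u u' a a', G.Adj u u' → φ u = some a → φ u' = some a' → H.Adj a a'

/-- The revenue of `φ`: the sum of `rev u (φ u)` over all `u` in the domain of `φ`. -/
def revenue {V W : Type*} [Fintype V] (rev : V → W → ℝ) (φ : V → Option W) : ℝ :=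
  ∑ u, (φ u).elim 0 (rev u)

/-- `φ` is an optimum solution to the instance `(G, rev)` of Max Partial `H`-Coloring. -/
def IsOptimumSolution {V W : Type*} [Fintype V] (G : SimpleGraph V) (H : SimpleGraph W)
    (rev : V → W → ℝ) (φ : V → Option W) : Prop :=
  IsPartialColoring G H φ ∧
    ∀ ψ : V → Option W, IsPartialColoring G H ψ → revenue rev ψ ≤ revenue rev φ

/-! ### The machine model

A random access machine over natural and real numbers, programmed by structured programs. A fixed
program can name finitely many arrays of naturals and arrays of reals, all of them unbounded, with
computed indices. Naturals can be added, subtracted (truncated at zero) and compared; reals can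
be added, subtracted and compared, and the only real constants are 0 and 1. Neither kind of number
can be multiplied, and there is no conversion between the two kinds. Every operation, memory
access and test costs one step. -/

namespace RealRAM

/-- A memory: `nat A i` and `real A i` are the entries with index `i` of the `A`-th array of
naturals and of the `A`-th array of reals. -/
structure State where
  nat : ℕ → ℕ → ℕ
  real : ℕ → ℕ → ℝ

/-- Expressions for natural numbers; `read A i` is entry `i` of the `A`-th array of naturals. -/
inductive NatExpr where
  | const (k : ℕ)
  | read (A : ℕ) (i : NatExpr)
  | add (e f : NatExpr)
  | sub (e f : NatExpr)

/-- Expressions for real numbers; `read A i` is entry `i` of the `A`-th array of reals. -/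
inductive RealExpr where
  | zero
  | one
  | read (A : ℕ) (i : NatExpr)
  | add (e f : RealExpr)
  | sub (e f : RealExpr)

/-- Tests. -/
inductive Test where
  | natLe (e f : NatExpr)
  | realLe (e f : RealExpr)
  | neg (b : Test)

/-- Programs: `setNat A i e` and `setReal A i e` assign `e` to entry `i` of the `A`-th array. -/
inductive Program where
  | skip
  | setNat (A : ℕ) (i : NatExpr) (e : NatExpr)
  | setReal (A : ℕ) (i : NatExpr) (e : RealExpr)
  | seq (p q : Program)
  | branch (b : Test) (p q : Program)
  | loop (b : Test) (p : Program)

def NatExpr.eval (σ : State) : NatExpr → ℕ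
  | .const k => k
  | .read A i => σ.nat A (i.eval σ)
  | .add e f => e.eval σ + f.eval σ
  | .sub e f => e.eval σ - f.eval σ

/-- The number of steps of an evaluation. -/
def NatExpr.cost : NatExpr → ℕ
  | .const _ => 1
  | .read _ i => i.cost + 1
  | .add e f => e.cost + f.cost + 1
  | .sub e f => e.cost + f.cost + 1

noncomputable def RealExpr.eval (σ : State) : RealExpr → ℝ
  | .zero => 0
  | .one => 1
  | .read A i => σ.real A (i.eval σ)
  | .add e f => e.eval σ + f.eval σ
  | .sub e f => e.eval σ - f.eval σ

/-- The number of steps of an evaluation. -/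
def RealExpr.cost : RealExpr → ℕ
  | .zero => 1
  | .one => 1
  | .read _ i => i.cost + 1
  | .add e f => e.cost + f.cost + 1
  | .sub e f => e.cost + f.cost + 1

def Test.Holds (σ : State) : Test → Prop
  | .natLe e f => e.eval σ ≤ f.eval σ
  | .realLe e f => e.eval σ ≤ f.eval σ
  | .neg b => ¬ b.Holds σ

/-- The number of steps of a test. -/
def Test.cost : Test → ℕ
  | .natLe e f => e.cost + f.cost + 1
  | .realLe e f => e.cost + f.cost + 1
  | .neg b => b.cost + 1

def State.setNat (σ : State) (A i v : ℕ) : State :=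
  { σ with nat := Function.update σ.nat A (Function.update (σ.nat A) i v) }

noncomputable def State.setReal (σ : State) (A i : ℕ) (v : ℝ) : State :=
  { σ with real := Function.update σ.real A (Function.update (σ.real A) i v) }

/-- `Runs p σ τ k`: started on the memory `σ`, the program `p` halts after exactly `k` steps, and
leaves the memory `τ`. -/
inductive Runs : Program → State → State → ℕ → Prop
  | skip (σ : State) : Runs .skip σ σ 1
  | setNat (σ : State) (A : ℕ) (i e : NatExpr) :
      Runs (.setNat A i e) σ (σ.setNat A (i.eval σ) (e.eval σ)) (i.cost + e.cost + 1)
  | setReal (σ : State) (A : ℕ) (i : NatExpr) (e : RealExpr) :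
      Runs (.setReal A i e) σ (σ.setReal A (i.eval σ) (e.eval σ)) (i.cost + e.cost + 1)
  | seq {p q : Program} {σ τ υ : State} {k l : ℕ} :
      Runs p σ τ k → Runs q τ υ l → Runs (.seq p q) σ υ (k + l)
  | branchTrue {b : Test} {p q : Program} {σ τ : State} {k : ℕ} :
      b.Holds σ → Runs p σ τ k → Runs (.branch b p q) σ τ (b.cost + k)
  | branchFalse {b : Test} {p q : Program} {σ τ : State} {k : ℕ} :
      ¬ b.Holds σ → Runs q σ τ k → Runs (.branch b p q) σ τ (b.cost + k)
  | loopDone {b : Test} {p : Program} {σ : State} :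
      ¬ b.Holds σ → Runs (.loop b p) σ σ b.cost
  | loopStep {b : Test} {p : Program} {σ τ υ : State} {k l : ℕ} :
      b.Holds σ → Runs p σ τ k → Runs (.loop b p) τ υ l → Runs (.loop b p) σ υ (b.cost + k + l)

open Classical in
/-- The input memory for a graph `G` on `{0, …, n-1}` and a revenue function. Array 0 of naturals
holds `n` in its entry 0, array 1 of naturals holds the adjacency matrix of `G` row by row, array 0
of reals holds the revenues (entry `u * h + v` is the revenue of sending `u` to `v`),
and everything else is 0. -/
noncomputable def inputState {n h : ℕ} (G : SimpleGraph (Fin n)) (rev : Fin n → Fin h → ℝ) :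
    State where
  nat A k :=
    if A = 0 ∧ k = 0 then n
    else if A = 1 then
      if hk : k < n * n then
        if G.Adj (Fin.divNat ⟨k, hk⟩) (Fin.modNat ⟨k, hk⟩) then 1 else 0
      else 0
    else 0
  real A k :=
    if A = 0 then
      if hk : k < n * h then rev (Fin.divNat ⟨k, hk⟩) (Fin.modNat ⟨k, hk⟩) else 0
    else 0

/-- The memory `σ` outputs `φ`: entry `u` of array 2 of naturals is 0 if `φ` is undefined at `u`,
and `v + 1` if `φ` sends `u` to `v`. -/
def Outputs {n h : ℕ} (σ : State) (φ : Fin n → Option (Fin h)) : Prop :=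
  ∀ u : Fin n, σ.nat 2 u = (φ u).elim 0 fun v => (v : ℕ) + 1

/-- On every instance `(G, rev)` of Max Partial `H`-Coloring with `G` in the class `𝒞`, the
program `p` halts within `T n G` steps, where `n` is the number of vertices of `G`, and outputs an
optimum solution. -/
def SolvesMaxPartialColoring {h : ℕ} (p : Program) (H : SimpleGraph (Fin h))
    (𝒞 : ∀ n : ℕ, SimpleGraph (Fin n) → Prop) (T : ∀ n : ℕ, SimpleGraph (Fin n) → ℕ) : Prop :=
  ∀ (n : ℕ) (G : SimpleGraph (Fin n)), 𝒞 n G → ∀ rev : Fin n → Fin h → ℝ,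
    ∃ (σ : State) (k : ℕ), Runs p (inputState G rev) σ k ∧ k ≤ T n G ∧
      ∃ φ : Fin n → Option (Fin h), IsOptimumSolution G H rev φ ∧ Outputs σ φ

end RealRAM

/-! ### Graph theory -/

/-! A partial coloring is an independent set of the conflict graph on the pairs (vertex, color), so
a heaviest independent set X of pairs is sought, and the components of the conflict graph can be
treated separately. The search guesses moves inside a component: `sel` deletes all pairs in conflict
with a chosen pair, and `cut` at a vertex p deletes p and those pairs at neighbours of p that
conflict with pairs outside N[p]. A move is safe for X if it deletes nothing of X. `Isolable d P X`
says that at most d safe moves in a row, with passages to components in between, leave only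
components that miss X or consist of one pair.

The combinatorial core is `exists_isolable`: O(ω) moves in a row suffice for every independent X. As
H has no loops, the neighbours of p that X colors with a given color form an independent set.
Ramsey's theorem and the exclusion of L_s and S_t yield a bounded subset with the same neighbours
outside N[p] (`exists_small_dominating`). Once the pairs of these subsets are selected, no pair that
survives outside N[p] conflicts with a pair of X in N(p), so cutting at p is safe. Thus boundedly
many moves leave components that lie inside N(p) or outside N[p] (`exists_isolable_of_homogeneous`).
Inside N(p) the clique number drops. Outside, the argument is repeated along an induced path p₁p₂p₃;
after three rounds the next vertex p₄ is complete to what remains, since otherwise the path extends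
to an induced P₆.

The clique number need not be known to the program. Every vertex receives the budget c, and each
move is charged to some vertex q, after which only N[q] may be charged. The charged vertices form a
clique, so at most cω moves in a row are possible (`budget_spend_lt`), while a maximum clique pays
for cω moves (`exists_spend`). The search tree therefore has n^{O(ω)} nodes, and yet its root
answers at least as well as every partial coloring (`SearchTree.weight_le`). Every answer is an
independent set whatever was guessed, so unsafe moves do no harm.

The program stores the nodes in arrays in order of creation, and then runs through them backwards
and lets each node improve the answer of its parent on one component (`Answers.replace`). `Wp s`
expresses total correctness with at most s rounds per loop; the number of steps is then at most a
polynomial in s that depends only on the program text (`Program.exists_bound_le`), and s can be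
taken n^{O(ω)}. The statement on P₅-free graphs follows since P₅ is an induced subgraph of P₆, L₃
and S₂. -/

theorem exists_ramsey (s t : ℕ) : ∃ r : ℕ, ∀ {α : Type} (R : α → α → Prop), (∀ x y, R x y → R y x) →
    ∀ Z : Finset α, r ≤ Z.card →
      (∃ T ⊆ Z, T.card = s ∧ (T : Set α).Pairwise R) ∨
      (∃ T ⊆ Z, T.card = t ∧ (T : Set α).Pairwise fun x y => ¬ R x y) := by
  classical
  induction s generalizing t with
  | zero => exact ⟨0, fun R _ Z _ => .inl ⟨∅, by simp, by simp, by simp⟩⟩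
  | succ s ihs =>
    induction t with
    | zero => exact ⟨0, fun R _ Z _ => .inr ⟨∅, by simp, by simp, by simp⟩⟩
    | succ t iht =>
      obtain ⟨r₁, h₁⟩ := ihs (t + 1)
      obtain ⟨r₂, h₂⟩ := iht
      -- Apart from a chosen `v`, either `r₁` elements are related to `v` or `r₂` are not.
      refine ⟨r₁ + r₂ + 1, fun {α} R hR Z hZ => ?_⟩
      obtain ⟨v, hv⟩ : Z.Nonempty := Finset.card_pos.1 (by omega)
      have hc : ((Z.erase v).filter (R v)).card + ((Z.erase v).filter fun x => ¬ R v x).card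
          = (Z.erase v).card := Finset.card_filter_add_card_filter_not _
      rw [Finset.card_erase_of_mem hv] at hc
      rcases le_or_gt r₁ ((Z.erase v).filter (R v)).card with h | h
      · rcases h₁ R hR _ h with ⟨T, hT, hs, hp⟩ | ⟨T, hT, hs, hp⟩
        · have hvT : v ∉ T := fun h => by simpa using hT h
          refine .inl ⟨insert v T, ?_, by simp [hvT, hs], ?_⟩
          · intro x hx
            rcases Finset.mem_insert.1 hx with rfl | hx
            · exact hv
            · exact (Finset.mem_erase.1 (Finset.mem_filter.1 (hT hx)).1).2
          · rw [Finset.coe_insert]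
            refine hp.insert fun x hx _ => ?_
            have := (Finset.mem_filter.1 (hT hx)).2
            exact ⟨this, hR _ _ this⟩
        · exact .inr ⟨T, hT.trans ((Finset.filter_subset _ _).trans (Finset.erase_subset _ _)),
            hs, hp⟩
      · have h' : r₂ ≤ ((Z.erase v).filter fun x => ¬ R v x).card := by omega
        rcases h₂ R hR _ h' with ⟨T, hT, hs, hp⟩ | ⟨T, hT, hs, hp⟩
        · exact .inl ⟨T, hT.trans ((Finset.filter_subset _ _).trans (Finset.erase_subset _ _)),
            hs, hp⟩
        · have hvT : v ∉ T := fun h => by simpa using hT h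
          refine .inr ⟨insert v T, ?_, by simp [hvT, hs], ?_⟩
          · intro x hx
            rcases Finset.mem_insert.1 hx with rfl | hx
            · exact hv
            · exact (Finset.mem_erase.1 (Finset.mem_filter.1 (hT hx)).1).2
          · rw [Finset.coe_insert]
            refine hp.insert fun x hx _ => ?_
            have := (Finset.mem_filter.1 (hT hx)).2
            exact ⟨this, fun h => this (hR _ _ h)⟩

/-! ### Recognizing the forbidden induced subgraphs. -/

section Patterns

variable {V : Type*} {G : SimpleGraph V}

/-- The map of the vertices of a subdivided star that is given by the images of the centre, of the
subdivision vertices and of the leaves. -/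
def starMap {t : ℕ} (p : V) (z y : Fin t → V) : Option (Fin t × Bool) → V
  | none => p
  | some (i, false) => z i
  | some (i, true) => y i

/-- The induced matching between the `z i` and the `y j` separates the indices, and adjacency to `p`
separates the two kinds. -/
theorem starMap_injective {t : ℕ} {p : V} {z y : Fin t → V} (hpz : ∀ i, G.Adj p (z i))
    (hpy : ∀ i, ¬ G.Adj p (y i)) (hp : ∀ i, p ≠ y i) (hzy : ∀ i j, G.Adj (z i) (y j) ↔ i = j) :
    Function.Injective (starMap p z y) := by
  have hz : ∀ i j, z i = z j → i = j := fun i j h => (hzy i j).1 (h ▸ (hzy j j).2 rfl)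
  have hy : ∀ i j, y i = y j → i = j := fun i j h => (hzy i j).1 (h ▸ (hzy i i).2 rfl)
  have hzy' : ∀ i j, z i ≠ y j := fun i j h => hpy j (h ▸ hpz i)
  rintro (_ | ⟨i, _ | _⟩) (_ | ⟨j, _ | _⟩) h <;> simp only [starMap] at h
  · rfl
  · exact absurd h (hpz j).ne
  · exact absurd h (hp j)
  · exact absurd h.symm (hpz i).ne
  · rw [hz i j h]
  · exact absurd h (hzy' i j)
  · exact absurd h.symm (hp i)
  · exact absurd h.symm (hzy' j i)
  · rw [hy i j h]

theorem subdividedStar_isIndContained {t : ℕ} {p : V} {z y : Fin t → V} (hpz : ∀ i, G.Adj p (z i))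
    (hpy : ∀ i, ¬ G.Adj p (y i)) (hp : ∀ i, p ≠ y i) (hzy : ∀ i j, G.Adj (z i) (y j) ↔ i = j)
    (hz : ∀ i j, ¬ G.Adj (z i) (z j)) (hy : ∀ i j, ¬ G.Adj (y i) (y j)) :
    (subdividedStar t).IsIndContained G := by
  refine ⟨⟨⟨starMap p z y, starMap_injective hpz hpy hp hzy⟩, ?_⟩⟩
  rintro (_ | ⟨i, _ | _⟩) (_ | ⟨j, _ | _⟩) <;>
    simp [starMap, subdividedStar, hpz, hpy, hzy, hz, hy, G.adj_comm _ p, G.adj_comm (y _) (z _),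
      eq_comm]

theorem subdividedStarWithClique_isIndContained {t : ℕ} {p : V} {z y : Fin t → V}
    (hpz : ∀ i, G.Adj p (z i)) (hpy : ∀ i, ¬ G.Adj p (y i)) (hp : ∀ i, p ≠ y i)
    (hzy : ∀ i j, G.Adj (z i) (y j) ↔ i = j) (hz : ∀ i j, ¬ G.Adj (z i) (z j))
    (hy : ∀ i j, i ≠ j → G.Adj (y i) (y j)) :
    (subdividedStarWithClique t).IsIndContained G := by
  refine ⟨⟨⟨starMap p z y, starMap_injective hpz hpy hp hzy⟩, ?_⟩⟩
  have hy' : ∀ i j, G.Adj (y i) (y j) ↔ i ≠ j := fun i j => ⟨fun h e => h.ne (e ▸ rfl), hy i j⟩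
  rintro (_ | ⟨i, _ | _⟩) (_ | ⟨j, _ | _⟩) <;>
    simp [starMap, subdividedStarWithClique, subdividedStar, hpz, hpy, hzy, hz, hy',
      G.adj_comm _ p, G.adj_comm (y _) (z _), eq_comm]

/-- Distinctness need not be assumed: no two vertices of the path have the same neighbours, so the
adjacencies force it. -/
theorem pathGraph_six_isIndContained {a b c d e f : V} (hab : G.Adj a b) (hbc : G.Adj b c)
    (hcd : G.Adj c d) (hde : G.Adj d e) (hef : G.Adj e f) (hac : ¬ G.Adj a c) (had : ¬ G.Adj a d)
    (hae : ¬ G.Adj a e) (haf : ¬ G.Adj a f) (hbd : ¬ G.Adj b d) (hbe : ¬ G.Adj b e)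
    (hbf : ¬ G.Adj b f) (hce : ¬ G.Adj c e) (hcf : ¬ G.Adj c f) (hdf : ¬ G.Adj d f) :
    (SimpleGraph.pathGraph 6).IsIndContained G := by
  have key : ∀ i j : Fin 6, G.Adj (![a, b, c, d, e, f] i) (![a, b, c, d, e, f] j) ↔
      (SimpleGraph.pathGraph 6).Adj i j := by
    intro i j
    rw [SimpleGraph.pathGraph_adj]
    fin_cases i <;> fin_cases j <;>
      simp [*, G.adj_comm b a, G.adj_comm c a, G.adj_comm d a, G.adj_comm e a, G.adj_comm f a,
        G.adj_comm c b, G.adj_comm d b, G.adj_comm e b, G.adj_comm f b, G.adj_comm d c,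
        G.adj_comm e c, G.adj_comm f c, G.adj_comm e d, G.adj_comm f d, G.adj_comm f e]
  refine ⟨⟨⟨![a, b, c, d, e, f], fun i j h => ?_⟩, key _ _⟩⟩
  have h' : ∀ k, (i : ℕ) + 1 = (k : Fin 6) ∨ (k : ℕ) + 1 = i ↔ (j : ℕ) + 1 = k ∨ (k : ℕ) + 1 = j :=
    fun k => by rw [← SimpleGraph.pathGraph_adj, ← SimpleGraph.pathGraph_adj, ← key, ← key, h]
  revert h'
  clear h
  revert i j
  decide

theorem pathGraph_five_isIndContained_six :
    (SimpleGraph.pathGraph 5).IsIndContained (SimpleGraph.pathGraph 6) :=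
  ⟨⟨⟨Fin.castSucc, Fin.castSucc_injective 5⟩, by simp [SimpleGraph.pathGraph_adj]⟩⟩

theorem pathGraph_five_isIndContained_subdividedStar :
    (SimpleGraph.pathGraph 5).IsIndContained (subdividedStar 2) := by
  refine ⟨⟨⟨![some (0, true), some (0, false), none, some (1, false), some (1, true)], ?_⟩, ?_⟩⟩
  · decide
  · intro i j
    rw [SimpleGraph.pathGraph_adj]
    fin_cases i <;> fin_cases j <;> simp [subdividedStar]

/-- The path starts on one leg, passes the centre, descends a second leg and ends at the leaf of a
third; with two legs only, the graph is a 5-cycle. -/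
theorem pathGraph_five_isIndContained_subdividedStarWithClique :
    (SimpleGraph.pathGraph 5).IsIndContained (subdividedStarWithClique 3) := by
  refine ⟨⟨⟨![some (0, false), none, some (1, false), some (1, true), some (2, true)], ?_⟩, ?_⟩⟩
  · decide
  · intro i j
    rw [SimpleGraph.pathGraph_adj]
    fin_cases i <;> fin_cases j <;> simp [subdividedStarWithClique, subdividedStar]

end Patterns

/-! ### Bounded domination of the vertices outside a closed neighbourhood. -/

section Domination

variable {V : Type} [Fintype V] {G : SimpleGraph V}

/-- In the absence of `S_t` and `L_s`, every independent set of neighbours of `p` has a subset of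
bounded size that dominates the same vertices outside the closed neighbourhood of `p`. -/
theorem exists_small_dominating (s t : ℕ) : ∃ r : ℕ, ∀ {V : Type} (G : SimpleGraph V),
    InducedFree (subdividedStarWithClique s) G → InducedFree (subdividedStar t) G →
    ∀ (p : V) (A : Finset V), (∀ v ∈ A, G.Adj p v) → (∀ v ∈ A, ∀ w ∈ A, ¬ G.Adj v w) →
      ∃ Z ⊆ A, Z.card ≤ r ∧ ∀ y, p ≠ y → ¬ G.Adj p y → (∃ v ∈ A, G.Adj v y) →
        ∃ v ∈ Z, G.Adj v y := by
  classical
  obtain ⟨r, hr⟩ := exists_ramsey s t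
  refine ⟨r, fun {V} G hs ht p A hA hind => ?_⟩
  let good : Finset V → Prop := fun Z => Z ⊆ A ∧ ∀ y, p ≠ y → ¬ G.Adj p y →
    (∃ v ∈ A, G.Adj v y) → ∃ v ∈ Z, G.Adj v y
  -- By minimality, every element of `Z` has a private neighbour outside the closed neighbourhood of
  -- `p`.
  obtain ⟨Z, hZ, hmin⟩ : ∃ Z, good Z ∧ ∀ Z', good Z' → Z.card ≤ Z'.card := by
    have hex : ∃ k, ∃ Z, good Z ∧ Z.card = k := ⟨_, A, ⟨subset_rfl, fun y _ _ h => h⟩, rfl⟩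
    obtain ⟨Z, hZ, hk⟩ := Nat.find_spec hex
    exact ⟨Z, hZ, fun Z' h => hk ▸ Nat.find_min' hex ⟨Z', h, rfl⟩⟩
  refine ⟨Z, hZ.1, ?_, hZ.2⟩
  by_contra! hlt
  have hpriv : ∀ z, ∃ y, z ∈ Z → p ≠ y ∧ ¬ G.Adj p y ∧ G.Adj z y ∧ ∀ v ∈ Z, G.Adj v y → v = z := by
    intro z
    by_cases hz : z ∈ Z
    swap
    · exact ⟨z, fun h => absurd h hz⟩
    by_contra! hcon
    have hg : good (Z.erase z) := by
      refine ⟨(Finset.erase_subset _ _).trans hZ.1, fun y h₁ h₂ h₃ => ?_⟩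
      obtain ⟨v, hv, hvy⟩ := hZ.2 y h₁ h₂ h₃
      by_cases hvz : v = z
      · subst hvz
        obtain ⟨w, hw, hwy, hne⟩ := (hcon y).2 h₁ h₂ hvy
        exact ⟨w, Finset.mem_erase.2 ⟨hne, hw⟩, hwy⟩
      · exact ⟨v, Finset.mem_erase.2 ⟨hvz, hv⟩, hvy⟩
    have h₁ := hmin _ hg
    rw [Finset.card_erase_of_mem hz] at h₁
    have := Finset.card_pos.2 ⟨z, hz⟩
    omega
  choose y hy using hpriv
  have hzy : ∀ {k} {T : Finset V} (hT : T ⊆ Z) (f : Fin k ≃ T) (i j : Fin k),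
      G.Adj (f i : V) (y (f j)) ↔ i = j := fun hT f i j =>
    ⟨fun h => f.injective (Subtype.ext ((hy _ (hT (f j).2)).2.2.2 _ (hT (f i).2) h)),
      fun h => h ▸ (hy _ (hT (f i).2)).2.2.1⟩
  -- With centre `p` and legs through `Z`, pairwise adjacent private neighbours are the leaves of
  -- `L_s`, and pairwise non-adjacent ones are the leaves of `S_t`.
  rcases hr (fun v w => G.Adj (y v) (y w)) (fun _ _ h => h.symm) Z hlt.le with
    ⟨T, hT, hc, hp⟩ | ⟨T, hT, hc, hp⟩
  · let f := (T.equivFinOfCardEq hc).symm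
    refine hs (subdividedStarWithClique_isIndContained (p := p) (z := fun i => f i)
      (y := fun i => y (f i)) (fun i => hA _ (hZ.1 (hT (f i).2)))
      (fun i => (hy _ (hT (f i).2)).2.1) (fun i => (hy _ (hT (f i).2)).1) (hzy hT f)
      (fun i j => hind _ (hZ.1 (hT (f i).2)) _ (hZ.1 (hT (f j).2))) fun i j hij => ?_)
    exact hp (f i).2 (f j).2 fun h => hij (f.injective (Subtype.ext h))
  · let f := (T.equivFinOfCardEq hc).symm
    refine ht (subdividedStar_isIndContained (p := p) (z := fun i => f i)
      (y := fun i => y (f i)) (fun i => hA _ (hZ.1 (hT (f i).2)))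
      (fun i => (hy _ (hT (f i).2)).2.1) (fun i => (hy _ (hT (f i).2)).1) (hzy hT f)
      (fun i j => hind _ (hZ.1 (hT (f i).2)) _ (hZ.1 (hT (f j).2))) fun i j hij => ?_)
    by_cases h : i = j
    · subst h
      exact hij.ne rfl
    · exact hp (f i).2 (f j).2 (fun e => h (f.injective (Subtype.ext e))) hij

end Domination

/-! ### Components of induced subgraphs. -/

section Components

variable {V : Type*} {G : SimpleGraph V}

/-- The component of `v` in the subgraph that is induced by `D`. -/
def componentIn (G : SimpleGraph V) (D : Set V) (v : V) : Set V :=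
  {x | Relation.ReflTransGen (fun a b => G.Adj a b ∧ b ∈ D) v x}

theorem mem_componentIn_self (D : Set V) (v : V) : v ∈ componentIn G D v := .refl

theorem componentIn_subset {D : Set V} {v : V} (hv : v ∈ D) : componentIn G D v ⊆ D := by
  intro x hx
  rcases Relation.ReflTransGen.cases_tail hx with rfl | ⟨_, _, h⟩
  exacts [hv, h.2]

theorem componentIn_closed {D : Set V} {v x y : V} (hx : x ∈ componentIn G D v) (hxy : G.Adj x y)
    (hy : y ∈ D) : y ∈ componentIn G D v := Relation.ReflTransGen.tail hx ⟨hxy, hy⟩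

theorem componentIn_induction {D T : Set V} {v : V} (hv : v ∈ T)
    (hT : ∀ x ∈ T, ∀ y ∈ D, G.Adj x y → y ∈ T) : componentIn G D v ⊆ T := by
  intro x hx
  induction hx with
  | refl => exact hv
  | tail _ h ih => exact hT _ ih _ h.2 h.1

/-- If no neighbour of `p` in `D` saw the component of `v` outside the closed neighbourhood of `p`,
that component would be closed in `D` and hence all of `D`, although `D` meets the closed
neighbourhood. The vertex `q` continues the induced path. -/
theorem exists_attachment {D : Set V} {p v : V} (hD : ∀ x ∈ D, componentIn G D x = D)
    (hp : ∃ y ∈ D, p = y ∨ G.Adj p y) (hv : v ∈ D) (hvp : ¬ (p = v ∨ G.Adj p v)) :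
    ∃ q ∈ D, G.Adj p q ∧ ∃ d ∈ componentIn G {x ∈ D | ¬ (p = x ∨ G.Adj p x)} v, G.Adj q d := by
  by_contra hcon
  set D' := componentIn G {x ∈ D | ¬ (p = x ∨ G.Adj p x)} v with hD'
  have hsub : D' ⊆ {x ∈ D | ¬ (p = x ∨ G.Adj p x)} := componentIn_subset ⟨hv, hvp⟩
  have : componentIn G D v ⊆ D' := by
    refine componentIn_induction (mem_componentIn_self _ _) fun x hx y hy hxy => ?_
    refine componentIn_closed hx hxy ⟨hy, ?_⟩
    rintro (rfl | h)
    · exact (hsub hx).2 (.inr hxy.symm)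
    · exact hcon ⟨y, hy, h, x, hx, hxy.symm⟩
  obtain ⟨y, hy, hpy⟩ := hp
  rw [hD v hv] at this
  exact (hsub (this hy)).2 hpy

theorem componentIn_eq_self {D : Set V} {v x : V} (hx : x ∈ componentIn G D v) :
    componentIn G (componentIn G D v) x = componentIn G D v := by
  refine subset_antisymm (componentIn_subset hx) ?_
  have hsymm : v ∈ componentIn G (componentIn G D v) x := by
    have hx' : Relation.ReflTransGen (fun a b => G.Adj a b ∧ b ∈ D) v x := hx
    clear hx
    induction hx' with
    | refl => exact .refl
    | tail hb h ih =>
      refine Relation.ReflTransGen.head (b := _) ⟨h.1.symm, hb⟩ ?_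
      exact ih
  intro y hy
  induction hy with
  | refl => exact hsymm
  | tail hb h ih => exact componentIn_closed ih h.1 (Relation.ReflTransGen.tail hb h)

/-- In a connected set `D`, a vertex that has a neighbour and a non-neighbour in `D` has them
adjacent. -/
theorem exists_mixed_edge {D : Set V} {p x y : V} (hD : componentIn G D x = D)
    (hx : G.Adj p x) (hxD : x ∈ D) (hy : y ∈ D) (hpy : ¬ G.Adj p y) :
    ∃ a ∈ D, ∃ b ∈ D, G.Adj a b ∧ G.Adj p a ∧ ¬ G.Adj p b := by
  by_contra! hcon
  have : componentIn G D x ⊆ {a ∈ D | G.Adj p a} := componentIn_induction ⟨hxD, hx⟩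
    fun a ha b hb hab => ⟨hb, hcon a ha.1 b hb hab ha.2⟩
  rw [hD] at this
  exact hpy (this hy).2

end Components

/-! ### Conflicts between pairs -/

section Conflict

variable {V W ι : Type} (G : SimpleGraph V) (H : SimpleGraph W) (e : ι ≃ V × W)

/-- Two pairs of a vertex and a color cannot occur in the same partial coloring. -/
def Conflict (x y : ι) : Prop :=
  ((e x).1 = (e y).1 ∧ (e x).2 ≠ (e y).2) ∨ (G.Adj (e x).1 (e y).1 ∧ ¬ H.Adj (e x).2 (e y).2)

/-- The vertices of two pairs are equal or adjacent. -/
def Near (x y : ι) : Prop := (e x).1 = (e y).1 ∨ G.Adj (e x).1 (e y).1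

/-- The component of `k` in the conflict graph on `P`. -/
def comp (P : Set ι) (k : ι) : Set ι :=
  {x | Relation.ReflTransGen (fun a b => Conflict G H e a b ∧ b ∈ P) k x}

/-- Selecting the pair `l`: all pairs that are in conflict with it are deleted. -/
def sel (l : ι) (K : Set ι) : Set ι := {x ∈ K | ¬ Conflict G H e l x}

/-- Cutting at the vertex `v` of `l`: the vertex `v` is deleted, as well as every pair at a
neighbor of `v` that is in conflict with a pair outside the closed neighborhood of `v`. -/
def cut (l : ι) (K : Set ι) : Set ι :=
  {x ∈ K | (e l).1 ≠ (e x).1 ∧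
    ¬ (Near G e l x ∧ ∃ y ∈ K, ¬ Near G e l y ∧ Conflict G H e x y)}

/-- `X` can be isolated in `P` with at most `d` moves in a row. -/
def Isolable : ℕ → Set ι → Set ι → Prop
  | 0, P, X => ∀ k ∈ P, X ∩ comp G H e P k = ∅ ∨ comp G H e P k = {k}
  | d + 1, P, X => ∀ k ∈ P, X ∩ comp G H e P k = ∅ ∨ comp G H e P k = {k} ∨
      ∃ l, (X ∩ comp G H e P k ⊆ sel G H e l (comp G H e P k) ∧
          Isolable d (sel G H e l (comp G H e P k)) (X ∩ comp G H e P k)) ∨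
        (X ∩ comp G H e P k ⊆ cut G H e l (comp G H e P k) ∧
          Isolable d (cut G H e l (comp G H e P k)) (X ∩ comp G H e P k))

variable {G H e}

theorem Conflict.symm {x y : ι} (h : Conflict G H e x y) : Conflict G H e y x := by
  rcases h with h | h
  · exact .inl ⟨h.1.symm, h.2.symm⟩
  · exact .inr ⟨h.1.symm, fun h' => h.2 h'.symm⟩

theorem Conflict.near {x y : ι} (h : Conflict G H e x y) : Near G e x y := by
  rcases h with h | h
  exacts [.inl h.1, .inr h.1]

theorem mem_comp_self (P : Set ι) (k : ι) : k ∈ comp G H e P k := .refl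

theorem comp_subset {P : Set ι} {k : ι} (hk : k ∈ P) : comp G H e P k ⊆ P := by
  intro x hx
  rcases Relation.ReflTransGen.cases_tail hx with rfl | ⟨_, _, h⟩
  exacts [hk, h.2]

theorem comp_closed {P : Set ι} {k x y : ι} (hx : x ∈ comp G H e P k)
    (hxy : Conflict G H e x y) (hy : y ∈ P) : y ∈ comp G H e P k :=
  Relation.ReflTransGen.tail hx ⟨hxy, hy⟩

theorem comp_induction {P T : Set ι} {k : ι} (hk : k ∈ T)
    (hT : ∀ x ∈ T, ∀ y ∈ P, Conflict G H e x y → y ∈ T) : comp G H e P k ⊆ T := by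
  intro x hx
  induction hx with
  | refl => exact hk
  | tail _ h ih => exact hT _ ih _ h.2 h.1

theorem comp_comp {P : Set ι} {k x : ι} (hx : x ∈ comp G H e P k) :
    comp G H e (comp G H e P k) x = comp G H e P k := by
  refine subset_antisymm (comp_subset hx) ?_
  have hsymm : k ∈ comp G H e (comp G H e P k) x := by
    have hx' : Relation.ReflTransGen (fun a b => Conflict G H e a b ∧ b ∈ P) k x := hx
    clear hx
    induction hx' with
    | refl => exact .refl
    | tail hb h ih => exact Relation.ReflTransGen.head ⟨h.1.symm, hb⟩ ih
  intro y hy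
  induction hy with
  | refl => exact hsymm
  | tail hb h ih => exact comp_closed ih h.1 (Relation.ReflTransGen.tail hb h)

theorem comp_eq_of_mem {P : Set ι} {k x : ι} (hk : k ∈ P) (hx : x ∈ comp G H e P k) :
    comp G H e P x = comp G H e P k := by
  refine subset_antisymm (comp_induction hx fun a ha b hb h => comp_closed ha h hb) ?_
  have hsub : comp G H e (comp G H e P k) x ⊆ comp G H e P x :=
    comp_induction (mem_comp_self _ _) fun a ha b hb h => comp_closed ha h (comp_subset hk hb)
  rwa [comp_comp hx] at hsub

theorem Isolable.empty_or {d : ℕ} {P X : Set ι}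
    (h : ∀ k ∈ P, X ∩ comp G H e P k = ∅ ∨ comp G H e P k = {k}) : Isolable G H e d P X := by
  cases d with
  | zero => exact h
  | succ d =>
    intro k hk
    rcases h k hk with h | h
    exacts [.inl h, .inr (.inl h)]

theorem Isolable.mono {d d' : ℕ} (hd : d ≤ d') {P X : Set ι} (h : Isolable G H e d P X) :
    Isolable G H e d' P X := by
  induction d generalizing d' P X with
  | zero => exact .empty_or h
  | succ d ih =>
    obtain ⟨d', rfl⟩ : ∃ d'', d' = d'' + 1 := ⟨d' - 1, by omega⟩
    intro k hk
    rcases h k hk with h | h | ⟨l, ⟨h₁, h₂⟩ | ⟨h₁, h₂⟩⟩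
    · exact .inl h
    · exact .inr (.inl h)
    · exact .inr (.inr ⟨l, .inl ⟨h₁, ih (by omega) h₂⟩⟩)
    · exact .inr (.inr ⟨l, .inr ⟨h₁, ih (by omega) h₂⟩⟩)

/-- Passing to components costs no move, since each clause of `Isolable` concerns one component
only. -/
theorem Isolable.of_comp {d : ℕ} {P X : Set ι}
    (h : ∀ k ∈ P, Isolable G H e d (comp G H e P k) (X ∩ comp G H e P k)) :
    Isolable G H e d P X := by
  have hi : ∀ k, X ∩ comp G H e P k ∩ comp G H e P k = X ∩ comp G H e P k := fun k => by
    rw [Set.inter_assoc, Set.inter_self]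
  cases d with
  | zero =>
    intro k hk
    have := h k hk k (mem_comp_self _ _)
    rwa [comp_comp (mem_comp_self _ _), hi] at this
  | succ d =>
    intro k hk
    have := h k hk k (mem_comp_self _ _)
    rwa [comp_comp (mem_comp_self _ _), hi] at this

variable (G H e) in
/-- `K` is nonempty and connected in the conflict graph. -/
def Conn (K : Set ι) : Prop := K.Nonempty ∧ ∀ k ∈ K, comp G H e K k = K

theorem conn_comp {P : Set ι} (k : ι) : Conn G H e (comp G H e P k) :=
  ⟨⟨k, mem_comp_self _ _⟩, fun _ hx => comp_comp hx⟩

variable (G H e) in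
/-- No two pairs in `X` are in conflict. -/
def Indep (X : Set ι) : Prop := ∀ x ∈ X, ∀ y ∈ X, ¬ Conflict G H e x y

/-- Selecting an element of the independent set `X` is safe, and later moves only delete pairs, so
the effects of all selections accumulate. The selected pairs need not lie in `P`. -/
theorem Isolable.of_select {X : Set ι} (hX : Indep G H e X) {d : ℕ} (Z : List ι)
    (hZ : ∀ z ∈ Z, z ∈ X) {P : Set ι}
    (h : ∀ K ⊆ P, Conn G H e K → (∀ z ∈ Z, ∀ x ∈ K, ¬ Conflict G H e z x) →
      Isolable G H e d K (X ∩ K)) : Isolable G H e (d + Z.length) P (X ∩ P) := by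
  induction Z generalizing P with
  | nil =>
    refine .of_comp fun k hk => ?_
    have hs := comp_subset (G := G) (H := H) (e := e) hk
    rw [Set.inter_assoc, Set.inter_eq_right.2 hs]
    exact h _ hs (conn_comp k) (by simp)
  | cons z Z ih =>
    intro k hk
    have hs := comp_subset (G := G) (H := H) (e := e) hk
    have hsel : X ∩ comp G H e P k ⊆ sel G H e z (comp G H e P k) := fun x hx =>
      ⟨hx.2, hX z (hZ z (by simp)) x hx.1⟩
    have heq : X ∩ comp G H e P k = X ∩ sel G H e z (comp G H e P k) :=
      subset_antisymm (fun x hx => ⟨hx.1, hsel hx⟩) fun x hx => ⟨hx.1, hx.2.1⟩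
    refine .inr (.inr ⟨z, .inl ?_⟩)
    rw [Set.inter_assoc, Set.inter_eq_right.2 hs]
    refine ⟨hsel, ?_⟩
    rw [heq]
    refine ih (fun z hz => hZ z (by simp [hz])) fun K hK hconn hK' => ?_
    refine h K (fun x hx => hs (hK hx).1) hconn fun z' hz' x hx => ?_
    rcases List.mem_cons.1 hz' with rfl | hz'
    · exact (hK hx).2
    · exact hK' z' hz' x hx

variable (G e) in
/-- `K` lies inside the neighborhood of `p`, or outside the closed neighborhood of `p`. -/
def Homogeneous (p : V) (K : Set ι) : Prop :=
  (∀ x ∈ K, G.Adj p (e x).1) ∨ ∀ x ∈ K, ¬ (p = (e x).1 ∨ G.Adj p (e x).1)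

/-- After the cut nothing is left at the vertex of `l`, and no conflict joins its neighbours to the
rest, so each component lies on one side. `h₁` and `h₂` make the cut safe. -/
theorem Isolable.of_cut {X P : Set ι} {d : ℕ} (l : ι)
    (h₁ : ∀ x ∈ X ∩ P, (e l).1 ≠ (e x).1)
    (h₂ : ∀ x ∈ X ∩ P, ∀ y ∈ P, Near G e l x → ¬ Near G e l y → ¬ Conflict G H e x y)
    (h : ∀ K ⊆ P, Conn G H e K → Homogeneous G e (e l).1 K → Isolable G H e d K (X ∩ K)) :
    Isolable G H e (d + 1) P (X ∩ P) := by
  intro k hk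
  have hs := comp_subset (G := G) (H := H) (e := e) hk
  set K₀ := comp G H e P k with hK₀
  have hcut : X ∩ K₀ ⊆ cut G H e l K₀ := fun x hx =>
    ⟨hx.2, h₁ x ⟨hx.1, hs hx.2⟩, fun ⟨hn, y, hy, hy', hc⟩ =>
      h₂ x ⟨hx.1, hs hx.2⟩ y (hs hy) hn hy' hc⟩
  refine .inr (.inr ⟨l, .inr ?_⟩)
  rw [Set.inter_assoc, Set.inter_eq_right.2 hs]
  refine ⟨hcut, .of_comp fun x hx => ?_⟩
  have hs' := comp_subset (G := G) (H := H) (e := e) hx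
  set K := comp G H e (cut G H e l K₀) x with hK
  have hKK : K ⊆ K₀ := fun y hy => (hs' hy).1
  rw [Set.inter_assoc, Set.inter_eq_right.2 hKK]
  refine h K (hKK.trans hs) (conn_comp x) ?_
  by_cases hn : Near G e l x
  · left
    have : K ⊆ {y ∈ cut G H e l K₀ | Near G e l y} := by
      refine comp_induction ⟨hx, hn⟩ fun a ha b hb hab => ⟨hb, ?_⟩
      by_contra hb'
      exact ha.1.2.2 ⟨ha.2, b, hb.1, hb', hab⟩
    intro y hy
    exact (this hy).2.resolve_left (this hy).1.2.1
  · right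
    have : K ⊆ {y ∈ cut G H e l K₀ | ¬ Near G e l y} := by
      refine comp_induction ⟨hx, hn⟩ fun a ha b hb hab => ⟨hb, fun hb' => ?_⟩
      exact hb.2.2 ⟨hb', a, ha.1.1, ha.2, hab.symm⟩
    exact fun y hy => (this hy).2

/-- A bounded number of selections of pairs of `X` around `p` makes the cut at `p` safe; `c` counts
these selections and the cut. -/
theorem exists_isolable_of_homogeneous (s t h : ℕ) : ∃ c : ℕ, ∀ {V W ι : Type} [Fintype V]
    [Fintype W] {G : SimpleGraph V} {H : SimpleGraph W} {e : ι ≃ V × W}, Fintype.card W = h →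
    InducedFree (subdividedStarWithClique s) G → InducedFree (subdividedStar t) G →
    ∀ {X P : Set ι} (d : ℕ) (p : V), Indep G H e X →
      (∀ K ⊆ P, Conn G H e K → Homogeneous G e p K → Isolable G H e d K (X ∩ K)) →
      Isolable G H e (d + c) P (X ∩ P) := by
  classical
  obtain ⟨r, hr⟩ := exists_small_dominating s t
  -- At most `r` dominating neighbours per color, at most one pair at `p` per color, and one cut.
  refine ⟨h * r + h + 1, fun {V W ι _ _ G H e} hW hs ht X P d p hX hP => ?_⟩
  have hZ : ∀ a, ∃ Z ⊆ Finset.univ.filter fun v => G.Adj p v ∧ e.symm (v, a) ∈ X,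
      Z.card ≤ r ∧ ∀ y, p ≠ y → ¬ G.Adj p y →
        (∃ v ∈ Finset.univ.filter (fun v => G.Adj p v ∧ e.symm (v, a) ∈ X), G.Adj v y) →
          ∃ v ∈ Z, G.Adj v y := by
    intro a
    refine hr G hs ht p _ (by simp +contextual) fun v hv w hw hvw => ?_
    simp only [Finset.mem_filter, Finset.mem_univ, true_and] at hv hw
    exact hX _ hv.2 _ hw.2 (.inr (by simpa using hvw))
  choose Z hZA hZr hZd using hZ
  let Z' : Finset ι := (Finset.univ.biUnion fun a => (Z a).image fun v => e.symm (v, a)) ∪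
    (Finset.univ.image fun a => e.symm (p, a)).filter (· ∈ X)
  have hcard : Z'.card ≤ h * r + h := by
    refine (Finset.card_union_le _ _).trans (add_le_add ?_ ?_)
    · refine Finset.card_biUnion_le.trans ?_
      refine (Finset.sum_le_card_nsmul _ _ r fun a _ => Finset.card_image_le.trans (hZr a)).trans ?_
      simp [hW]
    · exact (Finset.card_filter_le _ _).trans (Finset.card_image_le.trans (by simp [hW]))
  have hZX : ∀ z ∈ Z'.toList, z ∈ X := by
    intro z hz
    simp only [Z', Finset.mem_toList, Finset.mem_union, Finset.mem_biUnion, Finset.mem_univ,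
      true_and, Finset.mem_image, Finset.mem_filter] at hz
    rcases hz with ⟨a, v, hv, rfl⟩ | hz
    · have := hZA a hv
      simp only [Finset.mem_filter] at this
      exact this.2.2
    · exact hz.2
  refine Isolable.mono (d := d + 1 + Z'.toList.length) (by rw [Finset.length_toList]; omega) ?_
  refine Isolable.of_select hX _ hZX fun K hK hconn hKZ => ?_
  obtain ⟨k, hk⟩ := hconn.1
  -- A cut depends only on the vertex of the pair; any color will do, and `k` supplies one.
  let l := e.symm (p, (e k).2)
  have hl : (e l).1 = p := by simp [l]
  -- If `X` has a pair at `p` in `K`, it was selected, so nothing in `K` conflicts with it and the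
  -- connected set `K` is that pair alone. No cut is then needed.
  by_cases hpK : ∃ x ∈ X ∩ K, p = (e x).1
  · obtain ⟨x, ⟨hxX, hxK⟩, hx⟩ := hpK
    have hxe : e.symm (p, (e x).2) = x := by rw [hx]; simp
    have hxZ : x ∈ Z'.toList := by
      simp only [Z', Finset.mem_toList, Finset.mem_union, Finset.mem_filter, Finset.mem_image,
        Finset.mem_univ, true_and]
      exact .inr ⟨⟨(e x).2, hxe⟩, hxX⟩
    have hKx : K = {x} := by
      refine subset_antisymm ?_ (by simpa using hxK)
      rw [← hconn.2 x hxK]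
      refine comp_induction rfl fun a ha b hb hab => ?_
      obtain rfl : a = x := ha
      exact absurd hab (hKZ a hxZ b hb)
    refine .empty_or fun y hy => .inr ?_
    rw [hconn.2 y hy, hKx]
    rw [hKx] at hy
    rw [hy]
  · push Not at hpK
    refine Isolable.of_cut l (by rwa [hl]) (fun x hx y hy hn hn' hc => ?_)
      fun K' hK' hconn' hh => ?_
    · rw [Near, hl] at hn hn'
      have hpx : G.Adj p (e x).1 := hn.resolve_left (hpK x hx)
      push Not at hn'
      rcases hc with hc | hc
      · exact hn'.2 (hc.1 ▸ hpx)
      · have hxe : e.symm ((e x).1, (e x).2) = x := by simp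
        -- Some dominating neighbour of `p` has the color of `x` and sees the vertex of `y`; its
        -- selection would have deleted `y`.
        obtain ⟨v, hv, hvy⟩ := hZd (e x).2 (e y).1 hn'.1 hn'.2
          ⟨(e x).1, by simpa [hpx] using hx.1, hc.1⟩
        refine hKZ (e.symm (v, (e x).2)) ?_ y hy (.inr (by simpa using ⟨hvy, hc.2⟩))
        simp only [Z', Finset.mem_toList, Finset.mem_union, Finset.mem_biUnion, Finset.mem_univ,
          true_and, Finset.mem_image]
        exact .inl ⟨_, v, hv, rfl⟩
    · rw [hl] at hh
      exact hP K' (hK'.trans hK) hconn' hh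

/-- Every clique of `G` that is covered by pairs in `K` has at most `w` vertices. -/
def CliqueBound (G : SimpleGraph V) (e : ι ≃ V × W) (K : Set ι) (w : ℕ) : Prop :=
  ∀ T : Finset V, G.IsClique T → (∀ v ∈ T, ∃ x ∈ K, (e x).1 = v) → T.card ≤ w

/-- A clique in the neighbourhood of `p` extends by `p`, which has to be covered by `K` for the
larger clique to count. -/
theorem CliqueBound.of_adj {K K' : Set ι} {w : ℕ} (hK : CliqueBound G e K (w + 1)) (hK' : K' ⊆ K)
    {p : V} (hp : ∃ x ∈ K, (e x).1 = p) (h : ∀ x ∈ K', G.Adj p (e x).1) :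
    CliqueBound G e K' w := by
  classical
  intro T hT hTK
  have hpT : p ∉ T := fun hpT => by
    obtain ⟨x, hx, rfl⟩ := hTK p hpT
    exact (h x hx).ne rfl
  have := hK (insert p T) ?_ ?_
  · rw [Finset.card_insert_of_notMem hpT] at this
    omega
  · rw [Finset.coe_insert]
    refine hT.insert fun v hv _ => ?_
    obtain ⟨x, hx, rfl⟩ := hTK v hv
    exact h x hx
  · intro v hv
    rcases Finset.mem_insert.1 hv with rfl | hv
    · exact hp
    · obtain ⟨x, hx, rfl⟩ := hTK v hv
      exact ⟨x, hK' hx, rfl⟩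

/-- The vertices of a connected set of pairs lie in one component. -/
theorem Conn.subset_componentIn {K : Set ι} (hK : Conn G H e K) {D : Set V}
    (hD : ∀ x ∈ K, (e x).1 ∈ D) {k : ι} (hk : k ∈ K) {x : ι} (hx : x ∈ K) :
    (e x).1 ∈ componentIn G D (e k).1 := by
  have : comp G H e K k ⊆ {x | (e x).1 ∈ componentIn G D (e k).1} := by
    refine comp_induction (mem_componentIn_self _ _) fun a ha b hb hab => ?_
    rcases hab.near with h | h
    · exact (h ▸ ha : (e b).1 ∈ componentIn G D (e k).1)
    · exact componentIn_closed ha h (hD b hb)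
  rw [hK.2 k hk] at this
  exact this hx

/-- Induction on the clique bound. Each level makes components homogeneous to three consecutive
vertices of an induced path; a component inside the neighbourhood of a path vertex goes to the
induction hypothesis. -/
theorem exists_isolable (s t h : ℕ) : ∃ c : ℕ, ∀ {V W ι : Type} [Fintype V]
    [Fintype W] {G : SimpleGraph V} {H : SimpleGraph W} {e : ι ≃ V × W}, Fintype.card W = h →
    InducedFree (SimpleGraph.pathGraph 6) G →
    InducedFree (subdividedStarWithClique s) G → InducedFree (subdividedStar t) G →
    ∀ (w : ℕ) {X K : Set ι}, Indep G H e X → CliqueBound G e K w →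
      Isolable G H e (c * w) K (X ∩ K) := by
  obtain ⟨c, hc⟩ := exists_isolable_of_homogeneous s t h
  refine ⟨3 * c, fun {V W ι _ _ G H e} hW h6 hs ht w X K hX hw => ?_⟩
  induction w generalizing K with
  | zero =>
    intro k hk
    -- A single pair already covers a clique with one vertex.
    have := hw {(e k).1} (by simp) (by simpa using ⟨k, hk, rfl⟩)
    simp at this
  | succ w ih =>
    have step := @hc V W ι _ _ G H e hW hs ht X
    refine .of_comp fun k₀ hk₀ => ?_
    have hs₀ := comp_subset (G := G) (H := H) (e := e) hk₀
    have hK₀ := conn_comp (G := G) (H := H) (e := e) (P := K) k₀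
    rw [Set.inter_assoc, Set.inter_eq_right.2 hs₀]
    have hk₀' := mem_comp_self (G := G) (H := H) (e := e) K k₀
    set K₀ := comp G H e K k₀
    have hend : ∀ K' ⊆ K₀, ∀ p, (∃ x ∈ K₀, (e x).1 = p) → (∀ x ∈ K', G.Adj p (e x).1) →
        ∀ d, 3 * c * w ≤ d → Isolable G H e d K' (X ∩ K') := fun K' hK' p ⟨x, hx, hp⟩ h d hd =>
      (ih (K := K') (hw.of_adj (hK'.trans hs₀) ⟨x, hs₀ hx, hp⟩ h)).mono hd
    -- The path is sought among the vertices covered by `K₀`, as `hend` requires.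
    let D₀ : Set V := {v | ∃ x ∈ K₀, (e x).1 = v}
    have hD₀ : ∀ v ∈ D₀, componentIn G D₀ v = D₀ := by
      rintro v ⟨x, hx, rfl⟩
      refine subset_antisymm (componentIn_subset ⟨x, hx, rfl⟩) ?_
      rintro _ ⟨y, hy, rfl⟩
      exact hK₀.subset_componentIn (D := D₀) (fun z hz => ⟨z, hz, rfl⟩) hx hy
    set p₁ := (e k₀).1 with hp₁
    rw [show 3 * c * (w + 1) = (3 * c * w + c + c) + c by ring]
    refine step _ p₁ hX fun K₁ hK₁ hconn₁ hh₁ => ?_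
    rcases hh₁ with hh₁ | hh₁
    · exact hend K₁ hK₁ p₁ ⟨k₀, hk₀', rfl⟩ hh₁ _ (by omega)
    obtain ⟨k₁, hk₁⟩ := hconn₁.1
    obtain ⟨p₂, hp₂, h12, d₁, hd₁, h2d⟩ := exists_attachment (G := G) (p := p₁) (v := (e k₁).1) hD₀
      ⟨p₁, ⟨k₀, hk₀', rfl⟩, .inl rfl⟩ ⟨k₁, hK₁ hk₁, rfl⟩ (hh₁ k₁ hk₁)
    have hsub₁ := componentIn_subset (G := G) (D := {x ∈ D₀ | ¬ (p₁ = x ∨ G.Adj p₁ x)})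
      (v := (e k₁).1) ⟨⟨k₁, hK₁ hk₁, rfl⟩, hh₁ k₁ hk₁⟩
    have hKD₁ : ∀ x ∈ K₁, (e x).1 ∈ componentIn G {x ∈ D₀ | ¬ (p₁ = x ∨ G.Adj p₁ x)} (e k₁).1 :=
      fun x hx => hconn₁.subset_componentIn
        (D := {x ∈ D₀ | ¬ (p₁ = x ∨ G.Adj p₁ x)}) (fun z hz => ⟨⟨z, hK₁ hz, rfl⟩, hh₁ z hz⟩) hk₁ hx
    have hD₁ := fun v hv => componentIn_eq_self (G := G) (D := {x ∈ D₀ | ¬ (p₁ = x ∨ G.Adj p₁ x)})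
      (v := (e k₁).1) (x := v) hv
    set D₁ := componentIn G {x ∈ D₀ | ¬ (p₁ = x ∨ G.Adj p₁ x)} (e k₁).1
    refine step _ p₂ hX fun K₂ hK₂ hconn₂ hh₂ => ?_
    rcases hh₂ with hh₂ | hh₂
    · exact hend K₂ (hK₂.trans hK₁) p₂ hp₂ hh₂ _ (by omega)
    obtain ⟨k₂, hk₂⟩ := hconn₂.1
    obtain ⟨p₃, hp₃, h23, d₂, hd₂, h3d⟩ := exists_attachment (G := G) (p := p₂) (v := (e k₂).1) hD₁
      ⟨d₁, hd₁, .inr h2d⟩ (hKD₁ k₂ (hK₂ hk₂)) (hh₂ k₂ hk₂)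
    have hsub₂ := componentIn_subset (G := G) (D := {x ∈ D₁ | ¬ (p₂ = x ∨ G.Adj p₂ x)})
      (v := (e k₂).1) ⟨hKD₁ k₂ (hK₂ hk₂), hh₂ k₂ hk₂⟩
    have hKD₂ : ∀ x ∈ K₂, (e x).1 ∈ componentIn G {x ∈ D₁ | ¬ (p₂ = x ∨ G.Adj p₂ x)} (e k₂).1 :=
      fun x hx => hconn₂.subset_componentIn
        (D := {x ∈ D₁ | ¬ (p₂ = x ∨ G.Adj p₂ x)}) (fun z hz => ⟨hKD₁ z (hK₂ hz), hh₂ z hz⟩) hk₂ hx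
    have hD₂ := fun v hv => componentIn_eq_self (G := G) (D := {x ∈ D₁ | ¬ (p₂ = x ∨ G.Adj p₂ x)})
      (v := (e k₂).1) (x := v) hv
    set D₂ := componentIn G {x ∈ D₁ | ¬ (p₂ = x ∨ G.Adj p₂ x)} (e k₂).1
    refine step _ p₃ hX fun K₃ hK₃ hconn₃ hh₃ => ?_
    have hp₃' := (hsub₁ hp₃).1
    rcases hh₃ with hh₃ | hh₃
    · exact hend K₃ (hK₃.trans (hK₂.trans hK₁)) p₃ hp₃' hh₃ _ le_rfl
    obtain ⟨k₃, hk₃⟩ := hconn₃.1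
    obtain ⟨p₄, hp₄, h34, d₃, hd₃, h4d⟩ := exists_attachment (G := G) (p := p₃) (v := (e k₃).1) hD₂
      ⟨d₂, hd₂, .inr h3d⟩ (hKD₂ k₃ (hK₃ hk₃)) (hh₃ k₃ hk₃)
    have hsub₃ := componentIn_subset (G := G) (D := {x ∈ D₂ | ¬ (p₃ = x ∨ G.Adj p₃ x)})
      (v := (e k₃).1) ⟨hKD₂ k₃ (hK₃ hk₃), hh₃ k₃ hk₃⟩
    have hKD₃ : ∀ x ∈ K₃, (e x).1 ∈ componentIn G {x ∈ D₂ | ¬ (p₃ = x ∨ G.Adj p₃ x)} (e k₃).1 :=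
      fun x hx => hconn₃.subset_componentIn
        (D := {x ∈ D₂ | ¬ (p₃ = x ∨ G.Adj p₃ x)}) (fun z hz => ⟨hKD₂ z (hK₃ hz), hh₃ z hz⟩) hk₃ hx
    have hD₃ := fun v hv => componentIn_eq_self (G := G) (D := {x ∈ D₂ | ¬ (p₃ = x ∨ G.Adj p₃ x)})
      (v := (e k₃).1) (x := v) hv
    set D₃ := componentIn G {x ∈ D₂ | ¬ (p₃ = x ∨ G.Adj p₃ x)} (e k₃).1
    -- No fourth round is needed: a non-neighbour of `p₄` would give an edge `a b` in `D₃` with `p₄`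
    -- adjacent to `a` only, and p₁p₂p₃p₄ab would be an induced path.
    refine hend K₃ (hK₃.trans (hK₂.trans hK₁)) p₄ (hsub₁ (hsub₂ hp₄).1).1 (fun x hx => ?_) _ le_rfl
    by_contra hx'
    obtain ⟨a, ha, b, hb, hab, h4a, h4b⟩ :=
      exists_mixed_edge (hD₃ d₃ hd₃) h4d hd₃ (hKD₃ x hx) hx'
    have n₁ : ∀ v ∈ D₁, ¬ G.Adj p₁ v := fun v hv h => (hsub₁ hv).2 (.inr h)
    have n₂ : ∀ v ∈ D₂, ¬ G.Adj p₂ v := fun v hv h => (hsub₂ hv).2 (.inr h)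
    have n₃ : ∀ v ∈ D₃, ¬ G.Adj p₃ v := fun v hv h => (hsub₃ hv).2 (.inr h)
    have i₂ : ∀ v ∈ D₂, v ∈ D₁ := fun v hv => (hsub₂ hv).1
    have i₃ : ∀ v ∈ D₃, v ∈ D₂ := fun v hv => (hsub₃ hv).1
    exact h6 (pathGraph_six_isIndContained h12 h23 h34 h4a hab (n₁ _ hp₃) (n₁ _ (i₂ _ hp₄))
      (n₁ _ (i₂ _ (i₃ _ ha))) (n₁ _ (i₂ _ (i₃ _ hb))) (n₂ _ hp₄) (n₂ _ (i₃ _ ha)) (n₂ _ (i₃ _ hb))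
      (n₃ _ ha) (n₃ _ hb) h4b)

end Conflict

/-! ### The search tree -/

section SearchTree

variable {V W ι : Type} [Fintype ι] (G : SimpleGraph V) (H : SimpleGraph W)
  (e : ι ≃ V × W)

/-- The total revenue of a set of pairs. -/
noncomputable def weight (rev : ι → ℝ) (X : Set ι) : ℝ := ∑ x, X.indicator rev x

theorem weight_empty (rev : ι → ℝ) : weight rev ∅ = 0 := by simp [weight]

theorem weight_singleton (rev : ι → ℝ) (k : ι) : weight rev {k} = rev k := by
  classical
  simp [weight, Set.indicator_apply]

variable {G H e} in
-- The components partition `P`, and weights add up over them.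
theorem weight_le_of_comp {rev : ι → ℝ} {P X S : Set ι} (hX : X ⊆ P) (hS : S ⊆ P)
    (h : ∀ k ∈ P, weight rev (X ∩ comp G H e P k) ≤ weight rev (S ∩ comp G H e P k)) :
    weight rev X ≤ weight rev S := by
  classical
  have key : ∀ Y ⊆ P, weight rev Y =
      ∑ C ∈ Finset.univ.image (comp G H e P), weight rev (Y ∩ {x | comp G H e P x = C}) := by
    intro Y _
    unfold weight
    rw [Finset.sum_comm]
    refine Finset.sum_congr rfl fun x _ => ?_
    rw [Finset.sum_eq_single (comp G H e P x)]
    · by_cases hx : x ∈ Y <;> simp [hx]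
    · intro C _ hC
      refine Set.indicator_of_notMem ?_ _
      rintro ⟨_, h⟩
      exact hC h.symm
    · simp
  rw [key X hX, key S hS]
  refine Finset.sum_le_sum fun C hC => ?_
  obtain ⟨k, -, rfl⟩ := Finset.mem_image.1 hC
  by_cases hk : k ∈ P
  · have : ∀ Y ⊆ P, Y ∩ {x | comp G H e P x = comp G H e P k} = Y ∩ comp G H e P k := by
      intro Y hY
      ext x
      refine and_congr_right fun hx => ⟨fun hc => ?_, fun hc => comp_eq_of_mem hk hc⟩
      exact (show comp G H e P x = comp G H e P k from hc) ▸ mem_comp_self P x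
    rw [this X hX, this S hS]
    exact h k hk
  · have : ∀ Y ⊆ P, Y ∩ {x | comp G H e P x = comp G H e P k} = ∅ := by
      intro Y hY
      ext x
      refine ⟨fun ⟨hx, hc⟩ => hk (comp_subset (G := G) (H := H) (e := e) (hY hx) ?_), False.elim⟩
      exact (show comp G H e P x = comp G H e P k from hc) ▸ mem_comp_self P k
    rw [this X hX, this S hS]

open Classical in
/-- The budget that is left when one unit is spent at `q`: only the closed neighborhood of `q`
remains available. -/
noncomputable def spend (B : V → ℕ) (q v : V) : ℕ :=
  if v = q then B v - 1 else if G.Adj q v then B v else 0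

variable {G}

theorem exists_clique_sum_const (c : ℕ) :
    ∃ T : Finset V, G.IsClique T ∧ c * G.cliqueNum ≤ ∑ _ ∈ T, c := by
  obtain ⟨T, hT⟩ := G.exists_isNClique_cliqueNum
  exact ⟨T, hT.isClique, by rw [Finset.sum_const, hT.card_eq, smul_eq_mul, mul_comm]⟩

/-- A clique lies in the closed neighbourhood of each of its vertices, so a charge at one of them
costs it a single unit. -/
theorem exists_spend {B : V → ℕ} {T : Finset V} (hT : G.IsClique T) {d : ℕ}
    (hd : d + 1 ≤ ∑ v ∈ T, B v) : ∃ q, 0 < B q ∧ d ≤ ∑ v ∈ T, spend G B q v := by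
  classical
  obtain ⟨q, hqT, hq⟩ : ∃ q ∈ T, 0 < B q := by
    by_contra! h
    rw [Finset.sum_eq_zero fun v hv => Nat.le_zero.1 (h v hv)] at hd
    omega
  refine ⟨q, hq, ?_⟩
  rw [← Finset.add_sum_erase _ _ hqT] at hd ⊢
  have h₁ : spend G B q q = B q - 1 := by simp [spend]
  have h₂ : ∑ v ∈ T.erase q, spend G B q v = ∑ v ∈ T.erase q, B v :=
    Finset.sum_congr rfl fun v hv => by
      obtain ⟨hne, hv⟩ := Finset.mem_erase.1 hv
      simp [spend, hne, hT hqT hv hne.symm]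
  omega

variable (G)

/-- A tree of subproblems: node `i` asks for a heavy independent subset of `P i`, and may still
make moves according to its budget `B i`; its answer is `S i`. -/
structure SearchTree (rev : ι → ℝ) (N : ℕ) (P : ℕ → Set ι) (B : ℕ → V → ℕ) (S : ℕ → Set ι) :
    Prop where
  subset : ∀ i < N, S i ⊆ P i
  nonneg : ∀ i < N, ∀ k ∈ P i, 0 ≤ weight rev (S i ∩ comp G H e (P i) k)
  single : ∀ i < N, ∀ k ∈ P i, comp G H e (P i) k = {k} →
    rev k ≤ weight rev (S i ∩ comp G H e (P i) k)
  select : ∀ i < N, ∀ k ∈ P i, ∀ l q, 0 < B i q → ∃ j < N,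
    P j = sel G H e l (comp G H e (P i) k) ∧ B j = spend G (B i) q ∧
      weight rev (S j) ≤ weight rev (S i ∩ comp G H e (P i) k)
  cut : ∀ i < N, ∀ k ∈ P i, ∀ l q, 0 < B i q → ∃ j < N,
    P j = cut G H e l (comp G H e (P i) k) ∧ B j = spend G (B i) q ∧
      weight rev (S j) ≤ weight rev (S i ∩ comp G H e (P i) k)

variable {G H e}

/-- On every component, the safe move that `X` calls for is among the children, charged to a vertex
of the clique `T`. The child does at least as well as `X` there by induction, and the parent at
least as well as the child. -/
theorem SearchTree.weight_le {rev : ι → ℝ} {N : ℕ} {P : ℕ → Set ι} {B : ℕ → V → ℕ}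
    {S : ℕ → Set ι} (hT : SearchTree G H e rev N P B S) (d : ℕ) {i : ℕ} (hi : i < N) {X : Set ι}
    (hX : Isolable G H e d (P i) X) (hXP : X ⊆ P i)
    (hd : ∃ T : Finset V, G.IsClique T ∧ d ≤ ∑ v ∈ T, B i v) :
    weight rev X ≤ weight rev (S i) := by
  induction d generalizing i X with
  | zero =>
    refine weight_le_of_comp (G := G) (H := H) (e := e) hXP (hT.subset i hi) fun k hk => ?_
    rcases hX k hk with h | h
    · rw [h, weight_empty]
      exact hT.nonneg i hi k hk
    · rcases Set.subset_singleton_iff_eq.1 (h ▸ Set.inter_subset_right :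
        X ∩ comp G H e (P i) k ⊆ {k}) with h' | h'
      · rw [h', weight_empty]
        exact hT.nonneg i hi k hk
      · rw [h', weight_singleton]
        exact hT.single i hi k hk h
  | succ d ih =>
    refine weight_le_of_comp (G := G) (H := H) (e := e) hXP (hT.subset i hi) fun k hk => ?_
    obtain ⟨T, hTc, hTd⟩ := hd
    obtain ⟨q, hq, hqd⟩ := exists_spend hTc hTd
    rcases hX k hk with h | h | ⟨l, ⟨h₁, h₂⟩ | ⟨h₁, h₂⟩⟩
    · rw [h, weight_empty]
      exact hT.nonneg i hi k hk
    · rcases Set.subset_singleton_iff_eq.1 (h ▸ Set.inter_subset_right :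
        X ∩ comp G H e (P i) k ⊆ {k}) with h' | h'
      · rw [h', weight_empty]
        exact hT.nonneg i hi k hk
      · rw [h', weight_singleton]
        exact hT.single i hi k hk h
    · obtain ⟨j, hj, hP, hB, hw⟩ := hT.select i hi k hk l q hq
      exact (ih hj (hP ▸ h₂) (hP ▸ h₁) ⟨T, hTc, hB ▸ hqd⟩).trans hw
    · obtain ⟨j, hj, hP, hB, hw⟩ := hT.cut i hi k hk l q hq
      exact (ih hj (hP ▸ h₂) (hP ▸ h₁) ⟨T, hTc, hB ▸ hqd⟩).trans hw

variable [Fintype V] (G)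

/-- The largest number of units that can be spent. -/
noncomputable def budget (B : V → ℕ) : ℕ := by
  classical
  exact (Finset.univ.filter fun T : Finset V => G.IsClique T).sup fun T => ∑ v ∈ T, B v

variable {G}

theorem le_budget {B : V → ℕ} {T : Finset V} (hT : G.IsClique T) :
    ∑ v ∈ T, B v ≤ budget G B := by
  classical
  exact Finset.le_sup (f := fun T : Finset V => ∑ v ∈ T, B v) (by simpa using hT)

theorem budget_le {B : V → ℕ} {b : ℕ} (h : ∀ T : Finset V, G.IsClique T → ∑ v ∈ T, B v ≤ b) :
    budget G B ≤ b := by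
  classical
  exact Finset.sup_le fun T hT => h T (by simpa using hT)

theorem budget_const_le (c : ℕ) : budget G (fun _ => c) ≤ c * G.cliqueNum :=
  budget_le fun T hT => by
    rw [Finset.sum_const, smul_eq_mul, mul_comm]
    exact Nat.mul_le_mul_left _ hT.card_le_cliqueNum

/-- What a clique `T` can still spend lies at `q` or at neighbours of `q`. These neighbours together
with `q` form a clique, whose sum was larger by one unit before the charge. -/
theorem budget_spend_lt {B : V → ℕ} {q : V} (hq : 0 < B q) :
    budget G (spend G B q) < budget G B := by
  classical
  have hpos : B q ≤ budget G B := by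
    simpa using le_budget (G := G) (B := B) (T := {q}) (by simp)
  suffices h : budget G (spend G B q) ≤ budget G B - 1 by omega
  refine budget_le fun T hT => ?_
  have hT' : G.IsClique (insert q (T.filter (G.Adj q)) : Finset V) := by
    rw [Finset.coe_insert]
    exact (hT.subset fun v hv => (Finset.mem_filter.1 hv).1).insert fun v hv _ => by
      simpa using (Finset.mem_filter.1 hv).2
  have h₁ := le_budget (B := B) hT'
  rw [Finset.sum_insert (by simp)] at h₁
  have h₂ : ∑ v ∈ T, spend G B q v ≤ (B q - 1) + ∑ v ∈ T.filter (G.Adj q), B v := by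
    have : ∀ v ∈ T, spend G B q v ≤ (if v = q then B q - 1 else 0) +
        if G.Adj q v then B v else 0 := by
      intro v _
      unfold spend
      split_ifs with h <;> simp_all
    refine (Finset.sum_le_sum this).trans ?_
    rw [Finset.sum_add_distrib, Finset.sum_filter]
    gcongr
    rw [Finset.sum_ite_eq']
    split_ifs <;> simp
  omega

end SearchTree

/-! ### Reasoning about programs -/

namespace RealRAM

/-- The entry 0 of an array, used as a register. -/
abbrev reg (A : ℕ) : NatExpr := .read A (.const 0)

/-- The multiple of an expression by a constant. -/
def NatExpr.smul (e : NatExpr) : ℕ → NatExpr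
  | 0 => .const 0
  | k + 1 => .add (e.smul k) e

@[simp] theorem NatExpr.eval_smul (σ : State) (e : NatExpr) (k : ℕ) :
    (e.smul k).eval σ = k * e.eval σ := by
  induction k with
  | zero => simp [NatExpr.smul, NatExpr.eval]
  | succ k ih => simp [NatExpr.smul, NatExpr.eval, ih, Nat.succ_mul]

/-- The expression that is 1 if the two given expressions are equal, and 0 otherwise. -/
def NatExpr.eq (e f : NatExpr) : NatExpr := .sub (.const 1) (.add (.sub e f) (.sub f e))

@[simp] theorem NatExpr.eval_eq (σ : State) (e f : NatExpr) :
    (e.eq f).eval σ = if e.eval σ = f.eval σ then 1 else 0 := by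
  simp only [NatExpr.eq, NatExpr.eval]
  split_ifs <;> omega

/-- An upper bound for the number of steps of a program all of whose loops stop after at most `s`
rounds. -/
def Program.bound (s : ℕ) : Program → ℕ
  | .skip => 1
  | .setNat _ i e => i.cost + e.cost + 1
  | .setReal _ i e => i.cost + e.cost + 1
  | .seq p q => p.bound s + q.bound s
  | .branch b p q => b.cost + (p.bound s + q.bound s)
  | .loop b p => s * (b.cost + p.bound s) + b.cost

/-- The exponent that the induction produces is the number of loops in the program text. -/
theorem Program.exists_bound_le (p : Program) :
    ∃ c d : ℕ, ∀ s, 1 ≤ s → p.bound s ≤ c * s ^ d := by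
  induction p with
  | skip => exact ⟨1, 0, fun s _ => by simp [Program.bound]⟩
  | setNat A i e => exact ⟨i.cost + e.cost + 1, 0, fun s _ => by simp [Program.bound]⟩
  | setReal A i e => exact ⟨i.cost + e.cost + 1, 0, fun s _ => by simp [Program.bound]⟩
  | seq p q hp hq =>
    obtain ⟨c, d, h⟩ := hp
    obtain ⟨c', d', h'⟩ := hq
    refine ⟨c + c', d + d', fun s hs => ?_⟩
    calc p.bound s + q.bound s ≤ c * s ^ d + c' * s ^ d' := add_le_add (h s hs) (h' s hs)
      _ ≤ c * s ^ (d + d') + c' * s ^ (d + d') := by gcongr <;> omega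
      _ = _ := by ring
  | branch b p q hp hq =>
    obtain ⟨c, d, h⟩ := hp
    obtain ⟨c', d', h'⟩ := hq
    refine ⟨b.cost + c + c', d + d', fun s hs => ?_⟩
    calc b.cost + (p.bound s + q.bound s) ≤ b.cost * 1 + (c * s ^ d + c' * s ^ d') := by
          rw [mul_one]; gcongr; exacts [h s hs, h' s hs]
      _ ≤ b.cost * s ^ (d + d') + (c * s ^ (d + d') + c' * s ^ (d + d')) := by
          gcongr <;> first | omega | exact Nat.one_le_pow _ _ hs
      _ = _ := by ring
  | loop b p hp =>
    obtain ⟨c, d, h⟩ := hp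
    refine ⟨b.cost + c + b.cost, d + 1, fun s hs => ?_⟩
    have hsd : s ≤ s ^ (d + 1) := Nat.le_self_pow (by omega) s
    calc s * (b.cost + p.bound s) + b.cost ≤ s * b.cost + s * (c * s ^ d) + 1 * b.cost := by
          rw [mul_add, one_mul]; gcongr; exact h s hs
      _ ≤ s ^ (d + 1) * b.cost + s * (c * s ^ d) + s ^ (d + 1) * b.cost := by
          gcongr; exact hs.trans hsd
      _ = _ := by ring

/-- Started on `σ`, the program `p` halts, with loops of at most `s` rounds, and establishes `Q`. -/
def Wp (s : ℕ) (p : Program) (Q : State → Prop) (σ : State) : Prop :=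
  ∃ τ k, Runs p σ τ k ∧ k ≤ p.bound s ∧ Q τ

variable {s : ℕ} {σ : State} {Q : State → Prop}

theorem Wp.mono {p : Program} {Q' : State → Prop} (h : Wp s p Q σ) (hQ : ∀ τ, Q τ → Q' τ) :
    Wp s p Q' σ := by
  obtain ⟨τ, k, h₁, h₂, h₃⟩ := h
  exact ⟨τ, k, h₁, h₂, hQ τ h₃⟩

theorem Wp.skip (h : Q σ) : Wp s .skip Q σ := ⟨σ, 1, .skip σ, le_rfl, h⟩

theorem Wp.setNat {A : ℕ} {i e : NatExpr} (h : Q (σ.setNat A (i.eval σ) (e.eval σ))) :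
    Wp s (.setNat A i e) Q σ := ⟨_, _, .setNat σ A i e, le_rfl, h⟩

theorem Wp.setReal {A : ℕ} {i : NatExpr} {e : RealExpr}
    (h : Q (σ.setReal A (i.eval σ) (e.eval σ))) :
    Wp s (.setReal A i e) Q σ := ⟨_, _, .setReal σ A i e, le_rfl, h⟩

theorem Wp.seq {p q : Program} (h : Wp s p (Wp s q Q) σ) : Wp s (.seq p q) Q σ := by
  obtain ⟨τ, k, h₁, h₂, υ, l, h₃, h₄, h₅⟩ := h
  exact ⟨υ, k + l, .seq h₁ h₃, add_le_add h₂ h₄, h₅⟩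

theorem Wp.branch {b : Test} {p q : Program} (h₁ : b.Holds σ → Wp s p Q σ)
    (h₂ : ¬ b.Holds σ → Wp s q Q σ) : Wp s (.branch b p q) Q σ := by
  by_cases hb : b.Holds σ
  · obtain ⟨τ, k, hr, hk, hQ⟩ := h₁ hb
    exact ⟨τ, _, .branchTrue hb hr, by simp only [Program.bound]; omega, hQ⟩
  · obtain ⟨τ, k, hr, hk, hQ⟩ := h₂ hb
    exact ⟨τ, _, .branchFalse hb hr, by simp only [Program.bound]; omega, hQ⟩

/-- The invariant is indexed by the number of rounds made. That a further round is entered only when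
`j < s` gives both termination and the step bound. -/
theorem Wp.loop {b : Test} {p : Program} (I : ℕ → State → Prop) (h₀ : I 0 σ)
    (hs : ∀ j τ, I j τ → b.Holds τ → j < s ∧ Wp s p (I (j + 1)) τ)
    (hQ : ∀ j τ, I j τ → ¬ b.Holds τ → Q τ) : Wp s (.loop b p) Q σ := by
  suffices h : ∀ r j τ, s - j = r → I j τ → ∃ υ k, Runs (.loop b p) τ υ k ∧
      k ≤ r * (b.cost + p.bound s) + b.cost ∧ Q υ from h s 0 σ rfl h₀
  intro r
  induction r with
  | zero =>
    intro j τ hj hI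
    by_cases hb : b.Holds τ
    · have := (hs j τ hI hb).1
      omega
    · exact ⟨τ, _, .loopDone hb, by simp, hQ j τ hI hb⟩
  | succ r ih =>
    intro j τ hj hI
    by_cases hb : b.Holds τ
    · obtain ⟨-, υ, k, hr, hk, hI'⟩ := hs j τ hI hb
      obtain ⟨χ, l, hr', hl, hQ'⟩ := ih (j + 1) υ (by omega) hI'
      refine ⟨χ, _, .loopStep hb hr hr', ?_, hQ'⟩
      calc b.cost + k + l ≤ b.cost + p.bound s + (r * (b.cost + p.bound s) + b.cost) := by omega
        _ = _ := by ring
    · exact ⟨τ, _, .loopDone hb, by simp, hQ j τ hI hb⟩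

@[simp] theorem State.setNat_real (σ : State) (A i v : ℕ) : (σ.setNat A i v).real = σ.real := rfl

@[simp] theorem State.setNat_nat_self (σ : State) (A i v : ℕ) :
    (σ.setNat A i v).nat A = Function.update (σ.nat A) i v := by simp [State.setNat]

@[simp] theorem State.setNat_nat_of_ne (σ : State) {A B : ℕ} (h : B ≠ A) (i v : ℕ) :
    (σ.setNat A i v).nat B = σ.nat B := by simp [State.setNat, h]

@[simp] theorem State.setReal_nat (σ : State) (A i : ℕ) (v : ℝ) :
    (σ.setReal A i v).nat = σ.nat := rfl

@[simp] theorem State.setReal_real_self (σ : State) (A i : ℕ) (v : ℝ) :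
    (σ.setReal A i v).real A = Function.update (σ.real A) i v := by simp [State.setReal]

@[simp] theorem State.setReal_real_of_ne (σ : State) {A B : ℕ} (h : B ≠ A) (i : ℕ) (v : ℝ) :
    (σ.setReal A i v).real B = σ.real B := by simp [State.setReal, h]

/-- `τ` differs from `σ` at most in the arrays of naturals that are listed in `W`, and in the
arrays of reals other than the input. -/
def Frame (W : List ℕ) (σ τ : State) : Prop :=
  (∀ A, A ∉ W → τ.nat A = σ.nat A) ∧ τ.real 0 = σ.real 0

theorem Frame.refl (W : List ℕ) (σ : State) : Frame W σ σ := ⟨fun _ _ => rfl, rfl⟩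

theorem Frame.trans {W : List ℕ} {σ τ υ : State} (h : Frame W σ τ) (h' : Frame W τ υ) :
    Frame W σ υ := ⟨fun A hA => (h'.1 A hA).trans (h.1 A hA), h'.2.trans h.2⟩

theorem Frame.mono {W W' : List ℕ} {σ τ : State} (h : Frame W σ τ) (hW : W ⊆ W') :
    Frame W' σ τ := ⟨fun A hA => h.1 A fun hA' => hA (hW hA'), h.2⟩

theorem Frame.setNat {W : List ℕ} {σ τ : State} (h : Frame W σ τ) {A : ℕ} (hA : A ∈ W)
    (i v : ℕ) : Frame W σ (τ.setNat A i v) := by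
  refine ⟨fun B hB => ?_, h.2⟩
  have : B ≠ A := fun e => hB (e ▸ hA)
  rw [State.setNat_nat_of_ne _ this, h.1 B hB]

theorem Frame.setReal {W : List ℕ} {σ τ : State} (h : Frame W σ τ) {A : ℕ} (hA : A ≠ 0)
    (i : ℕ) (v : ℝ) : Frame W σ (τ.setReal A i v) :=
  ⟨h.1, by rw [State.setReal_real_of_ne _ hA.symm, h.2]⟩

/-- Run `p` with the register `x` taking the values below `e`. -/
def Program.forLoop (x : ℕ) (e : NatExpr) (p : Program) : Program :=
  .seq (.setNat x (.const 0) (.const 0)) (.loop (.neg (.natLe e (reg x)))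
    (.seq p (.setNat x (.const 0) (.add (reg x) (.const 1)))))

/-- The bound `e` is evaluated anew in each round, so the invariant has to fix its value; the body
has to hand back the counter unchanged. -/
theorem Wp.forLoop {x : ℕ} {e : NatExpr} {p : Program} {N : ℕ} (hN : N ≤ s)
    (I : ℕ → State → Prop) (h₀ : I 0 (σ.setNat x 0 0))
    (he : ∀ j τ, I j τ → e.eval τ = N)
    (hs : ∀ j < N, ∀ τ, τ.nat x 0 = j → I j τ →
      Wp s p (fun υ => υ.nat x 0 = j ∧ I (j + 1) (υ.setNat x 0 (j + 1))) τ)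
    (hQ : ∀ τ, I N τ → Q τ) : Wp s (.forLoop x e p) Q σ := by
  refine .seq (.setNat ?_)
  refine .loop (fun j τ => I j τ ∧ τ.nat x 0 = j ∧ j ≤ N) ⟨h₀, by simp [NatExpr.eval], by omega⟩
    ?_ ?_
  · rintro j τ ⟨hI, hx, hj⟩ hb
    simp only [Test.Holds, NatExpr.eval, he j τ hI, hx, not_le] at hb
    refine ⟨by omega, .seq ((hs j hb τ hx hI).mono ?_)⟩
    rintro υ ⟨hx', hI'⟩
    refine .setNat ?_
    simp only [NatExpr.eval, hx']
    exact ⟨hI', by simp, hb⟩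
  · rintro j τ ⟨hI, hx, hj⟩ hb
    simp only [Test.Holds, NatExpr.eval, he j τ hI, hx, not_not] at hb
    obtain rfl : j = N := by omega
    exact hQ τ hI

/-- A loop that fills the `N` entries of the array `A` from `b` on with the values of `g`. -/
theorem Wp.fill {A x : ℕ} {W : List ℕ} {e : NatExpr} {p : Program} {N : ℕ} (b : ℕ) (g : ℕ → ℕ)
    (hN : N ≤ s) (hAx : x ≠ A) (hxW : x ∉ W)
    (he : ∀ τ, Frame (A :: x :: W) σ τ → e.eval τ = N)
    (hp : ∀ j < N, ∀ τ, Frame (A :: x :: W) σ τ → τ.nat x 0 = j →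
      (∀ i < j, τ.nat A (b + i) = g i) → (∀ y, y < b ∨ b + j ≤ y → τ.nat A y = σ.nat A y) →
      Wp s p (fun υ => Frame (A :: W) τ υ ∧ υ.nat A = Function.update (τ.nat A) (b + j) (g j)) τ)
    (hQ : ∀ τ, Frame (A :: x :: W) σ τ → (∀ i < N, τ.nat A (b + i) = g i) →
      (∀ y, y < b ∨ b + N ≤ y → τ.nat A y = σ.nat A y) → Q τ) : Wp s (.forLoop x e p) Q σ := by
  refine .forLoop hN (fun j τ => Frame (A :: x :: W) σ τ ∧ (∀ i < j, τ.nat A (b + i) = g i) ∧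
    ∀ y, y < b ∨ b + j ≤ y → τ.nat A y = σ.nat A y) ?_ (fun j τ h => he τ h.1) ?_
    fun τ h => hQ τ h.1 h.2.1 h.2.2
  · refine ⟨(Frame.refl _ _).setNat (by simp) _ _, by simp, fun y _ => ?_⟩
    rw [State.setNat_nat_of_ne _ hAx.symm]
  · rintro j hj τ hx ⟨hF, hI, hO⟩
    refine (hp j hj τ hF hx hI hO).mono ?_
    rintro υ ⟨hF', hυ⟩
    refine ⟨by rw [hF'.1 x (by simp [hAx, hxW]), hx],
      (hF.trans (hF'.mono (by intro; simp; tauto))).setNat (by simp) _ _,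
      fun i hi => ?_, fun y hy => ?_⟩
    · rw [State.setNat_nat_of_ne _ hAx.symm, hυ, Function.update_apply]
      split_ifs with h
      · obtain rfl : i = j := by omega
        rfl
      · exact hI i (by omega)
    · rw [State.setNat_nat_of_ne _ hAx.symm, hυ, Function.update_of_ne (by omega)]
      exact hO y (by omega)

end RealRAM

/-! ### The program -/

namespace RealRAM

-- Numbers of arrays of naturals. The first two hold the input and the third the output, as
-- `inputState` and `Outputs` prescribe. Of the arrays whose names begin with `r`, only entry 0 is
-- used. Data of the nodes are stored in consecutive rows, with tabulated row starts, since indices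
-- cannot be multiplied.
notation "aVerts" => 0
notation "aAdj" => 1
notation "aOut" => 2
notation "aPairs" => 3
notation "aRow" => 4
notation "aVert" => 5
notation "aCol" => 6
notation "aPat" => 7
notation "aNode" => 8
notation "aCount" => 9
notation "aMask" => 10
notation "aBudget" => 11
notation "aComp" => 12
notation "aSol" => 13
notation "aParent" => 14
notation "aKey" => 15
notation "aMaskPtr" => 16
notation "aBudgetPtr" => 17
notation "aCur" => 18
notation "aSel" => 19
notation "aCut" => 20
notation "rK" => 21
notation "rR" => 22
notation "rX" => 23
notation "rY" => 24
notation "rL" => 25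
notation "rQ" => 26
notation "rFlag" => 27

/-- The pairs of a vertex and a color, in the order in which the revenues are stored. -/
abbrev pairEquiv (n h : ℕ) : Fin (n * h) ≃ Fin n × Fin h := finProdFinEquiv.symm

/-! ### Precomputed tables, the conflict test, and the computation of a component. -/

section Environment

variable {n h : ℕ} (G : SimpleGraph (Fin n)) (H : SimpleGraph (Fin h)) (rev : Fin (n * h) → ℝ)

open Classical in
/-- The tables that are computed in the beginning. -/
structure Env (σ : State) : Prop where
  verts : σ.nat aVerts 0 = n
  adj : ∀ u v : Fin n, σ.nat aAdj (u * n + v) = if G.Adj u v then 1 else 0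
  pairs : σ.nat aPairs 0 = n * h
  row : ∀ u < n, σ.nat aRow u = u * n
  vert : ∀ k < n * h, σ.nat aVert k = k / h
  col : ∀ k < n * h, σ.nat aCol k = k % h
  pat : ∀ a b : Fin h, σ.nat aPat (h * a + b) = if H.Adj a b then 1 else 0
  rev : ∀ k : Fin (n * h), σ.real 0 k = rev k

variable {G H rev}

theorem Env.frame {σ τ : State} {W : List ℕ} (hσ : Env G H rev σ) (h : Frame W σ τ)
    (hW : ∀ A ∈ [aVerts, aAdj, aPairs, aRow, aVert, aCol, aPat], A ∉ W := by decide) :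
    Env G H rev τ := by
  constructor
  · rw [h.1 _ (hW _ (by simp))]; exact hσ.verts
  · rw [h.1 _ (hW _ (by simp))]; exact hσ.adj
  · rw [h.1 _ (hW _ (by simp))]; exact hσ.pairs
  · rw [h.1 _ (hW _ (by simp))]; exact hσ.row
  · rw [h.1 _ (hW _ (by simp))]; exact hσ.vert
  · rw [h.1 _ (hW _ (by simp))]; exact hσ.col
  · rw [h.1 _ (hW _ (by simp))]; exact hσ.pat
  · rw [h.2]; exact hσ.rev

def adjE (u v : NatExpr) : NatExpr := .read aAdj (.add (.read aRow u) v)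

/-- Whether two vertices are equal or adjacent. -/
def closedE (u v : NatExpr) : NatExpr := .add (adjE u v) (u.eq v)

def sameE (k l : NatExpr) : NatExpr := (NatExpr.read aVert k).eq (.read aVert l)

def nearE (k l : NatExpr) : NatExpr := closedE (.read aVert k) (.read aVert l)

/-- A truncated difference of truth values means "the first but not the second". The two summands
are never both 1, because adjacent vertices differ. -/
def conflictE (h : ℕ) (k l : NatExpr) : NatExpr :=
  .add (.sub (adjE (.read aVert k) (.read aVert l))
      (.read aPat (.add ((NatExpr.read aCol k).smul h) (.read aCol l))))
    (.sub (sameE k l) ((NatExpr.read aCol k).eq (.read aCol l)))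

variable {σ : State} {k l : NatExpr}

open Classical in
theorem Env.eval_adjE (hσ : Env G H rev σ) {x y : Fin n} (hk : k.eval σ = x) (hl : l.eval σ = y) :
    (adjE k l).eval σ = if G.Adj x y then 1 else 0 := by
  simp [adjE, NatExpr.eval, hk, hl, hσ.row, hσ.adj]

open Classical in
theorem Env.eval_closedE (hσ : Env G H rev σ) {x y : Fin n} (hk : k.eval σ = x)
    (hl : l.eval σ = y) : (closedE k l).eval σ = if x = y ∨ G.Adj x y then 1 else 0 := by
  simp only [closedE, NatExpr.eval, NatExpr.eval_eq, hσ.eval_adjE hk hl, hk, hl, Fin.val_inj]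
  by_cases h : x = y
  · subst h
    simp
  · simp [h]

theorem Env.eval_vert (hσ : Env G H rev σ) {x : Fin (n * h)} (hk : k.eval σ = x) :
    (NatExpr.read aVert k).eval σ = (pairEquiv n h x).1 := by
  simp [NatExpr.eval, hk, hσ.vert]

theorem Env.eval_col (hσ : Env G H rev σ) {x : Fin (n * h)} (hk : k.eval σ = x) :
    (NatExpr.read aCol k).eval σ = (pairEquiv n h x).2 := by
  simp [NatExpr.eval, hk, hσ.col]

open Classical in
theorem Env.eval_sameE (hσ : Env G H rev σ) {x y : Fin (n * h)} (hk : k.eval σ = x)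
    (hl : l.eval σ = y) :
    (sameE k l).eval σ = if (pairEquiv n h x).1 = (pairEquiv n h y).1 then 1 else 0 := by
  simp only [sameE, NatExpr.eval_eq, hσ.eval_vert hk, hσ.eval_vert hl, Fin.val_inj]

open Classical in
theorem Env.eval_nearE (hσ : Env G H rev σ) {x y : Fin (n * h)} (hk : k.eval σ = x)
    (hl : l.eval σ = y) :
    (nearE k l).eval σ = if Near G (pairEquiv n h) x y then 1 else 0 :=
  (hσ.eval_closedE (hσ.eval_vert hk) (hσ.eval_vert hl)).trans (if_congr Iff.rfl rfl rfl)

open Classical in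
theorem Env.eval_conflictE (hσ : Env G H rev σ) {x y : Fin (n * h)} (hk : k.eval σ = x)
    (hl : l.eval σ = y) :
    (conflictE h k l).eval σ = if Conflict G H (pairEquiv n h) x y then 1 else 0 := by
  have h₁ := hσ.eval_adjE (hσ.eval_vert hk) (hσ.eval_vert hl)
  have h₂ := hσ.eval_sameE hk hl
  have h₃ := hσ.eval_col hk
  have h₄ := hσ.eval_col hl
  have h₅ := hσ.pat (pairEquiv n h x).2 (pairEquiv n h y).2
  have h₆ : (NatExpr.read aPat (.add ((NatExpr.read aCol k).smul h) (.read aCol l))).eval σ =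
      if H.Adj (pairEquiv n h x).2 (pairEquiv n h y).2 then 1 else 0 := by
    rw [← h₅, NatExpr.eval, NatExpr.eval, NatExpr.eval_smul, h₃, h₄]
  change (NatExpr.eval σ _ - NatExpr.eval σ _) + (NatExpr.eval σ _ - NatExpr.eval σ _) = _
  rw [h₁, h₂, h₆, NatExpr.eval_eq, h₃, h₄]
  unfold Conflict
  simp only [Fin.val_inj]
  by_cases e₁ : (pairEquiv n h x).1 = (pairEquiv n h y).1
  · simp only [e₁, SimpleGraph.irrefl, if_false, if_true, zero_tsub, zero_add, true_and, false_and,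
      or_false, ne_eq, ite_not]
    split_ifs <;> rfl
  · simp only [e₁, if_false, zero_tsub, add_zero, false_and, false_or]
    split_ifs <;> simp_all

open Classical in
/-- The entries of `f` from `b` on are the indicator function of `P`. -/
def IsMask {m : ℕ} (f : ℕ → ℕ) (b : ℕ) (P : Set (Fin m)) : Prop :=
  ∀ x : Fin m, f (b + x) = if x ∈ P then 1 else 0

/-- Compute the component of the pair in register `rK` in the mask of the node in `aNode`. -/
def compProg (h : ℕ) : Program :=
  .seq (.forLoop rX (reg aPairs) (.setNat aCur (reg rX) (.const 0)))
  (.seq (.setNat aCur (reg rK) (.const 1))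
  (.forLoop rR (reg aPairs) (.forLoop rX (reg aPairs) (.forLoop rY (reg aPairs)
    -- Three truth values add up to 3 exactly if all of them hold.
    (.branch (.natLe (.const 3) (.add (.add (.read aCur (reg rX))
        (.read aMask (.add (.read aMaskPtr (reg aNode)) (reg rY))))
        (conflictE h (reg rX) (reg rY))))
      (.setNat aCur (reg rY) (.const 1)) .skip)))))

theorem IsMask.update_insert {m : ℕ} {f : ℕ → ℕ} {b : ℕ} {P : Set (Fin m)} (hf : IsMask f b P)
    (x : Fin m) : IsMask (Function.update f (b + x) 1) b (insert x P) := by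
  intro y
  by_cases h : y = x
  · simp [h]
  · have : (y : ℕ) ≠ x := fun e => h (Fin.ext e)
    have hiff : y ∈ insert x P ↔ y ∈ P := by simp [h]
    rw [Function.update_of_ne (by omega), hf y]
    by_cases hy : y ∈ P
    · rw [if_pos hy, if_pos (hiff.2 hy)]
    · rw [if_neg hy, if_neg (mt hiff.1 hy)]

/-- A pass that starts with an incomplete set adds at least one pair, so as many passes as there are
pairs complete the component. -/
theorem wp_compProg {s : ℕ} (hs : n * h ≤ s) {Q : State → Prop} (hσ : Env G H rev σ)
    {P : Set (Fin (n * h))} {k : Fin (n * h)}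
    (hP : IsMask (σ.nat aMask) (σ.nat aMaskPtr (σ.nat aNode 0)) P) (hk : σ.nat rK 0 = k)
    (hQ : ∀ τ, Frame [aCur, rR, rX, rY] σ τ →
      IsMask (τ.nat aCur) 0 (comp G H (pairEquiv n h) P k) → Q τ) :
    Wp s (compProg h) Q σ := by
  classical
  refine .seq (.fill (A := aCur) (x := rX) (W := []) 0 (fun _ => 0) hs (by decide) (by decide)
    (fun τ hF => (hσ.frame hF).pairs) (fun j hj τ hF hx _ _ => .setNat ?_) fun τ hF hz _ => ?_)
  · simp only [NatExpr.eval, hx, State.setNat_nat_self, zero_add, and_true]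
    exact (Frame.refl _ _).setNat (by simp) _ _
  refine .seq (.setNat ?_)
  have hk' : (reg rK).eval τ = k := by
    simp only [NatExpr.eval]
    rw [hF.1 rK (by decide), hk]
  rw [hk', NatExpr.eval]
  set τ₁ := τ.setNat aCur k 1 with hτ₁
  have hF₁ : Frame [aCur, rR, rX, rY] σ τ₁ := (hF.mono (by decide)).setNat (by decide) _ _
  have hm₁ : IsMask (τ₁.nat aCur) 0 {k} := by
    have : IsMask (τ.nat aCur) 0 (∅ : Set (Fin (n * h))) := fun x => by
      rw [hz x x.2]
      simp
    have h' := this.update_insert k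
    simpa [hτ₁] using h'
  set C := comp G H (pairEquiv n h) P k with hC
  let I : Set (Fin (n * h)) → State → Prop := fun T τ =>
    Frame [aCur, rR, rX, rY] σ τ ∧ IsMask (τ.nat aCur) 0 T ∧ T ⊆ C
  have hI : ∀ T τ A v, A ∈ [rR, rX, rY] → I T τ → I T (τ.setNat A 0 v) := by
    intro T τ A v hA h'
    have hA' : aCur ≠ A := by rintro rfl; simp at hA
    refine ⟨h'.1.setNat (by simp only [List.mem_cons] at hA ⊢; tauto) _ _, ?_, h'.2.2⟩
    rw [State.setNat_nat_of_ne _ hA']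
    exact h'.2.1
  have hpairs : ∀ T τ, I T τ → (reg aPairs).eval τ = n * h := fun T τ h' =>
    (hσ.frame h'.1).pairs
  refine .forLoop hs (fun j τ => ∃ T, I T τ ∧ k ∈ T ∧ (T = C ∨ j < T.ncard)) ?_
    (fun j τ ⟨T, h', _⟩ => hpairs T τ h') ?_ ?_
  · exact ⟨{k}, hI _ _ _ _ (by decide) ⟨hF₁, hm₁, by simpa using mem_comp_self P k⟩, rfl,
      .inr (by simp)⟩
  · rintro r hr τ hτr ⟨T₀, hT₀, hkT₀, hcard⟩
    refine .forLoop hs (fun x τ => τ.nat rR 0 = r ∧ ∃ T, I T τ ∧ T₀ ⊆ T ∧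
      ∀ x' ∈ T₀, (x' : ℕ) < x → ∀ y ∈ P, Conflict G H (pairEquiv n h) x' y → y ∈ T) ?_
      (fun j τ ⟨_, T, h', _⟩ => hpairs T τ h') ?_ ?_
    · exact ⟨by simpa using hτr, T₀, hI _ _ _ _ (by decide) hT₀, subset_rfl, by simp⟩
    · rintro x hx τ hτx ⟨hτr, T₁, hT₁, hsub₁, hdone₁⟩
      refine .forLoop hs (fun y τ => τ.nat rR 0 = r ∧ τ.nat rX 0 = x ∧ ∃ T, I T τ ∧ T₁ ⊆ T ∧
        (⟨x, hx⟩ ∈ T₀ → ∀ y' ∈ P, (y' : ℕ) < y →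
          Conflict G H (pairEquiv n h) ⟨x, hx⟩ y' → y' ∈ T)) ?_
        (fun j τ ⟨_, _, T, h', _⟩ => hpairs T τ h') ?_ ?_
      · exact ⟨by simpa using hτr, by simpa using hτx, T₁, hI _ _ _ _ (by decide) hT₁, subset_rfl,
          by simp⟩
      · rintro y hy τ hτy ⟨hτr, hτx, T, hT, hsub, hdone⟩
        have hE := hσ.frame hT.1
        have hPτ : τ.nat aMask (τ.nat aMaskPtr (τ.nat aNode 0) + y) =
            if (⟨y, hy⟩ : Fin (n * h)) ∈ P then 1 else 0 := by
          rw [hT.1.1 aMask (by decide), hT.1.1 aMaskPtr (by decide), hT.1.1 aNode (by decide)]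
          exact hP ⟨y, hy⟩
        have hTx : τ.nat aCur x = if (⟨x, hx⟩ : Fin (n * h)) ∈ T then 1 else 0 := by
          simpa using hT.2.1 ⟨x, hx⟩
        have hcf := hE.eval_conflictE (k := reg rX) (l := reg rY) (x := ⟨x, hx⟩) (y := ⟨y, hy⟩)
          (by simpa [NatExpr.eval] using hτx) (by simpa [NatExpr.eval] using hτy)
        have hiff : (Test.natLe (.const 3) (.add (.add (.read aCur (reg rX))
            (.read aMask (.add (.read aMaskPtr (reg aNode)) (reg rY))))
            (conflictE h (reg rX) (reg rY)))).Holds τ ↔ (⟨x, hx⟩ : Fin (n * h)) ∈ T ∧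
              (⟨y, hy⟩ : Fin (n * h)) ∈ P ∧ Conflict G H (pairEquiv n h) ⟨x, hx⟩ ⟨y, hy⟩ := by
          simp only [Test.Holds, NatExpr.eval, hcf, hτx, hτy, hTx, hPτ]
          split_ifs <;> simp_all
        refine .branch (fun hb => .setNat ?_) fun hb => .skip ?_
        · rw [hiff] at hb
          simp only [NatExpr.eval, hτy]
          refine ⟨by simp [hτy], by simp [hτr], by simp [hτx], insert ⟨y, hy⟩ T,
            hI _ _ _ _ (by decide) ⟨hT.1.setNat (by decide) _ _, ?_, ?_⟩,
            hsub.trans (Set.subset_insert _ _), ?_⟩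
          · have := hT.2.1.update_insert ⟨y, hy⟩
            simpa using this
          · exact Set.insert_subset (comp_closed (hT.2.2 hb.1) hb.2.2 hb.2.1) hT.2.2
          · intro hxT y' hy' hlt hc
            rcases Nat.lt_succ_iff_lt_or_eq.1 hlt with hlt | heq
            · exact .inr (hdone hxT y' hy' hlt hc)
            · exact .inl (Fin.ext heq)
        · rw [hiff] at hb
          refine ⟨hτy, by simpa using hτr, by simpa using hτx, T, hI _ _ _ _ (by decide) hT,
            hsub, ?_⟩
          intro hxT y' hy' hlt hc
          rcases Nat.lt_succ_iff_lt_or_eq.1 hlt with hlt | heq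
          · exact hdone hxT y' hy' hlt hc
          · obtain rfl : y' = ⟨y, hy⟩ := Fin.ext heq
            exact absurd ⟨hsub (hsub₁ hxT), hy', hc⟩ hb
      · rintro τ ⟨hτr, hτx, T, hT, hsub, hdone⟩
        refine ⟨hτx, by simpa using hτr, T, hI _ _ _ _ (by decide) hT, hsub₁.trans hsub, ?_⟩
        intro x' hx' hlt y hy hc
        rcases Nat.lt_succ_iff_lt_or_eq.1 hlt with hlt | heq
        · exact hsub (hdone₁ x' hx' hlt y hy hc)
        · obtain rfl : x' = ⟨x, hx⟩ := Fin.ext heq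
          exact hdone hx' y hy y.2 hc
    · rintro τ ⟨hτr, T, hT, hsub, hdone⟩
      refine ⟨hτr, T, hI _ _ _ _ (by decide) hT, hsub hkT₀, ?_⟩
      by_cases hTC : T = C
      · exact .inl hTC
      have hT₀C : T₀ ≠ C := fun h' => hTC (subset_antisymm hT.2.2 (h' ▸ hsub))
      right
      have hlt := hcard.resolve_left hT₀C
      -- A pass that adds nothing shows that the set is closed under conflicts, so that it is the
      -- whole component.
      have hne : T₀ ≠ T := by
        rintro rfl
        refine hTC (subset_antisymm hT.2.2 (comp_induction hkT₀ fun a ha b hb hab => ?_))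
        exact hdone a ha a.2 b hb hab
      have := Set.ncard_lt_ncard (hsub.ssubset_of_ne hne)
      omega
  · rintro τ ⟨T, hT, hkT, hcard⟩
    have : T = C := hcard.resolve_right fun hlt => by
      have := Set.ncard_le_card T
      simp only [Nat.card_eq_fintype_card, Fintype.card_fin] at this
      omega
    exact hQ τ hT.1 (this ▸ hT.2.1)

end Environment

end RealRAM

/-! ### Storing the nodes of the search tree and adding children. -/

namespace RealRAM

theorem row_lt {i N m x : ℕ} (hi : i < N) (hx : x < m) : i * m + x < N * m :=
  calc i * m + x < i * m + m := by omega
    _ = (i + 1) * m := by ring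
    _ ≤ N * m := Nat.mul_le_mul_right _ hi

section Nodes

variable {n h : ℕ} {G : SimpleGraph (Fin n)} {H : SimpleGraph (Fin h)} {rev : Fin (n * h) → ℝ}
  {m : ℕ}

/-- The set of pairs of the node `j`. -/
def nodeSet (m : ℕ) (σ : State) (j : ℕ) : Set (Fin m) := {x | σ.nat aMask (j * m + x) = 1}

/-- The budget of the node `j`. -/
def nodeBudget (n : ℕ) (σ : State) (j : ℕ) (v : Fin n) : ℕ := σ.nat aBudget (j * n + v)

theorem IsMask.nodeSet_eq {σ : State} {j : ℕ} {P : Set (Fin m)}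
    (h : IsMask (σ.nat aMask) (j * m) P) : nodeSet m σ j = P := by
  ext x
  simp only [nodeSet, Set.mem_ofPred_eq, h x]
  split_ifs with hx <;> simp [hx]

/-- The memory holds `N` nodes. -/
structure Nodes (n m N : ℕ) (σ : State) : Prop where
  count : σ.nat aCount 0 = N
  -- The case `j = N` locates the row in which the next node will be written.
  maskPtr : ∀ j ≤ N, σ.nat aMaskPtr j = j * m
  budgetPtr : ∀ j ≤ N, σ.nat aBudgetPtr j = j * n
  mask : ∀ j < N, IsMask (σ.nat aMask) (j * m) (nodeSet m σ j)

/-- Between `σ` and `τ`, the nodes from `N` up to `N'` have been added, as children of `i`. Their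
keys, sets and budgets are exactly those that satisfy `R`. -/
structure Grown (i N N' : ℕ) (R : ℕ → Set (Fin m) → (Fin n → ℕ) → Prop) (σ τ : State) :
    Prop where
  nodes : Nodes n m N' τ
  le : N ≤ N'
  old : ∀ j < N, nodeSet m τ j = nodeSet m σ j ∧ nodeBudget n τ j = nodeBudget n σ j ∧
    τ.nat aParent j = σ.nat aParent j ∧ τ.nat aKey j = σ.nat aKey j
  new : ∀ j, N ≤ j → j < N' →
    τ.nat aParent j = i ∧ R (τ.nat aKey j) (nodeSet m τ j) (nodeBudget n τ j)
  all : ∀ key P B, R key P B → ∃ j, N ≤ j ∧ j < N' ∧ τ.nat aKey j = key ∧ nodeSet m τ j = P ∧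
    nodeBudget n τ j = B

variable {i N N' N'' : ℕ} {R R' : ℕ → Set (Fin m) → (Fin n → ℕ) → Prop} {σ τ υ : State}

theorem Grown.congr (h : Grown i N N' R σ τ) (hR : ∀ key P B, R key P B ↔ R' key P B) :
    Grown i N N' R' σ τ :=
  ⟨h.nodes, h.le, h.old, fun j h₁ h₂ => ⟨(h.new j h₁ h₂).1, (hR _ _ _).1 (h.new j h₁ h₂).2⟩,
    fun key P B h' => h.all key P B ((hR _ _ _).2 h')⟩

theorem Grown.trans (h : Grown i N N' R σ τ) (h' : Grown i N' N'' R' τ υ) :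
    Grown i N N'' (fun key P B => R key P B ∨ R' key P B) σ υ := by
  refine ⟨h'.nodes, h.le.trans h'.le, fun j hj => ?_, fun j h₁ h₂ => ?_, fun key P B hR => ?_⟩
  · obtain ⟨a, b, c, d⟩ := h.old j hj
    obtain ⟨a', b', c', d'⟩ := h'.old j (hj.trans_le h.le)
    exact ⟨a'.trans a, b'.trans b, c'.trans c, d'.trans d⟩
  · rcases lt_or_ge j N' with hj | hj
    · obtain ⟨a, b, c, d⟩ := h'.old j hj
      rw [a, b, c, d]
      exact ⟨(h.new j h₁ hj).1, .inl (h.new j h₁ hj).2⟩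
    · exact ⟨(h'.new j hj h₂).1, .inr (h'.new j hj h₂).2⟩
  · rcases hR with hR | hR
    · obtain ⟨j, h₁, h₂, h₃, h₄, h₅⟩ := h.all key P B hR
      obtain ⟨a, b, c, d⟩ := h'.old j h₂
      exact ⟨j, h₁, h₂.trans_le h'.le, d.trans h₃, a.trans h₄, b.trans h₅⟩
    · obtain ⟨j, h₁, h₂, h₃⟩ := h'.all key P B hR
      exact ⟨j, h.le.trans h₁, h₂, h₃⟩

/-- The rows of a new node may be prepared behind those of the `N` existing nodes without disturbing
them. -/
theorem Grown.of_agree (hN : Nodes n m N σ)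
    (h₁ : ∀ y < N * m, τ.nat aMask y = σ.nat aMask y)
    (h₂ : ∀ y < N * n, τ.nat aBudget y = σ.nat aBudget y)
    (h₃ : ∀ A ∈ [aCount, aMaskPtr, aBudgetPtr, aParent, aKey], τ.nat A = σ.nat A) :
    Grown (n := n) (m := m) i N N (fun _ _ _ => False) σ τ := by
  have hset : ∀ j < N, nodeSet m τ j = nodeSet m σ j := fun j hj => by
    ext x
    simp only [nodeSet, Set.mem_ofPred_eq, h₁ _ (row_lt hj x.2)]
  refine ⟨⟨?_, ?_, ?_, ?_⟩, le_rfl, fun j hj => ⟨hset j hj, ?_, ?_, ?_⟩, fun j h₁ h₂ => by omega,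
    fun _ _ _ => False.elim⟩
  · rw [h₃ aCount (by simp), hN.count]
  · rw [h₃ aMaskPtr (by simp)]; exact hN.maskPtr
  · rw [h₃ aBudgetPtr (by simp)]; exact hN.budgetPtr
  · intro j hj x
    rw [h₁ _ (row_lt hj x.2), hset j hj]
    exact hN.mask j hj x
  · funext v
    exact h₂ _ (row_lt hj v.2)
  · rw [h₃ aParent (by simp)]
  · rw [h₃ aKey (by simp)]

theorem Grown.of_frame {W : List ℕ} (hN : Nodes n m N σ) (hF : Frame W σ τ)
    (hW : ∀ A ∈ [aCount, aMask, aBudget, aParent, aKey, aMaskPtr, aBudgetPtr], A ∉ W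
      := by decide) :
    Grown (n := n) (m := m) i N N (fun _ _ _ => False) σ τ := by
  refine .of_agree hN (fun y _ => by rw [hF.1 _ (hW _ (by simp))])
    (fun y _ => by rw [hF.1 _ (hW _ (by simp))]) fun A hA => hF.1 A (hW A ?_)
  simp only [List.mem_cons, List.not_mem_nil, or_false] at hA ⊢
  tauto

theorem Grown.frame {W : List ℕ} (hG : Grown i N N' R σ τ) (hF : Frame W τ υ)
    (hW : ∀ A ∈ [aCount, aMask, aBudget, aParent, aKey, aMaskPtr, aBudgetPtr], A ∉ W
      := by decide) : Grown i N N' R σ υ :=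
  (hG.trans (.of_frame hG.nodes hF hW)).congr fun _ _ _ => by simp

/-- Add a node whose mask and budget have been written already. -/
def pushProg : Program :=
  .seq (.setNat aParent (reg aCount) (reg aNode))
  -- Keys are shifted by one, so that an entry 0 of `aComp` can stand for a pair without a recorded
  -- component.
  (.seq (.setNat aKey (reg aCount) (.add (reg rK) (.const 1)))
  (.seq (.setNat aMaskPtr (.add (reg aCount) (.const 1))
    (.add (.read aMaskPtr (reg aCount)) (reg aPairs)))
  (.seq (.setNat aBudgetPtr (.add (reg aCount) (.const 1))
    (.add (.read aBudgetPtr (reg aCount)) (reg aVerts)))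
  (.setNat aCount (.const 0) (.add (reg aCount) (.const 1))))))

theorem wp_pushProg {s : ℕ} {Q : State → Prop} (hv : σ.nat aVerts 0 = n)
    (hm : σ.nat aPairs 0 = m) (hN : Nodes n m N σ) {P : Set (Fin m)} {B : Fin n → ℕ}
    (hP : IsMask (σ.nat aMask) (N * m) P) (hB : ∀ v : Fin n, σ.nat aBudget (N * n + v) = B v)
    (hQ : ∀ τ, Frame [aCount, aParent, aKey, aMaskPtr, aBudgetPtr] σ τ →
      Grown (σ.nat aNode 0) N (N + 1)
        (fun key P' B' => key = σ.nat rK 0 + 1 ∧ P' = P ∧ B' = B) σ τ → Q τ) :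
    Wp s pushProg Q σ := by
  refine .seq (.setNat (.seq (.setNat (.seq (.setNat (.seq (.setNat (.setNat ?_))))))))
  refine hQ _ (((((((Frame.refl _ _).setNat (by decide) _ _).setNat (by decide) _ _).setNat
    (by decide) _ _).setNat (by decide) _ _).setNat (by decide) _ _)) ?_
  have hset : ∀ υ : State, υ.nat aMask = σ.nat aMask → nodeSet m υ = nodeSet m σ := fun υ h => by
    funext j
    simp only [nodeSet, h]
  have hbud : ∀ υ : State, υ.nat aBudget = σ.nat aBudget → nodeBudget n υ = nodeBudget n σ :=
    fun υ h => by
      funext j v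
      simp only [nodeBudget, h]
  have hBN : nodeBudget n σ N = B := funext hB
  have hPN : nodeSet m σ N = P := hP.nodeSet_eq
  refine ⟨⟨?_, ?_, ?_, ?_⟩, by omega, ?_, ?_, ?_⟩
  · simp [NatExpr.eval, hN.count]
  · intro j hj
    rcases Nat.le_succ_iff.1 hj with hj | rfl
    · have : j ≠ N + 1 := by omega
      simp [NatExpr.eval, hN.count, this, hN.maskPtr j hj]
    · simp [NatExpr.eval, hN.count, hN.maskPtr N le_rfl, hm, Nat.succ_mul]
  · intro j hj
    rcases Nat.le_succ_iff.1 hj with hj | rfl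
    · have : j ≠ N + 1 := by omega
      simp [NatExpr.eval, hN.count, this, hN.budgetPtr j hj]
    · simp [NatExpr.eval, hN.count, hN.budgetPtr N le_rfl, hv, Nat.succ_mul]
  · intro j hj
    rw [hset _ (by simp)]
    rw [State.setNat_nat_of_ne _ (by decide), State.setNat_nat_of_ne _ (by decide),
      State.setNat_nat_of_ne _ (by decide), State.setNat_nat_of_ne _ (by decide),
      State.setNat_nat_of_ne _ (by decide)]
    rcases Nat.lt_succ_iff_lt_or_eq.1 hj with hj | rfl
    · exact hN.mask j hj
    · rw [hPN]
      exact hP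
  · intro j hj
    have : j ≠ N := by omega
    rw [hset _ (by simp), hbud _ (by simp)]
    simp [NatExpr.eval, hN.count, this]
  · intro j h₁ h₂
    obtain rfl : j = N := by omega
    rw [hset _ (by simp), hbud _ (by simp)]
    simp [NatExpr.eval, hN.count, hBN, hPN]
  · rintro _ _ _ ⟨rfl, rfl, rfl⟩
    refine ⟨N, le_rfl, by omega, ?_⟩
    rw [hset _ (by simp), hbud _ (by simp)]
    simp [NatExpr.eval, hN.count, hBN, hPN]

/-- Add a child of the current node: its mask is in the array `src`, and the unit in register `rQ`
of the budget is spent. -/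
def createProg (src : ℕ) : Program :=
  .seq (.forLoop rX (reg aPairs)
    (.setNat aMask (.add (.read aMaskPtr (reg aCount)) (reg rX)) (.read src (reg rX))))
  (.seq (.forLoop rX (reg aVerts)
    (.branch (.natLe (.const 1) (closedE (reg rQ) (reg rX)))
      (.setNat aBudget (.add (.read aBudgetPtr (reg aCount)) (reg rX))
        (.sub (.read aBudget (.add (.read aBudgetPtr (reg aNode)) (reg rX)))
          ((reg rQ).eq (reg rX))))
      (.setNat aBudget (.add (.read aBudgetPtr (reg aCount)) (reg rX)) (.const 0))))
  pushProg)

theorem wp_createProg {s src : ℕ} {Q : State → Prop} (hms : n * h ≤ s) (hns : n ≤ s)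
    (hσ : Env G H rev σ) (hN : Nodes n (n * h) N σ) (hi : σ.nat aNode 0 < N) {q : Fin n}
    (hq : σ.nat rQ 0 = q) {P : Set (Fin (n * h))} (hP : IsMask (σ.nat src) 0 P)
    (hsrc : src ∉ [aMask, rX])
    (hQ : ∀ τ, Frame [aCount, aMask, aBudget, aParent, aKey, aMaskPtr, aBudgetPtr, rX] σ τ →
      Grown (σ.nat aNode 0) N (N + 1) (fun key P' B' => key = σ.nat rK 0 + 1 ∧ P' = P ∧
        B' = spend G (nodeBudget n σ (σ.nat aNode 0)) q) σ τ → Q τ) :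
    Wp s (createProg src) Q σ := by
  classical
  refine .seq (.fill (A := aMask) (x := rX) (W := []) (N * (n * h)) (σ.nat src) hms (by decide)
    (by decide) (fun τ hF => (hσ.frame hF).pairs) (fun j hj τ hF hx _ _ => .setNat ?_)
    fun τ hF hM hM' => ?_)
  · have h₁ : τ.nat aMaskPtr (τ.nat aCount 0) = N * (n * h) := by
      rw [hF.1 aMaskPtr (by decide), hF.1 aCount (by decide), hN.count, hN.maskPtr N le_rfl]
    simp only [NatExpr.eval, hx, h₁, State.setNat_nat_self, hF.1 src hsrc, and_true]
    exact (Frame.refl _ _).setNat (by simp) _ _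
  have hτ := hσ.frame hF
  have hNτ : Grown (n := n) (m := n * h) (σ.nat aNode 0) N N (fun _ _ _ => False) σ τ := by
    refine .of_agree hN (fun y hy => hM' y (.inl hy)) (fun y _ => by rw [hF.1 aBudget (by decide)])
      fun A hA => hF.1 A ?_
    revert A
    decide
  have hiτ : τ.nat aNode 0 = σ.nat aNode 0 := by rw [hF.1 aNode (by decide)]
  set B := spend G (nodeBudget n σ (σ.nat aNode 0)) q with hB
  refine .seq (.fill (A := aBudget) (x := rX) (W := []) (N * n)
    (fun j => if hj : j < n then B ⟨j, hj⟩ else 0) hns (by decide)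
    (by decide) (fun υ hF => (hτ.frame hF).verts) (fun j hj υ hF' hx _ hO => ?_)
    fun υ hF' hM₂ hM₂' => ?_)
  · have hυ := hτ.frame hF'
    have h₁ : υ.nat aBudgetPtr (υ.nat aCount 0) = N * n := by
      rw [hF'.1 aBudgetPtr (by decide), hF'.1 aCount (by decide), hNτ.nodes.count,
        hNτ.nodes.budgetPtr N le_rfl]
    have hq' : υ.nat rQ 0 = q := by
      rw [hF'.1 rQ (by decide), hF.1 rQ (by decide), hq]
    have h₂ : υ.nat aBudgetPtr (υ.nat aNode 0) = υ.nat aNode 0 * n := by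
      rw [hF'.1 aBudgetPtr (by decide), hF'.1 aNode (by decide), hNτ.nodes.budgetPtr]
      omega
    have h₃ : υ.nat aBudget (υ.nat aNode 0 * n + j) = nodeBudget n σ (σ.nat aNode 0) ⟨j, hj⟩ := by
      rw [hF'.1 aNode (by decide), hiτ, hO _ (.inl (row_lt hi hj)), hF.1 aBudget (by decide)]
      rfl
    have h₄ := hυ.eval_closedE (k := reg rQ) (l := reg rX) (x := q) (y := ⟨j, hj⟩)
      (by simpa [NatExpr.eval] using hq') (by simpa [NatExpr.eval] using hx)
    have h₅ : (Test.natLe (.const 1) (closedE (reg rQ) (reg rX))).Holds υ ↔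
        q = ⟨j, hj⟩ ∨ G.Adj q ⟨j, hj⟩ := by
      simp only [Test.Holds, NatExpr.eval, h₄]
      split_ifs with hc <;> simp [hc]
    refine .branch (fun hb => .setNat ?_) fun hb => .setNat ?_
    · rw [h₅] at hb
      simp only [NatExpr.eval, NatExpr.eval_eq, hx, h₁, h₂, h₃, hq', State.setNat_nat_self]
      refine ⟨(Frame.refl _ _).setNat (by simp) _ _, ?_⟩
      congr 1
      simp only [hB, hj, dif_pos, spend]
      by_cases hqj : q = ⟨j, hj⟩
      · subst hqj
        simp
      · have : (q : ℕ) ≠ j := fun e => hqj (Fin.ext e)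
        have hjq : (⟨j, hj⟩ : Fin n) ≠ q := fun e => hqj e.symm
        simp [this, hjq, hb.resolve_left hqj]
    · rw [h₅] at hb
      push Not at hb
      simp only [NatExpr.eval, hx, h₁, State.setNat_nat_self]
      refine ⟨(Frame.refl _ _).setNat (by simp) _ _, ?_⟩
      congr 1
      simp [hB, hj, spend, hb.1.symm, hb.2]
  have hυ := hτ.frame hF'
  have hNυ : Grown (n := n) (m := n * h) (σ.nat aNode 0) N N (fun _ _ _ => False) τ υ := by
    refine .of_agree hNτ.nodes (fun y _ => by rw [hF'.1 aMask (by decide)])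
      (fun y hy => hM₂' y (.inl hy)) fun A hA => hF'.1 A ?_
    revert A
    decide
  have hk : υ.nat rK 0 = σ.nat rK 0 := by rw [hF'.1 rK (by decide), hF.1 rK (by decide)]
  have hiυ : υ.nat aNode 0 = σ.nat aNode 0 := by rw [hF'.1 aNode (by decide), hiτ]
  refine wp_pushProg hυ.verts hυ.pairs hNυ.nodes (P := P) (B := B) ?_ ?_ fun χ hF'' hχ => ?_
  · intro x
    rw [hF'.1 aMask (by decide), hM x x.2]
    simpa using hP x
  · intro v
    rw [hM₂ v v.2]
    simp
  · rw [hk, hiυ] at hχ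
    refine hQ χ (((hF.mono (by decide)).trans (hF'.mono (by decide))).trans (hF''.mono (by decide)))
      (((hNτ.trans hNυ).trans hχ).congr fun _ _ _ => by tauto)

end Nodes

end RealRAM

/-! ### Carrying out both kinds of moves with every possible charge. -/

namespace RealRAM

section Expand

variable {n h : ℕ} {G : SimpleGraph (Fin n)} {H : SimpleGraph (Fin h)} {rev : Fin (n * h) → ℝ}
  {s : ℕ} {σ : State} {Q : State → Prop}

def selProg (h : ℕ) : Program :=
  .forLoop rX (reg aPairs) (.setNat aSel (reg rX)
    (.sub (.read aCur (reg rX)) (conflictE h (reg rL) (reg rX))))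

theorem wp_selProg (hs : n * h ≤ s) (hσ : Env G H rev σ) {K : Set (Fin (n * h))}
    (hK : IsMask (σ.nat aCur) 0 K) {l : Fin (n * h)} (hl : σ.nat rL 0 = l)
    (hQ : ∀ τ, Frame [aSel, rX] σ τ →
      IsMask (τ.nat aSel) 0 (sel G H (pairEquiv n h) l K) → Q τ) :
    Wp s (selProg h) Q σ := by
  classical
  refine .fill (A := aSel) (x := rX) (W := []) 0
    (fun j => if hj : j < n * h then if (⟨j, hj⟩ : Fin (n * h)) ∈
      sel G H (pairEquiv n h) l K then 1 else 0 else 0) hs (by decide) (by decide)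
    (fun τ hF => (hσ.frame hF).pairs) (fun j hj τ hF hx _ _ => .setNat ?_) fun τ hF hM _ => ?_
  · have hc := (hσ.frame hF).eval_conflictE (k := reg rL) (l := reg rX) (x := l) (y := ⟨j, hj⟩)
      (by simpa [NatExpr.eval, hF.1 rL (by decide)] using hl) (by simpa [NatExpr.eval] using hx)
    have hKj := hK ⟨j, hj⟩
    simp only [zero_add] at hKj
    simp only [NatExpr.eval, hx, hc, State.setNat_nat_self, hF.1 aCur (by decide), hKj, zero_add]
    refine ⟨(Frame.refl _ _).setNat (by simp) _ _, ?_⟩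
    congr 1
    simp only [hj, dif_pos, sel, Set.mem_ofPred_eq]
    split_ifs <;> simp_all
  · refine hQ τ hF fun x => ?_
    rw [hM x x.2]
    simp

def cutProg (h : ℕ) : Program :=
  .forLoop rX (reg aPairs)
    (.seq (.setNat rFlag (.const 0) (.const 0))
    (.seq (.forLoop rY (reg aPairs) (.branch
      -- The other side is a sum of three truth values, so the test forces all three to hold and
      -- `nearE` to fail.
      (.natLe (.add (.const 3) (nearE (reg rL) (reg rY)))
        (.add (.add (.read aCur (reg rY)) (conflictE h (reg rX) (reg rY)))
          (nearE (reg rL) (reg rX))))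
      (.setNat rFlag (.const 0) (.const 1)) .skip))
    (.setNat aCut (reg rX)
      (.sub (.read aCur (reg rX)) (.add (sameE (reg rL) (reg rX)) (reg rFlag))))))

theorem wp_cutProg (hs : n * h ≤ s) (hσ : Env G H rev σ) {K : Set (Fin (n * h))}
    (hK : IsMask (σ.nat aCur) 0 K) {l : Fin (n * h)} (hl : σ.nat rL 0 = l)
    (hQ : ∀ τ, Frame [aCut, rX, rFlag, rY] σ τ →
      IsMask (τ.nat aCut) 0 (cut G H (pairEquiv n h) l K) → Q τ) :
    Wp s (cutProg h) Q σ := by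
  classical
  refine .fill (A := aCut) (x := rX) (W := [rFlag, rY]) 0
    (fun j => if hj : j < n * h then if (⟨j, hj⟩ : Fin (n * h)) ∈
      cut G H (pairEquiv n h) l K then 1 else 0 else 0) hs (by decide) (by decide)
    (fun τ hF => (hσ.frame hF).pairs) (fun j hj τ hF hx _ _ => .seq (.setNat (.seq ?_)))
    fun τ hF hM _ => ?_
  · have hKτ : ∀ x : Fin (n * h), ∀ υ, Frame [rFlag, rY] τ υ →
        υ.nat aCur x = if x ∈ K then 1 else 0 := fun x υ hυ => by
      rw [hυ.1 aCur (by decide), hF.1 aCur (by decide)]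
      simpa using hK x
    have hlτ : ∀ υ, Frame [rFlag, rY] τ υ → (reg rL).eval υ = l := fun υ hυ => by
      simp only [NatExpr.eval, hυ.1 rL (by decide), hF.1 rL (by decide), hl]
    have hxτ : ∀ υ, Frame [rFlag, rY] τ υ → (reg rX).eval υ = (⟨j, hj⟩ : Fin (n * h)) :=
      fun υ hυ => by simp only [NatExpr.eval, hυ.1 rX (by decide), hx]
    have hE : ∀ υ, Frame [rFlag, rY] τ υ → Env G H rev υ := fun υ hυ => (hσ.frame hF).frame hυ
    refine .forLoop hs (fun y υ => Frame [rFlag, rY] τ υ ∧ υ.nat rFlag 0 =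
      if Near G (pairEquiv n h) l ⟨j, hj⟩ ∧ ∃ y' ∈ K, (y' : ℕ) < y ∧
        ¬ Near G (pairEquiv n h) l y' ∧ Conflict G H (pairEquiv n h) ⟨j, hj⟩ y'
      then 1 else 0) ?_ (fun y υ hυ => (hE υ hυ.1).pairs) ?_ ?_
    · refine ⟨((Frame.refl _ _).setNat (by decide) _ _).setNat (by decide) _ _, ?_⟩
      simp [NatExpr.eval]
    · rintro y hy υ hυy ⟨hυ, hflag⟩
      have e₁ := (hE υ hυ).eval_nearE (hlτ υ hυ) (hxτ υ hυ)
      have hy' : (reg rY).eval υ = (⟨y, hy⟩ : Fin (n * h)) := hυy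
      have e₂ := (hE υ hυ).eval_nearE (hlτ υ hυ) hy'
      have e₃ := (hE υ hυ).eval_conflictE (hxτ υ hυ) hy'
      have e₄ := hKτ ⟨y, hy⟩ υ hυ
      have hiff : (Test.natLe (.add (.const 3) (nearE (reg rL) (reg rY)))
          (.add (.add (.read aCur (reg rY)) (conflictE h (reg rX) (reg rY)))
            (nearE (reg rL) (reg rX)))).Holds υ ↔
          Near G (pairEquiv n h) l ⟨j, hj⟩ ∧ (⟨y, hy⟩ : Fin (n * h)) ∈ K ∧
            ¬ Near G (pairEquiv n h) l ⟨y, hy⟩ ∧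
            Conflict G H (pairEquiv n h) ⟨j, hj⟩ ⟨y, hy⟩ := by
        simp only [Test.Holds, NatExpr.eval, e₁, e₂, e₃, hυy, e₄]
        split_ifs <;> simp_all
      refine .branch (fun hb => .setNat ?_) fun hb => .skip ?_
      · rw [hiff] at hb
        refine ⟨by simpa using hυy, (hυ.setNat (by decide) _ _).setNat (by decide) _ _, ?_⟩
        rw [if_pos ⟨hb.1, ⟨y, hy⟩, hb.2.1, Nat.lt_succ_self y, hb.2.2⟩]
        simp [NatExpr.eval]
      · rw [hiff] at hb
        refine ⟨hυy, hυ.setNat (by decide) _ _, ?_⟩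
        rw [State.setNat_nat_of_ne _ (by decide), hflag]
        congr 1
        refine propext (and_congr_right fun hn => exists_congr fun y' => and_congr_right fun hK' =>
          ⟨fun hc => ⟨hc.1.trans (Nat.lt_succ_self _), hc.2⟩, fun hc => ⟨?_, hc.2⟩⟩)
        rcases Nat.lt_succ_iff_lt_or_eq.1 hc.1 with hlt | heq
        · exact hlt
        · obtain rfl : y' = ⟨y, hy⟩ := Fin.ext heq
          exact absurd ⟨hn, hK', hc.2⟩ hb
    · rintro υ ⟨hυ, hflag⟩
      refine .setNat ?_
      have e₁ := (hE υ hυ).eval_sameE (hlτ υ hυ) (hxτ υ hυ)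
      have e₂ := hKτ ⟨j, hj⟩ υ hυ
      have e₃ : (reg rX).eval υ = j := hxτ υ hυ
      have e₄ : (NatExpr.sub (.read aCur (reg rX)) (.add (sameE (reg rL) (reg rX))
          (reg rFlag))).eval υ = if (⟨j, hj⟩ : Fin (n * h)) ∈ cut G H (pairEquiv n h) l K
          then 1 else 0 := by
        change υ.nat aCur ((reg rX).eval υ) - ((sameE (reg rL) (reg rX)).eval υ + υ.nat rFlag 0) = _
        rw [e₁, e₃, hflag]
        rw [show υ.nat aCur j = _ from e₂]
        have hcut : (⟨j, hj⟩ : Fin (n * h)) ∈ cut G H (pairEquiv n h) l K ↔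
            (⟨j, hj⟩ : Fin (n * h)) ∈ K ∧
            ¬ (pairEquiv n h l).1 = (pairEquiv n h ⟨j, hj⟩).1 ∧
            ¬ (Near G (pairEquiv n h) l ⟨j, hj⟩ ∧ ∃ y' ∈ K, (y' : ℕ) < n * h ∧
              ¬ Near G (pairEquiv n h) l y' ∧ Conflict G H (pairEquiv n h) ⟨j, hj⟩ y') := by
          simp only [cut, Set.mem_ofPred_eq, Fin.is_lt, true_and, ne_eq]
        simp only [hcut]
        split_ifs <;> simp_all
      rw [e₄, e₃]
      refine ⟨(hυ.mono (by decide)).setNat (by decide) _ _, ?_⟩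
      simp only [State.setNat_nat_self, zero_add, hj, dif_pos, hυ.1 aCut (by decide)]
  · refine hQ τ hF fun x => ?_
    rw [hM x x.2]
    simp

/-- Add the children of the current node for the component in `aCur`. -/
def expandProg (h : ℕ) : Program :=
  .forLoop rL (reg aPairs) (.seq (selProg h) (.seq (cutProg h)
    (.forLoop rQ (reg aVerts)
      (.branch (.natLe (.const 1) (.read aBudget (.add (.read aBudgetPtr (reg aNode)) (reg rQ))))
        (.seq (createProg aSel) (createProg aCut)) .skip))))

theorem wp_createLoop (hms : n * h ≤ s) (hns : n ≤ s) (hσ : Env G H rev σ) {N i : ℕ}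
    (hN : Nodes n (n * h) N σ) (hi : σ.nat aNode 0 = i) (hiN : i < N)
    {P₁ P₂ : Set (Fin (n * h))} (hP₁ : IsMask (σ.nat aSel) 0 P₁) (hP₂ : IsMask (σ.nat aCut) 0 P₂)
    (hQ : ∀ τ N', N' ≤ N + 2 * n →
      Frame [aCount, aMask, aBudget, aParent, aKey, aMaskPtr, aBudgetPtr, rX, rQ] σ τ →
      Grown i N N' (fun key P' B' => ∃ q, 0 < nodeBudget n σ i q ∧ key = σ.nat rK 0 + 1 ∧
        (P' = P₁ ∨ P' = P₂) ∧ B' = spend G (nodeBudget n σ i) q) σ τ → Q τ) :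
    Wp s (.forLoop rQ (reg aVerts)
      (.branch (.natLe (.const 1) (.read aBudget (.add (.read aBudgetPtr (reg aNode)) (reg rQ))))
        (.seq (createProg aSel) (createProg aCut)) .skip)) Q σ := by
  classical
  refine .forLoop hns (fun j τ =>
    Frame [aCount, aMask, aBudget, aParent, aKey, aMaskPtr, aBudgetPtr, rX, rQ] σ τ ∧
    ∃ N', N' ≤ N + 2 * j ∧ Grown i N N' (fun key P' B' => ∃ q : Fin n, (q : ℕ) < j ∧
      0 < nodeBudget n σ i q ∧ key = σ.nat rK 0 + 1 ∧
        (P' = P₁ ∨ P' = P₂) ∧ B' = spend G (nodeBudget n σ i) q) σ τ) ?_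
    (fun j τ h' => (hσ.frame h'.1).verts) ?_ ?_
  · refine ⟨(Frame.refl _ _).setNat (by decide) _ _, N, by omega, ?_⟩
    exact (Grown.of_frame hN ((Frame.refl [rQ] σ).setNat (by decide) _ _)).congr
      fun _ _ _ => by simp
  · rintro j hj τ hτq ⟨hF, N', hN', hG⟩
    have hE := hσ.frame hF
    have hBτ : nodeBudget n τ i = nodeBudget n σ i := (hG.old i hiN).2.1
    have hiτ : τ.nat aNode 0 = i := by rw [hF.1 aNode (by decide), hi]
    have hkτ : τ.nat rK 0 = σ.nat rK 0 := by rw [hF.1 rK (by decide)]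
    have hle := hG.le
    have hval : (NatExpr.read aBudget (.add (.read aBudgetPtr (reg aNode)) (reg rQ))).eval τ =
        nodeBudget n σ i ⟨j, hj⟩ := by
      rw [← hBτ]
      simp only [NatExpr.eval, hiτ, hτq, hG.nodes.budgetPtr i (by omega)]
      rfl
    have hkey : (nodeBudget n σ i ⟨j, hj⟩ = 0 →
        Grown i N N' (fun key P' B' => ∃ q : Fin n, (q : ℕ) < j + 1 ∧
          0 < nodeBudget n σ i q ∧ key = σ.nat rK 0 + 1 ∧
            (P' = P₁ ∨ P' = P₂) ∧ B' = spend G (nodeBudget n σ i) q) σ τ) := by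
      intro h0
      refine hG.congr fun key P' B' => exists_congr fun q => ⟨fun hc => ⟨by omega, hc.2⟩,
        fun hc => ⟨?_, hc.2⟩⟩
      rcases Nat.lt_succ_iff_lt_or_eq.1 hc.1 with hlt | heq
      · exact hlt
      · obtain rfl : q = ⟨j, hj⟩ := Fin.ext heq
        exact absurd hc.2.1 (by omega)
    refine .branch (fun hb => ?_) fun hb => .skip ?_
    · have hpos : 0 < nodeBudget n σ i ⟨j, hj⟩ := by
        rw [← hval]; exact hb
      have hP₁τ : IsMask (τ.nat aSel) 0 P₁ := by rwa [hF.1 aSel (by decide)]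
      refine .seq (wp_createProg hms hns hE hG.nodes (by omega) (q := ⟨j, hj⟩) hτq
        hP₁τ (by decide) fun υ hFυ hGυ => ?_)
      have hE' := hE.frame hFυ
      rw [hiτ, hkτ, hBτ] at hGυ
      have hiυ : υ.nat aNode 0 = i := by rw [hFυ.1 aNode (by decide), hiτ]
      have hkυ : υ.nat rK 0 = σ.nat rK 0 := by rw [hFυ.1 rK (by decide), hkτ]
      have hBυ : nodeBudget n υ i = nodeBudget n σ i := (hGυ.old i (by omega)).2.1.trans hBτ
      have hqυ : υ.nat rQ 0 = j := by rw [hFυ.1 rQ (by decide), hτq]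
      have hP₂υ : IsMask (υ.nat aCut) 0 P₂ := by
        rwa [hFυ.1 aCut (by decide), hF.1 aCut (by decide)]
      refine wp_createProg hms hns hE' hGυ.nodes (by omega) (q := ⟨j, hj⟩) hqυ
        hP₂υ (by decide) fun χ hFχ hGχ => ?_
      rw [hiυ, hkυ, hBυ] at hGχ
      refine ⟨by rw [hFχ.1 rQ (by decide), hqυ],
        ((hF.trans (hFυ.mono (by decide))).trans (hFχ.mono (by decide))).setNat (by decide) _ _,
        N' + 1 + 1, by omega, ?_⟩
      refine ((((hG.trans hGυ).trans hGχ).frame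
        ((Frame.refl [rQ] χ).setNat (by decide) _ _))).congr fun key P' B' => ?_
      constructor
      · rintro ((⟨q, h₁, h₂⟩ | ⟨h₁, h₂, h₃⟩) | ⟨h₁, h₂, h₃⟩)
        · exact ⟨q, by omega, h₂⟩
        · exact ⟨⟨j, hj⟩, Nat.lt_succ_self j, hpos, h₁, .inl h₂, h₃⟩
        · exact ⟨⟨j, hj⟩, Nat.lt_succ_self j, hpos, h₁, .inr h₂, h₃⟩
      · rintro ⟨q, h₁, h₂, h₃, h₄, h₅⟩
        rcases Nat.lt_succ_iff_lt_or_eq.1 h₁ with hlt | heq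
        · exact .inl (.inl ⟨q, hlt, h₂, h₃, h₄, h₅⟩)
        · obtain rfl : q = ⟨j, hj⟩ := Fin.ext heq
          rcases h₄ with h₄ | h₄
          · exact .inl (.inr ⟨h₃, h₄, h₅⟩)
          · exact .inr ⟨h₃, h₄, h₅⟩
    · have h0 : nodeBudget n σ i ⟨j, hj⟩ = 0 := by
        rw [← hval]
        by_contra hne
        exact hb (Nat.one_le_iff_ne_zero.2 hne)
      exact ⟨hτq, hF.setNat (by decide) _ _, N', by omega,
        (hkey h0).frame ((Frame.refl [rQ] τ).setNat (by decide) _ _)⟩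
  · rintro τ ⟨hF, N', hN', hG⟩
    refine hQ τ N' hN' hF (hG.congr fun key P' B' => exists_congr fun q => ?_)
    simp

theorem wp_expandProg (hms : n * h ≤ s) (hns : n ≤ s) (hσ : Env G H rev σ) {N i : ℕ}
    (hN : Nodes n (n * h) N σ) (hi : σ.nat aNode 0 = i) (hiN : i < N)
    {K : Set (Fin (n * h))} (hK : IsMask (σ.nat aCur) 0 K)
    (hQ : ∀ τ N', N' ≤ N + 2 * n * (n * h) →
      Frame [aCount, aMask, aBudget, aParent, aKey, aMaskPtr, aBudgetPtr, rX, rQ, aSel, aCut, rFlag,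
        rY, rL] σ τ →
      Grown i N N' (fun key P' B' => key = σ.nat rK 0 + 1 ∧ ∃ l q, 0 < nodeBudget n σ i q ∧
        (P' = sel G H (pairEquiv n h) l K ∨ P' = cut G H (pairEquiv n h) l K) ∧
        B' = spend G (nodeBudget n σ i) q) σ τ → Q τ) :
    Wp s (expandProg h) Q σ := by
  refine .forLoop hms (fun j τ =>
    Frame [aCount, aMask, aBudget, aParent, aKey, aMaskPtr, aBudgetPtr, rX, rQ, aSel, aCut, rFlag,
      rY, rL] σ τ ∧
    ∃ N', N' ≤ N + 2 * n * j ∧ Grown i N N' (fun key P' B' => ∃ l : Fin (n * h), (l : ℕ) < j ∧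
      ∃ q, 0 < nodeBudget n σ i q ∧ key = σ.nat rK 0 + 1 ∧
        (P' = sel G H (pairEquiv n h) l K ∨ P' = cut G H (pairEquiv n h) l K) ∧
        B' = spend G (nodeBudget n σ i) q) σ τ) ?_
    (fun j τ h' => (hσ.frame h'.1).pairs) ?_ ?_
  · refine ⟨(Frame.refl _ _).setNat (by decide) _ _, N, by omega, ?_⟩
    exact (Grown.of_frame hN ((Frame.refl [rL] σ).setNat (by decide) _ _)).congr
      fun _ _ _ => by simp
  · rintro j hj τ hτl ⟨hF, N', hN', hG⟩
    have hle := hG.le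
    have hE := hσ.frame hF
    have hKτ : IsMask (τ.nat aCur) 0 K := by rwa [hF.1 aCur (by decide)]
    refine .seq (wp_selProg hms hE hKτ (l := ⟨j, hj⟩) hτl fun υ hFυ hυ => ?_)
    have hE' := hE.frame hFυ
    have hKυ : IsMask (υ.nat aCur) 0 K := by rwa [hFυ.1 aCur (by decide)]
    refine .seq (wp_cutProg hms hE' hKυ (l := ⟨j, hj⟩) (by rw [hFυ.1 rL (by decide), hτl])
      fun χ hFχ hχ => ?_)
    have hE'' := hE'.frame hFχ
    have hGχ := (hG.frame hFυ).frame hFχ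
    have hF' : Frame [aCount, aMask, aBudget, aParent, aKey, aMaskPtr, aBudgetPtr, rX, rQ, aSel,
      aCut, rFlag, rY, rL] σ χ := (hF.trans (hFυ.mono (by decide))).trans (hFχ.mono (by decide))
    have hBχ : nodeBudget n χ i = nodeBudget n σ i := (hGχ.old i hiN).2.1
    refine wp_createLoop hms hns hE'' hGχ.nodes (by rw [hF'.1 aNode (by decide), hi])
      (by omega) (by rw [hFχ.1 aSel (by decide)]; exact hυ) hχ fun ψ N'' hN'' hFψ hGψ => ?_
    rw [hBχ, hF'.1 rK (by decide)] at hGψ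
    refine ⟨?_, (hF'.trans (hFψ.mono (by decide))).setNat (by decide) _ _, N'', ?_,
      ((hGχ.trans hGψ).frame ((Frame.refl [rL] ψ).setNat (by decide) _ _)).congr
        fun key P' B' => ?_⟩
    · rw [hFψ.1 rL (by decide), hFχ.1 rL (by decide), hFυ.1 rL (by decide), hτl]
    · calc N'' ≤ N' + 2 * n := hN''
        _ ≤ N + 2 * n * j + 2 * n := by omega
        _ = N + 2 * n * (j + 1) := by ring
    · constructor
      · rintro (⟨l, h₁, h₂⟩ | h')
        · exact ⟨l, by omega, h₂⟩
        · exact ⟨⟨j, hj⟩, Nat.lt_succ_self j, h'⟩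
      · rintro ⟨l, h₁, h₂⟩
        rcases Nat.lt_succ_iff_lt_or_eq.1 h₁ with hlt | heq
        · exact .inl ⟨l, hlt, h₂⟩
        · obtain rfl : l = ⟨j, hj⟩ := Fin.ext heq
          exact .inr h₂
  · rintro τ ⟨hF, N', hN', hG⟩
    refine hQ τ N' hN' hF (hG.congr fun key P' B' => ?_)
    constructor
    · rintro ⟨l, -, q, h₁, h₂, h₃⟩
      exact ⟨h₂, l, q, h₁, h₃⟩
    · rintro ⟨h₂, l, q, h₁, h₃⟩
      exact ⟨l, l.2, q, h₁, h₂, h₃⟩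

end Expand

end RealRAM

/-! ### Processing one node. -/

namespace RealRAM

section Forward

variable {n h : ℕ} (G : SimpleGraph (Fin n)) (H : SimpleGraph (Fin h))

/-- The first pair of the component of `x`. -/
noncomputable def rep (P : Set (Fin (n * h))) (x : Fin (n * h)) : ℕ :=
  sInf ((fun y : Fin (n * h) => (y : ℕ)) '' comp G H (pairEquiv n h) P x)

theorem exists_rep (P : Set (Fin (n * h))) (x : Fin (n * h)) :
    ∃ y ∈ comp G H (pairEquiv n h) P x, (y : ℕ) = rep G H P x :=
  Nat.sInf_mem (Set.Nonempty.image _ ⟨x, mem_comp_self P x⟩)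

variable {G H} in
theorem rep_le {P : Set (Fin (n * h))} {x y : Fin (n * h)}
    (hy : y ∈ comp G H (pairEquiv n h) P x) : rep G H P x ≤ y :=
  Nat.sInf_le (Set.mem_image_of_mem _ hy)

variable {G H} in
theorem rep_congr {P : Set (Fin (n * h))} {x y : Fin (n * h)} (hx : x ∈ P)
    (hy : y ∈ comp G H (pairEquiv n h) P x) : rep G H P y = rep G H P x := by
  rw [rep, rep, comp_eq_of_mem hx hy]

variable {G H} in
theorem mem_comp_of_rep_eq {P : Set (Fin (n * h))} {x y : Fin (n * h)} (hx : x ∈ P) (hy : y ∈ P)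
    (hr : rep G H P x = rep G H P y) : y ∈ comp G H (pairEquiv n h) P x := by
  obtain ⟨z, hz, hz'⟩ := exists_rep G H P x
  obtain ⟨w, hw, hw'⟩ := exists_rep G H P y
  obtain rfl : z = w := Fin.ext (by omega)
  rw [← comp_eq_of_mem hx hz, comp_eq_of_mem hy hw]
  exact mem_comp_self P y

variable {G H} in
theorem mem_comp_iff_rep_eq {P : Set (Fin (n * h))} {x y : Fin (n * h)} (hx : x ∈ P) :
    y ∈ comp G H (pairEquiv n h) P x ↔ y ∈ P ∧ rep G H P y = rep G H P x :=
  ⟨fun hy => ⟨comp_subset hx hy, rep_congr hx hy⟩, fun hy => mem_comp_of_rep_eq hx hy.1 hy.2.symm⟩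

/-- A child of a node with the set `P` and the budget `B`. -/
def Kid (P : Set (Fin (n * h))) (B : Fin n → ℕ) (key : ℕ) (P' : Set (Fin (n * h)))
    (B' : Fin n → ℕ) : Prop :=
  ∃ k ∈ P, rep G H P k = k ∧ key = k + 1 ∧ ∃ l q, 0 < B q ∧
    (P' = sel G H (pairEquiv n h) l (comp G H (pairEquiv n h) P k) ∨
      P' = cut G H (pairEquiv n h) l (comp G H (pairEquiv n h) P k)) ∧ B' = spend G B q

/-- The entry of the current node and the pair in register `x`. -/
def entry (x : ℕ) : NatExpr := .add (.read aMaskPtr (reg aNode)) (reg x)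

/-- Record the components of the current node, a first solution, and its children. -/
def nodeProg (h : ℕ) : Program :=
  .forLoop rK (reg aPairs)
    -- The pair belongs to the node and has no recorded component yet. As pairs are visited in
    -- increasing order, it is then the first pair of its component.
    (.branch (.natLe (.add (.const 1) (.read aComp (entry rK))) (.read aMask (entry rK)))
      (.seq (compProg h)
      (.seq (.forLoop rX (reg aPairs) (.branch (.natLe (.const 1) (.read aCur (reg rX)))
        (.setNat aComp (entry rX) (.add (reg rK) (.const 1))) .skip))
      -- The first solution takes the first pair of each component unless its revenue is negative;
      -- on components with one pair this is optimal.
      (.seq (.branch (.realLe .zero (.read 0 (reg rK))) (.setNat aSol (entry rK) (.const 1)) .skip)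
      (expandProg h)))) .skip)

variable {G H} {rev : Fin (n * h) → ℝ} {s : ℕ} {σ : State} {Q : State → Prop}

/-- The arrays that are written while a node is processed. -/
abbrev nodeArrays : List ℕ := [aCount, aMask, aBudget, aComp, aSol, aParent, aKey, aMaskPtr,
  aBudgetPtr, aCur, aSel, aCut, rK, rR, rX, rY, rL, rQ, rFlag]

open Classical in
/-- What the processing of a node does, for the components whose first pair is below `j`. -/
structure Processed (G : SimpleGraph (Fin n)) (H : SimpleGraph (Fin h)) (rev : Fin (n * h) → ℝ)
    (i j N N' : ℕ) (σ τ : State) : Prop where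
  frame : Frame nodeArrays σ τ
  le : N' ≤ N + 2 * n * (n * h) * j
  grown : Grown i N N' (fun key P' B' => key ≤ j ∧
    Kid G H (nodeSet (n * h) σ i) (nodeBudget n σ i) key P' B') σ τ
  comp : ∀ x : Fin (n * h), τ.nat aComp (i * (n * h) + x) =
    if x ∈ nodeSet (n * h) σ i ∧ rep G H (nodeSet (n * h) σ i) x < j
      then rep G H (nodeSet (n * h) σ i) x + 1 else 0
  compOut : ∀ y, y < i * (n * h) ∨ i * (n * h) + n * h ≤ y → τ.nat aComp y = σ.nat aComp y
  sol : ∀ x : Fin (n * h), τ.nat aSol (i * (n * h) + x) =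
    if x ∈ nodeSet (n * h) σ i ∧ rep G H (nodeSet (n * h) σ i) x = x ∧ (x : ℕ) < j ∧ 0 ≤ rev x
      then 1 else 0
  solOut : ∀ y, y < i * (n * h) ∨ i * (n * h) + n * h ≤ y → τ.nat aSol y = σ.nat aSol y

theorem wp_nodeProg (hms : n * h ≤ s) (hns : n ≤ s) (hσ : Env G H rev σ) {N i : ℕ}
    (hN : Nodes n (n * h) N σ) (hi : σ.nat aNode 0 = i) (hiN : i < N)
    (hcomp : ∀ x : Fin (n * h), σ.nat aComp (i * (n * h) + x) = 0)
    (hsol : ∀ x : Fin (n * h), σ.nat aSol (i * (n * h) + x) = 0)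
    (hQ : ∀ τ N', Processed G H rev i (n * h) N N' σ τ → Q τ) :
    Wp s (nodeProg h) Q σ := by
  classical
  set P := nodeSet (n * h) σ i with hPdef
  refine .forLoop hms (fun j τ => ∃ N', Processed G H rev i j N N' σ τ) ?_
    (fun j τ ⟨N', h'⟩ => (hσ.frame h'.frame).pairs) ?_ fun τ ⟨N', h'⟩ => hQ τ N' h'
  · refine ⟨N, (Frame.refl _ _).setNat (by decide) _ _, by simp, ?_, ?_, ?_, ?_, ?_⟩
    · refine (Grown.of_frame hN ((Frame.refl [rK] σ).setNat (by decide) _ _)).congr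
        fun key P' B' => ⟨False.elim, ?_⟩
      rintro ⟨h₁, k, _, _, h₂, _⟩
      omega
    · intro x
      simpa using hcomp x
    · intro y _
      rw [State.setNat_nat_of_ne _ (by decide)]
    · intro x
      simpa using hsol x
    · intro y _
      rw [State.setNat_nat_of_ne _ (by decide)]
  · rintro j hj τ hτk ⟨N', hp⟩
    have hF := hp.frame
    have hG := hp.grown
    have hle := hG.le
    have hE := hσ.frame hF
    have hiτ : τ.nat aNode 0 = i := by rw [hF.1 aNode (by decide), hi]
    have hptr : τ.nat aMaskPtr i = i * (n * h) := hG.nodes.maskPtr i (by omega)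
    have hPτ : nodeSet (n * h) τ i = P := (hG.old i hiN).1
    have hPm : IsMask (τ.nat aMask) (i * (n * h)) P := by
      have := hG.nodes.mask i (by omega)
      rwa [hPτ] at this
    set k : Fin (n * h) := ⟨j, hj⟩ with hk
    have hb : (Test.natLe (.add (.const 1) (.read aComp (entry rK)))
        (.read aMask (entry rK))).Holds τ ↔ k ∈ P ∧ rep G H P k = j := by
      have e₁ : τ.nat aComp (i * (n * h) + j) =
          if k ∈ P ∧ rep G H P k < j then rep G H P k + 1 else 0 := hp.comp k
      have e₂ : τ.nat aMask (i * (n * h) + j) = if k ∈ P then 1 else 0 := hPm k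
      simp only [Test.Holds, entry, NatExpr.eval, hiτ, hptr, hτk, e₁, e₂]
      by_cases hkP : k ∈ P
      · have hle : rep G H P k ≤ j := rep_le (mem_comp_self P k)
        rcases hle.lt_or_eq with hlt | heq
        · simp [hkP, hlt, hlt.ne]
        · simp [hkP, heq]
      · simp [hkP]
    refine .branch (fun hbt => ?_) fun hbf => .skip ?_
    · rw [hb] at hbt
      obtain ⟨hkP, hkr⟩ := hbt
      have hmem : ∀ x, x ∈ comp G H (pairEquiv n h) P k ↔ x ∈ P ∧ rep G H P x = j := fun x => by
        rw [mem_comp_iff_rep_eq hkP, hkr]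
      refine .seq (wp_compProg hms hE (P := P) (k := k) (by rwa [hiτ, hptr]) hτk fun υ hFυ hυ => ?_)
      have hE₁ := hE.frame hFυ
      have hG₁ := hG.frame hFυ
      have hiυ : υ.nat aNode 0 = i := by rw [hFυ.1 aNode (by decide), hiτ]
      have hkυ : υ.nat rK 0 = j := by rw [hFυ.1 rK (by decide), hτk]
      have hptrυ : υ.nat aMaskPtr i = i * (n * h) := hG₁.nodes.maskPtr i (by omega)
      set K := comp G H (pairEquiv n h) P k with hK
      have hF₁ : Frame nodeArrays σ υ := hF.trans (hFυ.mono (by decide))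
      refine .seq (.fill (A := aComp) (x := rX) (W := []) (i * (n * h))
        (fun y => if hy : y < n * h then if (⟨y, hy⟩ : Fin (n * h)) ∈ K then j + 1
          else τ.nat aComp (i * (n * h) + y) else 0) hms
        (by decide) (by decide) (fun χ hF => (hE₁.frame hF).pairs)
        (fun y hy χ hFχ hx _ hO => ?_) fun χ hFχ hM hM' => ?_)
      · have e₁ : χ.nat aCur y = if (⟨y, hy⟩ : Fin (n * h)) ∈ K then 1 else 0 := by
          rw [hFχ.1 aCur (by decide)]
          simpa using hυ ⟨y, hy⟩
        have e₂ : (entry rX).eval χ = i * (n * h) + y := by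
          simp only [entry, NatExpr.eval, hx, hFχ.1 aNode (by decide), hFχ.1 aMaskPtr (by decide),
            hiυ, hptrυ]
        have e₃ : χ.nat rK 0 = j := by rw [hFχ.1 rK (by decide), hkυ]
        refine .branch (fun hb => .setNat ?_) fun hb => .skip ⟨Frame.refl _ _, ?_⟩
        · simp only [Test.Holds, NatExpr.eval, hx, e₁] at hb
          have hyK : (⟨y, hy⟩ : Fin (n * h)) ∈ K := by
            by_contra hc
            simp [hc] at hb
          rw [e₂]
          refine ⟨(Frame.refl _ _).setNat (by simp) _ _, ?_⟩
          simp [NatExpr.eval, e₃, hy, hyK]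
        · simp only [Test.Holds, NatExpr.eval, hx, e₁] at hb
          have hyK : (⟨y, hy⟩ : Fin (n * h)) ∉ K := fun hc => by simp [hc] at hb
          rw [eq_comm, Function.update_eq_self_iff]
          simp [hy, hyK, hO _ (.inr le_rfl), hFυ.1 aComp (by decide)]
      have hE₂ := hE₁.frame hFχ
      have hG₂ := hG₁.frame hFχ
      have hF₂ : Frame nodeArrays σ χ := hF₁.trans (hFχ.mono (by decide))
      have hiχ : χ.nat aNode 0 = i := by rw [hFχ.1 aNode (by decide), hiυ]
      have hkχ : χ.nat rK 0 = j := by rw [hFχ.1 rK (by decide), hkυ]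
      have hptrχ : χ.nat aMaskPtr i = i * (n * h) := hG₂.nodes.maskPtr i (by omega)
      have hsolχ : χ.nat aSol = τ.nat aSol := by
        rw [hFχ.1 aSol (by decide), hFυ.1 aSol (by decide)]
      have hentry : (entry rK).eval χ = i * (n * h) + k := by
        simp only [entry, NatExpr.eval, hkχ, hiχ, hptrχ, hk]
      have hrev : (Test.realLe .zero (.read 0 (reg rK))).Holds χ ↔ 0 ≤ rev k := by
        simp only [Test.Holds, RealExpr.eval, NatExpr.eval, hkχ]
        rw [show j = (k : ℕ) from rfl, hE₂.rev k]
      -- The rest of the round, for both outcomes of the sign test.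
      have key : ∀ ψ, Frame [aSol] χ ψ → (ψ.nat aSol = if 0 ≤ rev k then
          Function.update (τ.nat aSol) (i * (n * h) + k) 1 else τ.nat aSol) →
          Wp s (expandProg h) (fun υ => υ.nat rK 0 = j ∧
            ∃ N', Processed G H rev i (j + 1) N N' σ (υ.setNat rK 0 (j + 1))) ψ := by
        intro ψ hFψ hψ
        have hE₃ := hE₂.frame hFψ
        have hG₃ := hG₂.frame hFψ
        have hF₃ : Frame nodeArrays σ ψ := hF₂.trans (hFψ.mono (by decide))
        have hcur : IsMask (ψ.nat aCur) 0 K := by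
          rw [hFψ.1 aCur (by decide), hFχ.1 aCur (by decide)]
          exact hυ
        refine wp_expandProg hms hns hE₃ hG₃.nodes (by rw [hFψ.1 aNode (by decide), hiχ])
          (by omega) hcur fun ω N'' hN'' hFω hGω => ?_
        rw [hFψ.1 rK (by decide), hkχ, (hG₃.old i hiN).2.1] at hGω
        refine ⟨by rw [hFω.1 rK (by decide), hFψ.1 rK (by decide), hkχ], N'',
          (hF₃.trans (hFω.mono (by decide))).setNat (by decide) _ _, ?_, ?_, ?_, ?_, ?_, ?_⟩
        · have := hp.le
          calc N'' ≤ N' + 2 * n * (n * h) := hN''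
            _ ≤ N + 2 * n * (n * h) * j + 2 * n * (n * h) := by omega
            _ = _ := by ring
        · refine ((hG₃.trans hGω).frame ((Frame.refl [rK] ω).setNat (by decide) _ _)).congr
            fun key P' B' => ?_
          constructor
          · rintro (⟨h₁, h₂⟩ | ⟨h₁, h₂⟩)
            · exact ⟨by omega, h₂⟩
            · exact ⟨by omega, k, hkP, hkr, h₁, h₂⟩
          · rintro ⟨h₁, k', h₂, h₃, h₄, h₅⟩
            rcases Nat.le_succ_iff.1 h₁ with hlt | heq
            · exact .inl ⟨hlt, k', h₂, h₃, h₄, h₅⟩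
            · obtain rfl : k' = k := Fin.ext (by simp only [hk]; omega)
              exact .inr ⟨heq, h₅⟩
        · intro x
          rw [State.setNat_nat_of_ne _ (by decide), hFω.1 aComp (by decide),
            hFψ.1 aComp (by decide), hM x x.2]
          simp only [x.2, dif_pos, Fin.eta, hp.comp x, hmem]
          by_cases hxP : x ∈ P
          · rcases lt_trichotomy (rep G H P x) j with hlt | heq | hgt
            · simp [← hPdef, hxP, hlt, hlt.ne, Nat.lt_succ_of_lt hlt]
            · simp [← hPdef, hxP, heq]
            · simp [← hPdef, hxP, hgt.ne', not_lt_of_gt hgt, not_lt.2 (Nat.succ_le_of_lt hgt)]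
          · simp [← hPdef, hxP]
        · intro y hy
          rw [State.setNat_nat_of_ne _ (by decide), hFω.1 aComp (by decide),
            hFψ.1 aComp (by decide), hM' y hy, hFυ.1 aComp (by decide), hp.compOut y hy]
        · intro x
          rw [State.setNat_nat_of_ne _ (by decide), hFω.1 aSol (by decide), hψ]
          have e := hp.sol x
          by_cases hxk : x = k
          · subst hxk
            have hlt : ¬ (k : ℕ) < j := lt_irrefl j
            have hlt' : (k : ℕ) < j + 1 := Nat.lt_succ_self j
            have hr : rep G H P k = k := hkr
            simp only [hlt, false_and, and_false, if_false] at e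
            simp only [← hPdef, hkP, hr, hlt', true_and]
            split_ifs
            · simp
            · exact e
          · have hne : (x : ℕ) ≠ j := fun hc => hxk (Fin.ext hc)
            have hiff : (x : ℕ) < j + 1 ↔ (x : ℕ) < j := by omega
            have hne' : i * (n * h) + (x : ℕ) ≠ i * (n * h) + (k : ℕ) := by
              simp only [hk]
              omega
            simp only [hiff]
            rw [← e]
            split_ifs
            · rw [Function.update_of_ne hne']
            · rfl
        · intro y hy
          rw [State.setNat_nat_of_ne _ (by decide), hFω.1 aSol (by decide), hψ, ← hp.solOut y hy]
          split_ifs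
          · rw [Function.update_of_ne]
            have := k.2
            omega
          · rfl
      refine .seq (.branch (fun hb => .setNat ?_) fun hb => .skip ?_)
      · rw [hrev] at hb
        refine key _ ((Frame.refl _ _).setNat (by decide) _ _) ?_
        rw [if_pos hb, hentry, State.setNat_nat_self, hsolχ]
        rfl
      · rw [hrev] at hb
        refine key _ (Frame.refl _ _) ?_
        rw [if_neg hb, hsolχ]
    · rw [hb] at hbf
      -- No component of `P` begins at `j`, so nothing has to be recorded in this round.
      have hno : ∀ x ∈ P, rep G H P x ≠ j := by
        intro x hx hr
        obtain ⟨y, hy, hy'⟩ := exists_rep G H P x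
        obtain rfl : y = k := Fin.ext (by simp only [hk]; omega)
        exact hbf ⟨comp_subset hx hy, (rep_congr hx hy).trans hr⟩
      refine ⟨hτk, N', hF.setNat (by decide) _ _, ?_, ?_, ?_, ?_, ?_, ?_⟩
      · have := hp.le
        have h' : 2 * n * (n * h) * j ≤ 2 * n * (n * h) * (j + 1) :=
          Nat.mul_le_mul_left _ (Nat.le_succ j)
        omega
      · refine (hG.frame ((Frame.refl [rK] τ).setNat (by decide) _ _)).congr
          fun key P' B' => ⟨fun ⟨h₁, h₂⟩ => ⟨by omega, h₂⟩, ?_⟩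
        rintro ⟨h₁, k', h₂, h₃, h₄, h₅⟩
        refine ⟨?_, k', h₂, h₃, h₄, h₅⟩
        have h₆ := hno k' h₂
        have h₇ : rep G H P k' = k' := h₃
        omega
      · intro x
        rw [State.setNat_nat_of_ne _ (by decide), hp.comp x]
        by_cases hxP : x ∈ P
        · have hiff : rep G H P x < j + 1 ↔ rep G H P x < j := by
            have := hno x hxP
            omega
          simp only [← hPdef, hiff]
        · simp [← hPdef, hxP]
      · intro y hy
        rw [State.setNat_nat_of_ne _ (by decide), hp.compOut y hy]
      · intro x
        rw [State.setNat_nat_of_ne _ (by decide), hp.sol x]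
        by_cases hxP : x ∈ P ∧ rep G H P x = x
        · have hiff : (x : ℕ) < j + 1 ↔ (x : ℕ) < j := by
            have := hno x hxP.1
            omega
          simp only [hiff]
        · rw [if_neg (fun hc => hxP ⟨hc.1, hc.2.1⟩), if_neg (fun hc => hxP ⟨hc.1, hc.2.1⟩)]
      · intro y hy
        rw [State.setNat_nat_of_ne _ (by decide), hp.solOut y hy]

end Forward

end RealRAM

/-! ### Growing the whole tree, and the number of its nodes. -/

namespace RealRAM

section Forest

variable {n h : ℕ} (G : SimpleGraph (Fin n)) (H : SimpleGraph (Fin h)) (rev : Fin (n * h) → ℝ)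

open Classical in
/-- The memory holds a search tree with `N` nodes, of which the first `i` have been processed. -/
structure Forest (c i N : ℕ) (σ : State) : Prop where
  node : σ.nat aNode 0 = i
  le : i ≤ N
  pos : 0 < N
  nodes : Nodes n (n * h) N σ
  root : nodeSet (n * h) σ 0 = Set.univ
  rootBudget : nodeBudget n σ 0 = fun _ => c
  parent : ∀ j < N, 0 < j → σ.nat aParent j < i ∧ σ.nat aParent j < j ∧
    Kid G H (nodeSet (n * h) σ (σ.nat aParent j)) (nodeBudget n σ (σ.nat aParent j))
      (σ.nat aKey j) (nodeSet (n * h) σ j) (nodeBudget n σ j)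
  all : ∀ i' < i, ∀ key P B, Kid G H (nodeSet (n * h) σ i') (nodeBudget n σ i') key P B →
    ∃ j < N, 0 < j ∧ σ.nat aParent j = i' ∧ σ.nat aKey j = key ∧ nodeSet (n * h) σ j = P ∧
      nodeBudget n σ j = B
  comp : ∀ i' < i, ∀ x : Fin (n * h), σ.nat aComp (i' * (n * h) + x) =
    if x ∈ nodeSet (n * h) σ i' then rep G H (nodeSet (n * h) σ i') x + 1 else 0
  compOut : ∀ y, i * (n * h) ≤ y → σ.nat aComp y = 0
  sol : ∀ i' < i, ∀ x : Fin (n * h), σ.nat aSol (i' * (n * h) + x) =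
    if x ∈ nodeSet (n * h) σ i' ∧ rep G H (nodeSet (n * h) σ i') x = x ∧ 0 ≤ rev x then 1 else 0
  solOut : ∀ y, i * (n * h) ≤ y → σ.nat aSol y = 0

/-- A bound for the number of descendants of the nodes that have not been processed yet. -/
noncomputable def pending (i N : ℕ) (σ : State) : ℕ :=
  ∑ j ∈ Finset.Ico i N, (2 * n * (n * h) * (n * h) + 1) ^ budget G (nodeBudget n σ j)

variable {G H rev} {s : ℕ} {σ τ : State} {Q : State → Prop}

theorem Forest.step {c i N N' : ℕ} (hF : Forest G H rev c i N σ) (hi : i < N)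
    (hp : Processed G H rev i (n * h) N N' σ τ) :
    Forest G H rev c (i + 1) N' (τ.setNat aNode 0 (i + 1)) := by
  classical
  set υ := τ.setNat aNode 0 (i + 1) with hυ
  have hG := hp.grown.frame ((Frame.refl [aNode] τ).setNat (by decide) _ _ :
    Frame [aNode] τ υ)
  have hle := hG.le
  have hset : ∀ j < N, nodeSet (n * h) υ j = nodeSet (n * h) σ j := fun j hj => (hG.old j hj).1
  have hbud : ∀ j < N, nodeBudget n υ j = nodeBudget n σ j := fun j hj => (hG.old j hj).2.1
  have hlt : ∀ i' < i, ∀ x : Fin (n * h), i' * (n * h) + (x : ℕ) < i * (n * h) := fun i' hi' x =>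
    row_lt hi' x.2
  have hc : υ.nat aComp = τ.nat aComp := by simp [hυ]
  have hs : υ.nat aSol = τ.nat aSol := by simp [hυ]
  refine ⟨by simp [hυ], by omega, by omega, hG.nodes, ?_, ?_, fun j hj hj0 => ?_,
    fun i' hi' key P B hk => ?_, fun i' hi' x => ?_, fun y hy => ?_, fun i' hi' x => ?_,
    fun y hy => ?_⟩
  · rw [hset 0 hF.pos, hF.root]
  · rw [hbud 0 hF.pos, hF.rootBudget]
  · rcases lt_or_ge j N with hjN | hjN
    · obtain ⟨a, b, c, d⟩ := hG.old j hjN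
      obtain ⟨h₁, h₂, h₃⟩ := hF.parent j hjN hj0
      rw [c, hset _ (h₂.trans hjN), hbud _ (h₂.trans hjN), d, a, b]
      exact ⟨by omega, h₂, h₃⟩
    · obtain ⟨h₁, h₂, h₃⟩ := hG.new j hjN hj
      rw [h₁, hset i hi, hbud i hi]
      exact ⟨by omega, by omega, h₃⟩
  · rcases Nat.lt_succ_iff_lt_or_eq.1 hi' with hi' | rfl
    · rw [hset i' (hi'.trans hi), hbud i' (hi'.trans hi)] at hk
      obtain ⟨j, hj, hj0, h₁, h₂, h₃, h₄⟩ := hF.all i' hi' key P B hk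
      obtain ⟨a, b, c, d⟩ := hG.old j hj
      exact ⟨j, by omega, hj0, c.trans h₁, d.trans h₂, a.trans h₃, b.trans h₄⟩
    · rw [hset i' hi, hbud i' hi] at hk
      have hkey : key ≤ n * h := by
        obtain ⟨k, -, -, rfl, -⟩ := hk
        exact k.2
      obtain ⟨j, h₁, h₂, h₃⟩ := hG.all key P B ⟨hkey, hk⟩
      exact ⟨j, h₂, by omega, (hG.new j h₁ h₂).1, h₃⟩
  · rw [hc]
    rcases Nat.lt_succ_iff_lt_or_eq.1 hi' with hi' | rfl
    · rw [hset i' (hi'.trans hi), hp.compOut _ (.inl (hlt i' hi' x)), hF.comp i' hi' x]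
    · rw [hset i' hi, hp.comp x]
      have : rep G H (nodeSet (n * h) σ i') x < n * h :=
        (rep_le (mem_comp_self _ _)).trans_lt x.2
      simp only [this, and_true]
  · rw [hc, hp.compOut y (.inr (by rwa [Nat.succ_mul] at hy)),
      hF.compOut y ((Nat.mul_le_mul_right _ (Nat.le_succ i)).trans hy)]
  · rw [hs]
    rcases Nat.lt_succ_iff_lt_or_eq.1 hi' with hi' | rfl
    · rw [hset i' (hi'.trans hi), hp.solOut _ (.inl (hlt i' hi' x)), hF.sol i' hi' x]
    · rw [hset i' hi, hp.sol x]
      simp only [x.2, true_and]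
  · rw [hs, hp.solOut y (.inr (by rwa [Nat.succ_mul] at hy)),
      hF.solOut y ((Nat.mul_le_mul_right _ (Nat.le_succ i)).trans hy)]

/-- A node that can spend b units has at most M children, which can spend at most b - 1 units each,
and M(M+1)^(b-1) + 1 ≤ (M+1)^b. With b = 0 there are no children. So each processed node lowers the
potential by at least one. -/
theorem Processed.pending_le {i N N' : ℕ} (hi : i < N)
    (hp : Processed G H rev i (n * h) N N' σ τ) :
    pending (h := h) G (i + 1) N' τ + 1 ≤ pending (h := h) G i N σ := by
  have hG := hp.grown
  unfold pending
  set M := 2 * n * (n * h) * (n * h) with hM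
  rw [Finset.sum_eq_sum_Ico_succ_bot hi, ← Finset.sum_Ico_consecutive _ hi hG.le]
  have h₁ : ∑ j ∈ Finset.Ico (i + 1) N, (M + 1) ^ budget G (nodeBudget n τ j) =
      ∑ j ∈ Finset.Ico (i + 1) N, (M + 1) ^ budget G (nodeBudget n σ j) :=
    Finset.sum_congr rfl fun j hj => by rw [(hG.old j (Finset.mem_Ico.1 hj).2).2.1]
  have h₂ : ∀ j ∈ Finset.Ico N N', budget G (nodeBudget n τ j) < budget G (nodeBudget n σ i) := by
    intro j hj
    obtain ⟨hj₁, hj₂⟩ := Finset.mem_Ico.1 hj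
    obtain ⟨-, -, k, -, -, -, l, q, hq, -, hB⟩ := hG.new j hj₁ hj₂
    rw [hB]
    exact budget_spend_lt hq
  have h₃ : ∑ j ∈ Finset.Ico N N', (M + 1) ^ budget G (nodeBudget n τ j) + 1 ≤
      (M + 1) ^ budget G (nodeBudget n σ i) := by
    rcases Nat.eq_zero_or_pos (budget G (nodeBudget n σ i)) with h0 | hpos
    · rw [Finset.sum_eq_zero fun j hj => absurd (h₂ j hj) (by omega)]
      exact Nat.one_le_pow _ _ (by omega)
    · obtain ⟨b, hb⟩ := Nat.exists_eq_succ_of_ne_zero hpos.ne'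
      rw [hb] at h₂ ⊢
      have : ∑ j ∈ Finset.Ico N N', (M + 1) ^ budget G (nodeBudget n τ j) ≤
          (Finset.Ico N N').card • (M + 1) ^ b :=
        Finset.sum_le_card_nsmul _ _ _ fun j hj =>
          Nat.pow_le_pow_right (by omega) (Nat.lt_succ_iff.1 (h₂ j hj))
      have hcard : (Finset.Ico N N').card ≤ M := by
        have := hp.le
        rw [Nat.card_Ico]
        omega
      calc _ ≤ (Finset.Ico N N').card * (M + 1) ^ b + 1 := by
            rw [smul_eq_mul] at this
            omega
        _ ≤ M * (M + 1) ^ b + (M + 1) ^ b := by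
            gcongr
            exact Nat.one_le_pow _ _ (by omega)
        _ = (M + 1) ^ (b + 1) := by ring
  rw [h₁]
  omega

/-- Process all nodes. -/
def forwardProg (h : ℕ) : Program :=
  .loop (.neg (.natLe (reg aCount) (reg aNode)))
    (.seq (nodeProg h) (.setNat aNode (.const 0) (.add (reg aNode) (.const 1))))

theorem wp_forwardProg (hms : n * h ≤ s) (hns : n ≤ s) (hσ : Env G H rev σ) {c : ℕ}
    (hF : Forest G H rev c 0 1 σ) (hs : (2 * n * (n * h) * (n * h) + 1) ^ (c * G.cliqueNum) ≤ s)
    (hQ : ∀ τ N, N ≤ s → Frame (aNode :: nodeArrays) σ τ → Forest G H rev c N N τ → Q τ) :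
    Wp s (forwardProg h) Q σ := by
  -- The number of processed nodes plus the potential never exceeds `s`; in the end it bounds the
  -- number of all nodes.
  refine .loop (fun i τ => Frame (aNode :: nodeArrays) σ τ ∧ ∃ N, Forest G H rev c i N τ ∧
    i + pending (h := h) G i N τ ≤ s) ⟨Frame.refl _ _, 1, hF, ?_⟩ ?_ ?_
  · refine le_trans ?_ hs
    simp only [pending, Nat.Ico_succ_singleton, Finset.sum_singleton, hF.rootBudget, zero_add]
    exact Nat.pow_le_pow_right (by omega) (budget_const_le c)
  · rintro i τ ⟨hFr, N, hN, hpot⟩ hb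
    have hiN : i < N := by
      simpa [Test.Holds, NatExpr.eval, hN.node, hN.nodes.count] using hb
    have hpend : 0 < pending (h := h) G i N τ :=
      Finset.sum_pos (fun _ _ => by positivity) ⟨i, by simpa using hiN⟩
    refine ⟨by omega, .seq (wp_nodeProg hms hns (hσ.frame hFr) hN.nodes hN.node hiN
      (fun x => hN.compOut _ (by omega)) (fun x => hN.solOut _ (by omega))
      fun υ N' hp => .setNat ?_)⟩
    have hval : (NatExpr.add (reg aNode) (.const 1)).eval υ = i + 1 := by
      simp only [NatExpr.eval]
      rw [hp.frame.1 aNode (by decide), hN.node]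
    rw [hval]
    refine ⟨(hFr.trans (hp.frame.mono (by decide))).setNat (by decide) _ _, N', hN.step hiN hp, ?_⟩
    have := hp.pending_le hiN
    have heq : pending (h := h) G (i + 1) N' (υ.setNat aNode 0 (i + 1)) =
        pending (h := h) G (i + 1) N' υ := by
      simp only [pending]
      rfl
    simp only [NatExpr.eval, heq]
    omega
  · rintro i τ ⟨hFr, N, hN, hpot⟩ hb
    have hiN : N ≤ i := by
      simpa [Test.Holds, NatExpr.eval, hN.node, hN.nodes.count] using hb
    obtain rfl : i = N := le_antisymm hN.le hiN
    exact hQ τ i (by omega) hFr hN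

end Forest

end RealRAM

/-! ### Improving the answers -/

section Answers

variable {V W ι : Type} [Fintype ι] (G : SimpleGraph V) (H : SimpleGraph W) (e : ι ≃ V × W)

/-- The answers `S` of the nodes are independent sets. The nodes from `J` on have been compared to
the answers of their parents on the components from which they stem. -/
structure Answers (rev : ι → ℝ) (J N : ℕ) (P : ℕ → Set ι) (parent : ℕ → ℕ) (K S : ℕ → Set ι) :
    Prop where
  subset : ∀ i < N, S i ⊆ P i
  indep : ∀ i < N, Indep G H e (S i)
  nonneg : ∀ i < N, ∀ k ∈ P i, 0 ≤ weight rev (S i ∩ comp G H e (P i) k)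
  single : ∀ i < N, ∀ k ∈ P i, comp G H e (P i) k = {k} →
    rev k ≤ weight rev (S i ∩ comp G H e (P i) k)
  done : ∀ j, J ≤ j → j < N → 0 < j → weight rev (S j) ≤ weight rev (S (parent j) ∩ K j)

variable {G H e} {rev : ι → ℝ} {J N : ℕ} {P : ℕ → Set ι} {parent : ℕ → ℕ} {K S : ℕ → Set ι}

theorem Answers.keep (hA : Answers G H e rev (J + 1) N P parent K S)
    (hJ : weight rev (S J) ≤ weight rev (S (parent J) ∩ K J)) :
    Answers G H e rev J N P parent K S := by
  refine ⟨hA.subset, hA.indep, hA.nonneg, hA.single, fun j hj hjN hj0 => ?_⟩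
  rcases hj.lt_or_eq with hlt | rfl
  · exact hA.done j hlt hjN hj0
  · exact hJ

/-- No conflict leaves the component `K J`, so exchanging the parent's answer on it preserves
independence and leaves all other components alone. The weight of the parent's answer decreases on
no component, so earlier comparisons with the same parent stay valid. -/
theorem Answers.replace (hA : Answers G H e rev (J + 1) N P parent K S) (hJN : J < N) (hJ0 : 0 < J)
    (hK : ∀ j < N, 0 < j → parent j < j ∧ P j ⊆ K j ∧
      ∃ k ∈ P (parent j), K j = comp G H e (P (parent j)) k)
    (hJ : weight rev (S (parent J) ∩ K J) ≤ weight rev (S J)) {S' : ℕ → Set ι}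
    (hS : S' (parent J) = S J ∪ S (parent J) \ K J)
    (hS' : ∀ j < N, j ≠ parent J → S' j = S j) :
    Answers G H e rev J N P parent K S' := by
  obtain ⟨hi, hPK, k, hk, hKk⟩ := hK J hJN hJ0
  set i := parent J with hidef
  have hSK : S J ⊆ K J := (hA.subset J hJN).trans hPK
  have hKP : K J ⊆ P i := hKk ▸ comp_subset hk
  have hiN : i < N := hi.trans hJN
  have hcap : S' i ∩ K J = S J := by
    rw [hS]
    ext x
    simp only [Set.mem_inter_iff, Set.mem_union, Set.mem_sdiff]
    have := @hSK x
    tauto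
  have hcomp : ∀ k' ∈ P i, comp G H e (P i) k' = K J ∨
      S' i ∩ comp G H e (P i) k' = S i ∩ comp G H e (P i) k' := by
    intro k' hk'
    by_cases hmem : ∃ x ∈ comp G H e (P i) k', x ∈ K J
    · obtain ⟨x, hx, hxK⟩ := hmem
      left
      rw [hKk] at hxK ⊢
      rw [← comp_eq_of_mem hk' hx, comp_eq_of_mem hk hxK]
    · right
      push Not at hmem
      rw [hS]
      ext x
      simp only [Set.mem_inter_iff, Set.mem_union, Set.mem_sdiff]
      have h₁ := @hSK x
      have h₂ := hmem x
      tauto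
  have hmono : ∀ k' ∈ P i, weight rev (S i ∩ comp G H e (P i) k') ≤
      weight rev (S' i ∩ comp G H e (P i) k') := by
    intro k' hk'
    rcases hcomp k' hk' with h | h
    · rw [h, hcap]
      exact hJ
    · rw [h]
  refine ⟨fun j hj => ?_, fun j hj => ?_, fun j hj k' hk' => ?_, fun j hj k' hk' hs => ?_,
    fun j hj hjN hj0 => ?_⟩
  · by_cases hji : j = i
    · rw [hji, hS]
      exact Set.union_subset (hSK.trans hKP) (Set.sdiff_subset.trans (hA.subset i hiN))
    · rw [hS' j hj hji]
      exact hA.subset j hj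
  · by_cases hji : j = i
    · rw [hji, hS]
      have cross : ∀ x ∈ S J, ∀ y ∈ S i \ K J, ¬ Conflict G H e x y := fun x hx y hy hc =>
        hy.2 (by
          have := hSK hx
          rw [hKk] at this ⊢
          exact comp_closed this hc (hA.subset i hiN hy.1))
      rintro x (hx | hx) y (hy | hy)
      · exact hA.indep J hJN x hx y hy
      · exact cross x hx y hy
      · exact fun hc => cross y hy x hx hc.symm
      · exact hA.indep i hiN x hx.1 y hy.1
    · rw [hS' j hj hji]
      exact hA.indep j hj
  · by_cases hji : j = i
    · rw [hji] at hk' ⊢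
      exact (hA.nonneg i hiN k' hk').trans (hmono k' hk')
    · rw [hS' j hj hji]
      exact hA.nonneg j hj k' hk'
  · by_cases hji : j = i
    · rw [hji] at hk' hs ⊢
      exact (hA.single i hiN k' hk' hs).trans (hmono k' hk')
    · rw [hS' j hj hji]
      exact hA.single j hj k' hk' hs
  · rw [hS' j hjN (by omega)]
    rcases hj.lt_or_eq with hlt | rfl
    · refine (hA.done j hlt hjN hj0).trans ?_
      obtain ⟨h₁, -, k', hk', hKk'⟩ := hK j hjN hj0
      by_cases hji : parent j = i
      · rw [hji] at hk' hKk' ⊢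
        rw [hKk']
        exact hmono k' hk'
      · rw [hS' _ (h₁.trans hjN) hji]
    · rw [← hidef, hcap]

end Answers

/-! ### The backward pass from the last node to the root. -/

namespace RealRAM

section Backward

variable {n h : ℕ} {G : SimpleGraph (Fin n)} {H : SimpleGraph (Fin h)} {rev : Fin (n * h) → ℝ}
  {s : ℕ} {σ τ : State} {Q : State → Prop}

/-- The answer of the node `j`. -/
def nodeSol (m : ℕ) (σ : State) (j : ℕ) : Set (Fin m) := {x | σ.nat aSol (j * m + x) = 1}

variable (G H) in
/-- The component of the parent from which the node `j` stems. -/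
def origin (σ : State) (j : ℕ) : Set (Fin (n * h)) :=
  {x ∈ nodeSet (n * h) σ (σ.nat aParent j) |
    rep G H (nodeSet (n * h) σ (σ.nat aParent j)) x + 1 = σ.nat aKey j}

theorem Forest.origin_eq {c N : ℕ} (hF : Forest G H rev c N N σ) {j : ℕ} (hj : j < N)
    (hj0 : 0 < j) : σ.nat aParent j < j ∧ nodeSet (n * h) σ j ⊆ origin G H σ j ∧
      ∃ k ∈ nodeSet (n * h) σ (σ.nat aParent j), origin G H σ j =
        _root_.comp G H (pairEquiv n h) (nodeSet (n * h) σ (σ.nat aParent j)) k := by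
  obtain ⟨-, hlt, k, hk, hrep, hkey, l, q, -, hP, -⟩ := hF.parent j hj hj0
  have heq : origin G H σ j =
      _root_.comp G H (pairEquiv n h) (nodeSet (n * h) σ (σ.nat aParent j)) k := by
    ext x
    simp only [origin, Set.mem_ofPred_eq]
    rw [mem_comp_iff_rep_eq hk, hrep, hkey, Nat.add_right_cancel_iff]
  refine ⟨hlt, ?_, k, hk, heq⟩
  rw [heq]
  rcases hP with hP | hP <;> rw [hP]
  · exact fun x hx => hx.1
  · exact fun x hx => hx.1

theorem Conflict.irrefl (x : Fin (n * h)) : ¬ Conflict G H (pairEquiv n h) x x := by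
  rintro (hc | hc)
  · exact hc.2 rfl
  · exact hc.1.ne rfl

theorem Forest.nodeSol_eq {c N : ℕ} (hF : Forest G H rev c N N σ) {j : ℕ} (hj : j < N) :
    nodeSol (n * h) σ j = {x ∈ nodeSet (n * h) σ j |
      rep G H (nodeSet (n * h) σ j) x = x ∧ 0 ≤ rev x} := by
  ext x
  simp only [nodeSol, Set.mem_ofPred_eq, hF.sol j hj x]
  split_ifs with hx <;> simp [hx]

/-- First pairs of different components do not conflict, and only pairs of nonnegative revenue are
taken. No comparison has been made yet, so `done` is vacuous. -/
theorem Forest.answers {c N : ℕ} (hF : Forest G H rev c N N σ) :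
    Answers G H (pairEquiv n h) rev N N (nodeSet (n * h) σ) (σ.nat aParent) (origin G H σ)
      (nodeSol (n * h) σ) := by
  classical
  refine ⟨fun i hi => ?_, fun i hi => ?_, fun i hi k hk => ?_, fun i hi k hk hs => ?_,
    fun j _ _ => by omega⟩
  · rw [hF.nodeSol_eq hi]
    exact fun x hx => hx.1
  · rw [hF.nodeSol_eq hi]
    intro x hx y hy hc
    have hxy := rep_congr hx.1 (comp_closed (mem_comp_self _ x) hc hy.1)
    rw [hx.2.1, hy.2.1] at hxy
    obtain rfl : y = x := Fin.ext hxy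
    exact Conflict.irrefl y hc
  · rw [hF.nodeSol_eq hi]
    refine Finset.sum_nonneg fun x _ => Set.indicator_apply_nonneg fun hx => hx.1.2.2
  · rw [hF.nodeSol_eq hi, hs]
    have hrep : rep G H (nodeSet (n * h) σ i) k = k := by
      obtain ⟨y, hy, hy'⟩ := exists_rep G H (nodeSet (n * h) σ i) k
      rw [hs] at hy
      rw [← hy', show y = k from hy]
    by_cases hr : 0 ≤ rev k
    · have : {x ∈ nodeSet (n * h) σ i | rep G H (nodeSet (n * h) σ i) x = x ∧ 0 ≤ rev x} ∩ {k} =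
          {k} := by
        rw [Set.inter_eq_right]
        rintro x rfl
        exact ⟨hk, hrep, hr⟩
      rw [this, weight_singleton]
    · refine (not_le.1 hr).le.trans ?_
      exact Finset.sum_nonneg fun x _ => Set.indicator_apply_nonneg fun hx => hx.1.2.2

/-- The entry of the parent of the current node and the pair in register `rX`. -/
def parentEntry : NatExpr := .add (.read aMaskPtr (.read aParent (reg aNode))) (reg rX)

/-- Whether the pair in register `rX` is in the component from which the current node stems. -/
def originE : NatExpr := (NatExpr.read aComp parentEntry).eq (.read aKey (reg aNode))

/-- The difference between the weight of the node's answer and that of its parent's answer on the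
component of origin is accumulated in entry 0 of array 1 of reals. -/
def weighProg : Program :=
  .seq (.setReal 1 (.const 0) .zero) (.forLoop rX (reg aPairs)
    (.seq (.branch (.natLe (.const 1) (.read aSol (entry rX)))
      (.setReal 1 (.const 0) (.add (.read 1 (.const 0)) (.read 0 (reg rX)))) .skip)
    (.branch (.natLe (.const 2) (.add (.read aSol parentEntry) originE))
      (.setReal 1 (.const 0) (.sub (.read 1 (.const 0)) (.read 0 (reg rX)))) .skip)))

open Classical in
/-- The current node `j` and the data that its comparison with its parent needs. -/
structure Comparison (G : SimpleGraph (Fin n)) (H : SimpleGraph (Fin h)) (rev : Fin (n * h) → ℝ)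
    (i j : ℕ) (K S T : Set (Fin (n * h))) (σ : State) : Prop where
  env : Env G H rev σ
  node : σ.nat aNode 0 = j
  parent : σ.nat aParent j = i
  ptr : σ.nat aMaskPtr i = i * (n * h)
  ptr' : σ.nat aMaskPtr j = j * (n * h)
  lt : i < j
  sol : IsMask (σ.nat aSol) (j * (n * h)) S
  sol' : IsMask (σ.nat aSol) (i * (n * h)) T
  key : ∀ x : Fin (n * h), σ.nat aComp (i * (n * h) + x) = σ.nat aKey j ↔ x ∈ K

theorem Comparison.frame {i j : ℕ} {K S T : Set (Fin (n * h))}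
    (hC : Comparison G H rev i j K S T σ) {W : List ℕ} (hF : Frame W σ τ)
    (hW : ∀ A ∈ [aVerts, aAdj, aPairs, aRow, aVert, aCol, aPat, aNode, aParent, aMaskPtr, aSol,
      aComp, aKey], A ∉ W := by decide) : Comparison G H rev i j K S T τ := by
  refine ⟨hC.env.frame hF fun A hA => hW A ?_, ?_, ?_, ?_, ?_, hC.lt, ?_, ?_, ?_⟩
  · simp only [List.mem_cons, List.not_mem_nil, or_false] at hA ⊢
    tauto
  · rw [hF.1 _ (hW aNode (by simp))]; exact hC.node
  · rw [hF.1 _ (hW aParent (by simp))]; exact hC.parent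
  · rw [hF.1 _ (hW aMaskPtr (by simp))]; exact hC.ptr
  · rw [hF.1 _ (hW aMaskPtr (by simp))]; exact hC.ptr'
  · rw [hF.1 _ (hW aSol (by simp))]; exact hC.sol
  · rw [hF.1 _ (hW aSol (by simp))]; exact hC.sol'
  · rw [hF.1 _ (hW aComp (by simp)), hF.1 _ (hW aKey (by simp))]; exact hC.key

theorem Comparison.eval_entry {i j : ℕ} {K S T : Set (Fin (n * h))}
    (hC : Comparison G H rev i j K S T σ) :
    (entry rX).eval σ = j * (n * h) + σ.nat rX 0 := by
  simp only [entry, NatExpr.eval, hC.node, hC.ptr']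

theorem Comparison.eval_parentEntry {i j : ℕ} {K S T : Set (Fin (n * h))}
    (hC : Comparison G H rev i j K S T σ) :
    parentEntry.eval σ = i * (n * h) + σ.nat rX 0 := by
  simp only [parentEntry, NatExpr.eval, hC.node, hC.parent, hC.ptr]

open Classical in
theorem Comparison.eval_originE {i j : ℕ} {K S T : Set (Fin (n * h))}
    (hC : Comparison G H rev i j K S T σ) {x : Fin (n * h)} (hx : σ.nat rX 0 = x) :
    originE.eval σ = if x ∈ K then 1 else 0 := by
  have e₁ : (NatExpr.read aComp parentEntry).eval σ = σ.nat aComp (i * (n * h) + x) := by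
    rw [NatExpr.eval, hC.eval_parentEntry, hx]
  have e₂ : (NatExpr.read aKey (reg aNode)).eval σ = σ.nat aKey j := by
    simp only [NatExpr.eval, hC.node]
  rw [originE, NatExpr.eval_eq, e₁, e₂]
  simp only [hC.key x]

theorem wp_weighProg (hs : n * h ≤ s) {i j : ℕ} {K S T : Set (Fin (n * h))}
    (hC : Comparison G H rev i j K S T σ)
    (hQ : ∀ τ, Frame [rX] σ τ → τ.real 1 0 = weight rev S - weight rev (T ∩ K) → Q τ) :
    Wp s weighProg Q σ := by
  classical
  let f : ℕ → ℝ := fun y => if hy : y < n * h then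
    S.indicator rev ⟨y, hy⟩ - (T ∩ K).indicator rev ⟨y, hy⟩ else 0
  refine .seq (.setReal (.forLoop hs (fun y τ => Frame [rX] σ τ ∧
    τ.real 1 0 = ∑ y' ∈ Finset.range y, f y') ?_ (fun y τ hτ => (hC.frame hτ.1).env.pairs) ?_ ?_))
  · refine ⟨((Frame.refl _ _).setReal (by decide) _ _).setNat (by decide) _ _, ?_⟩
    simp [NatExpr.eval, RealExpr.eval]
  · rintro y hy τ hτx ⟨hF, hsum⟩
    have hCτ := hC.frame hF
    have e₁ : (NatExpr.read aSol (entry rX)).eval τ =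
        if (⟨y, hy⟩ : Fin (n * h)) ∈ S then 1 else 0 := by
      rw [NatExpr.eval, hCτ.eval_entry, hτx]
      exact hCτ.sol ⟨y, hy⟩
    have hrev : τ.real 0 y = rev ⟨y, hy⟩ := hCτ.env.rev ⟨y, hy⟩
    have key : ∀ υ, Frame [rX] τ υ → υ.nat rX 0 = y →
        υ.real 1 0 = τ.real 1 0 + S.indicator rev ⟨y, hy⟩ →
        Wp s (.branch (.natLe (.const 2) (.add (.read aSol parentEntry) originE))
          (.setReal 1 (.const 0) (.sub (.read 1 (.const 0)) (.read 0 (reg rX)))) .skip)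
          (fun υ => υ.nat rX 0 = y ∧ Frame [rX] σ (υ.setNat rX 0 (y + 1)) ∧
            (υ.setNat rX 0 (y + 1)).real 1 0 = ∑ y' ∈ Finset.range (y + 1), f y') υ := by
      intro υ hFυ hυx hυ
      have hCυ := hCτ.frame hFυ
      have e₂ : (NatExpr.read aSol parentEntry).eval υ =
          if (⟨y, hy⟩ : Fin (n * h)) ∈ T then 1 else 0 := by
        rw [NatExpr.eval, hCυ.eval_parentEntry, hυx]
        exact hCυ.sol' ⟨y, hy⟩
      have e₃ := hCυ.eval_originE (x := ⟨y, hy⟩) hυx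
      have hiff : (Test.natLe (.const 2) (.add (.read aSol parentEntry) originE)).Holds υ ↔
          (⟨y, hy⟩ : Fin (n * h)) ∈ T ∩ K := by
        change 2 ≤ (NatExpr.read aSol parentEntry).eval υ + originE.eval υ ↔ _
        rw [e₂, e₃]
        split_ifs <;> simp_all
      have hf : f y = S.indicator rev ⟨y, hy⟩ - (T ∩ K).indicator rev ⟨y, hy⟩ := by
        simp only [f, hy, dif_pos]
      refine .branch (fun hb => .setReal ?_) fun hb => .skip ?_
      · rw [hiff] at hb
        refine ⟨hυx, ((hF.trans hFυ).setReal (by decide) _ _).setNat (by decide) _ _, ?_⟩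
        rw [Finset.sum_range_succ, hf, Set.indicator_of_mem hb, ← hsum]
        have hrev' : υ.real 0 y = rev ⟨y, hy⟩ := by rw [hFυ.2, hrev]
        simp [RealExpr.eval, NatExpr.eval, hυ, hυx, hrev']
        ring
      · rw [hiff] at hb
        refine ⟨hυx, (hF.trans hFυ).setNat (by decide) _ _, ?_⟩
        rw [Finset.sum_range_succ, hf, Set.indicator_of_notMem hb, ← hsum]
        simp [hυ]
    refine .seq (.branch (fun hb => .setReal ?_) fun hb => .skip ?_)
    · have hS : (⟨y, hy⟩ : Fin (n * h)) ∈ S := by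
        by_contra hc
        change 1 ≤ (NatExpr.read aSol (entry rX)).eval τ at hb
        rw [e₁, if_neg hc] at hb
        omega
      refine key _ ((Frame.refl _ _).setReal (by decide) _ _) (by simpa using hτx) ?_
      rw [Set.indicator_of_mem hS]
      simp [RealExpr.eval, NatExpr.eval, hτx, hrev]
    · have hS : (⟨y, hy⟩ : Fin (n * h)) ∉ S := by
        intro hc
        change ¬ 1 ≤ (NatExpr.read aSol (entry rX)).eval τ at hb
        rw [e₁, if_pos hc] at hb
        omega
      refine key _ (Frame.refl _ _) hτx ?_
      rw [Set.indicator_of_notMem hS, add_zero]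
  · rintro τ ⟨hF, hsum⟩
    refine hQ τ hF ?_
    rw [hsum, Finset.sum_range, weight, weight, ← Finset.sum_sub_distrib]
    exact Finset.sum_congr rfl fun x _ => by simp [f]

def copyProg : Program :=
  .forLoop rX (reg aPairs) (.branch (.natLe (.const 1) originE)
    (.setNat aSol parentEntry (.read aSol (entry rX))) .skip)

theorem wp_copyProg (hs : n * h ≤ s) {i j : ℕ} {K S T : Set (Fin (n * h))} (hSK : S ⊆ K)
    (hC : Comparison G H rev i j K S T σ)
    (hQ : ∀ τ, Frame [aSol, rX] σ τ → IsMask (τ.nat aSol) (i * (n * h)) (S ∪ T \ K) →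
      (∀ y, y < i * (n * h) ∨ i * (n * h) + n * h ≤ y → τ.nat aSol y = σ.nat aSol y) → Q τ) :
    Wp s copyProg Q σ := by
  classical
  refine .fill (A := aSol) (x := rX) (W := []) (i * (n * h))
    (fun y => if hy : y < n * h then if (⟨y, hy⟩ : Fin (n * h)) ∈ S ∪ T \ K then 1 else 0 else 0)
    hs (by decide) (by decide) (fun τ hF => (hC.env.frame hF).pairs)
    (fun y hy τ hF hx _ hO => ?_) fun τ hF hM hM' => hQ τ hF (fun x => ?_) hM'
  · have hptr : j * (n * h) + y < i * (n * h) ∨ i * (n * h) + y ≤ j * (n * h) + y :=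
      .inr (Nat.add_le_add_right (Nat.mul_le_mul_right _ hC.lt.le) _)
    have e₁ : (entry rX).eval τ = j * (n * h) + y := by
      simp only [entry, NatExpr.eval, hx, hF.1 aNode (by decide), hF.1 aMaskPtr (by decide),
        hC.node, hC.ptr']
    have e₂ : parentEntry.eval τ = i * (n * h) + y := by
      simp only [parentEntry, NatExpr.eval, hx, hF.1 aNode (by decide), hF.1 aMaskPtr (by decide),
        hF.1 aParent (by decide), hC.node, hC.ptr, hC.parent]
    have e₃ : originE.eval τ = if (⟨y, hy⟩ : Fin (n * h)) ∈ K then 1 else 0 := by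
      have e₄ : (NatExpr.read aKey (reg aNode)).eval τ = σ.nat aKey j := by
        simp only [NatExpr.eval, hF.1 aNode (by decide), hF.1 aKey (by decide), hC.node]
      rw [originE, NatExpr.eval_eq, e₄, NatExpr.eval, e₂, hF.1 aComp (by decide)]
      simp only [← hC.key ⟨y, hy⟩]
    have e₅ : τ.nat aSol (j * (n * h) + y) = if (⟨y, hy⟩ : Fin (n * h)) ∈ S then 1 else 0 := by
      rw [hO _ hptr]
      exact hC.sol ⟨y, hy⟩
    have e₆ : τ.nat aSol (i * (n * h) + y) = if (⟨y, hy⟩ : Fin (n * h)) ∈ T then 1 else 0 := by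
      rw [hO _ (.inr le_rfl)]
      exact hC.sol' ⟨y, hy⟩
    refine .branch (fun hb => .setNat ?_) fun hb => .skip ⟨Frame.refl _ _, ?_⟩
    · have hK : (⟨y, hy⟩ : Fin (n * h)) ∈ K := by
        by_contra hc
        simp only [Test.Holds, e₃, hc, NatExpr.eval, if_false] at hb
        omega
      rw [e₂, NatExpr.eval, e₁, e₅]
      refine ⟨(Frame.refl _ _).setNat (by simp) _ _, ?_⟩
      simp [hy, hK]
    · have hK : (⟨y, hy⟩ : Fin (n * h)) ∉ K := by
        intro hc
        simp only [Test.Holds, e₃, hc, NatExpr.eval, if_true] at hb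
        omega
      have hS : (⟨y, hy⟩ : Fin (n * h)) ∉ S := fun hc => hK (hSK hc)
      rw [eq_comm, Function.update_eq_self_iff, e₆]
      simp [hy, hK, hS]
  · rw [hM x x.2]
    simp

/-- Compare all answers to those of the parents, from the last node to the first. -/
def backwardProg : Program :=
  .seq (.setNat aNode (.const 0) (reg aCount)) (.loop (.natLe (.const 2) (reg aNode))
    (.seq (.setNat aNode (.const 0) (.sub (reg aNode) (.const 1)))
    (.seq weighProg (.branch (.realLe .zero (.read 1 (.const 0))) copyProg .skip))))

/-- Children have larger numbers than their parents, so the answer of a node is final when it is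
compared with the parent's answer. -/
theorem wp_backwardProg (hs : n * h ≤ s) {c N : ℕ} (hNs : N ≤ s) (hσ : Env G H rev σ)
    (hF : Forest G H rev c N N σ)
    (hQ : ∀ τ, Frame [aNode, aSol, rX] σ τ →
      IsMask (τ.nat aSol) 0 (nodeSol (n * h) τ 0) →
      Answers G H (pairEquiv n h) rev 1 N (nodeSet (n * h) σ) (σ.nat aParent) (origin G H σ)
        (nodeSol (n * h) τ) → Q τ) : Wp s backwardProg Q σ := by
  classical
  have hpos := hF.pos
  refine .seq (.setNat (.loop (fun r τ => r + τ.nat aNode 0 = N ∧ 0 < τ.nat aNode 0 ∧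
    Frame [aNode, aSol, rX] σ τ ∧
    (∀ j < N, IsMask (τ.nat aSol) (j * (n * h)) (nodeSol (n * h) τ j)) ∧
    Answers G H (pairEquiv n h) rev (τ.nat aNode 0) N (nodeSet (n * h) σ) (σ.nat aParent)
      (origin G H σ) (nodeSol (n * h) τ)) ?_ ?_ ?_))
  · have e : (σ.setNat aNode 0 ((reg aCount).eval σ)).nat aNode 0 = N := by
      simp [NatExpr.eval, hF.nodes.count]
    rw [NatExpr.eval, e]
    refine ⟨by omega, hpos, (Frame.refl _ _).setNat (by decide) _ _, fun j hj x => ?_, ?_⟩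
    · have h₁ : nodeSol (n * h) (σ.setNat aNode 0 ((reg aCount).eval σ)) j =
          nodeSol (n * h) σ j := rfl
      rw [State.setNat_nat_of_ne _ (by decide), h₁, hF.nodeSol_eq hj, hF.sol j hj x]
      simp only [Set.mem_ofPred_eq]
      split_ifs <;> rfl
    · exact hF.answers
  · rintro r τ ⟨hr, hpos', hFτ, hmask, hA⟩ hb
    have hb' : 2 ≤ τ.nat aNode 0 := hb
    obtain ⟨j, hj⟩ : ∃ j, τ.nat aNode 0 = j + 1 := ⟨_, (Nat.succ_pred_eq_of_pos hpos').symm⟩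
    have hjN : j < N := by omega
    have hj0 : 0 < j := by omega
    obtain ⟨hlt, hsub, k, hk, hok⟩ := hF.origin_eq hjN hj0
    rw [hj] at hA
    refine ⟨by omega, .seq (.setNat ?_)⟩
    have hval : (NatExpr.sub (reg aNode) (.const 1)).eval τ = j := by
      simp [NatExpr.eval, hj]
    rw [hval, NatExpr.eval]
    set τ₁ := τ.setNat aNode 0 j with hτ₁
    have hFτ₁ : Frame [aNode, aSol, rX] σ τ₁ := hFτ.setNat (by decide) _ _
    have hnode₁ : τ₁.nat aNode 0 = j := by simp [hτ₁]
    have hsol₁ : τ₁.nat aSol = τ.nat aSol := by simp [hτ₁]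
    have hC : Comparison G H rev (σ.nat aParent j) j (origin G H σ j) (nodeSol (n * h) τ j)
        (nodeSol (n * h) τ (σ.nat aParent j)) τ₁ := by
      refine ⟨hσ.frame hFτ₁, hnode₁, ?_, ?_, ?_, hlt, ?_, ?_, fun x => ?_⟩
      · rw [hFτ₁.1 aParent (by decide)]
      · rw [hFτ₁.1 aMaskPtr (by decide), hF.nodes.maskPtr _ (by omega)]
      · rw [hFτ₁.1 aMaskPtr (by decide), hF.nodes.maskPtr _ hjN.le]
      · rw [hsol₁]
        exact hmask j hjN
      · rw [hsol₁]
        exact hmask _ (by omega)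
      · rw [hFτ₁.1 aComp (by decide), hFτ₁.1 aKey (by decide), hF.comp _ (by omega) x]
        -- A key is positive, so it never equals the entry 0 that stands for a pair outside the
        -- parent's set.
        obtain ⟨-, -, k', -, -, hkey, -⟩ := hF.parent j hjN hj0
        simp only [origin, Set.mem_ofPred_eq]
        split_ifs with hx
        · simp [hx]
        · simp only [hx, false_and, iff_false]
          omega
    refine .seq (wp_weighProg hs hC fun υ hFυ hυ => ?_)
    have hFυ' : Frame [aNode, aSol, rX] σ υ := hFτ₁.trans (hFυ.mono (by decide))
    have hCυ := hC.frame hFυ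
    have hsolυ : υ.nat aSol = τ.nat aSol := by rw [hFυ.1 aSol (by decide), hsol₁]
    refine .branch (fun hb => ?_) fun hb => .skip ?_
    · have hb₁ : 0 ≤ weight rev (nodeSol (n * h) τ j) -
          weight rev (nodeSol (n * h) τ (σ.nat aParent j) ∩ origin G H σ j) := by
        rw [← hυ]
        exact hb
      refine wp_copyProg hs ((hA.subset j hjN).trans hsub) hCυ fun χ hFχ hχ hO => ?_
      have hother : ∀ j' < N, j' ≠ σ.nat aParent j → ∀ x : Fin (n * h),
          χ.nat aSol (j' * (n * h) + x) = τ.nat aSol (j' * (n * h) + x) := by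
        intro j' _ hne x
        rw [hO, hsolυ]
        rcases lt_or_gt_of_ne hne with hlt' | hgt
        · exact .inl (row_lt hlt' x.2)
        · right
          calc σ.nat aParent j * (n * h) + n * h = (σ.nat aParent j + 1) * (n * h) := by ring
            _ ≤ j' * (n * h) := Nat.mul_le_mul_right _ hgt
            _ ≤ _ := Nat.le_add_right _ _
      have hother' : ∀ j' < N, j' ≠ σ.nat aParent j →
          nodeSol (n * h) χ j' = nodeSol (n * h) τ j' := fun j' hj' hne => by
        ext x
        simp only [nodeSol, Set.mem_ofPred_eq, hother j' hj' hne x]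
      have hnew : nodeSol (n * h) χ (σ.nat aParent j) = nodeSol (n * h) τ j ∪
          nodeSol (n * h) τ (σ.nat aParent j) \ origin G H σ j := by
        ext x
        change χ.nat aSol _ = 1 ↔ _
        rw [hχ x]
        split_ifs with hx <;> simp [hx]
      have hnodeχ : χ.nat aNode 0 = j := by
        rw [hFχ.1 aNode (by decide), hFυ.1 aNode (by decide), hnode₁]
      rw [hnodeχ]
      refine ⟨by omega, hj0, hFυ'.trans (hFχ.mono (by decide)), fun j' hj' => ?_, ?_⟩
      · by_cases hne : j' = σ.nat aParent j
        · rw [hne, hnew]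
          exact hχ
        · intro x
          rw [hother j' hj' hne x, hother' j' hj' hne]
          exact hmask j' hj' x
      · exact hA.replace hjN hj0 (fun j' h₁ h₂ => hF.origin_eq h₁ h₂) (by linarith) hnew hother'
    · have hb₁ : ¬ 0 ≤ weight rev (nodeSol (n * h) τ j) -
          weight rev (nodeSol (n * h) τ (σ.nat aParent j) ∩ origin G H σ j) := by
        rw [← hυ]
        exact hb
      have hsame : nodeSol (n * h) υ = nodeSol (n * h) τ := by
        funext j'
        simp only [nodeSol, hsolυ]
      have hnodeυ : υ.nat aNode 0 = j := by rw [hFυ.1 aNode (by decide), hnode₁]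
      rw [hnodeυ, hsame, hsolυ]
      exact ⟨by omega, hj0, hFυ', hmask, hA.keep (by linarith)⟩
  · rintro r τ ⟨hr, hpos', hFτ, hmask, hA⟩ hb
    have hb' : ¬ 2 ≤ τ.nat aNode 0 := hb
    have hone : τ.nat aNode 0 = 1 := by omega
    rw [hone] at hA
    have := hmask 0 hpos
    rw [zero_mul] at this
    exact hQ τ hFτ this hA

/-- Children exist only for the first pair of each component; every other pair of that component
determines the same component and hence the same moves. -/
theorem Forest.searchTree {c N : ℕ} (hF : Forest G H rev c N N σ) {S : ℕ → Set (Fin (n * h))}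
    (hA : Answers G H (pairEquiv n h) rev 1 N (nodeSet (n * h) σ) (σ.nat aParent)
      (origin G H σ) S) :
    SearchTree G H (pairEquiv n h) rev N (nodeSet (n * h) σ) (nodeBudget n σ) S := by
  have key : ∀ i < N, ∀ k ∈ nodeSet (n * h) σ i, ∀ q, 0 < nodeBudget n σ i q → ∀ P' l,
      (P' = sel G H (pairEquiv n h) l (_root_.comp G H (pairEquiv n h) (nodeSet (n * h) σ i) k) ∨
        P' = cut G H (pairEquiv n h) l (_root_.comp G H (pairEquiv n h) (nodeSet (n * h) σ i) k)) →
      ∃ j < N, nodeSet (n * h) σ j = P' ∧ nodeBudget n σ j = spend G (nodeBudget n σ i) q ∧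
        weight rev (S j) ≤
          weight rev (S i ∩ _root_.comp G H (pairEquiv n h) (nodeSet (n * h) σ i) k) := by
    intro i hi k hk q hq P' l hP'
    obtain ⟨k', hk', hrep⟩ := exists_rep G H (nodeSet (n * h) σ i) k
    have hk'P := comp_subset hk hk'
    have hcomp := comp_eq_of_mem hk hk'
    rw [← hcomp] at hP' ⊢
    have hrep' : rep G H (nodeSet (n * h) σ i) k' = k' := (rep_congr hk hk').trans hrep.symm
    obtain ⟨j, hj, hj0, h₁, h₂, h₃, h₄⟩ := hF.all i hi (k' + 1) P' _
      ⟨k', hk'P, hrep', rfl, l, q, hq, hP', rfl⟩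
    refine ⟨j, hj, h₃, h₄, (hA.done j hj0 hj hj0).trans_eq ?_⟩
    have : origin G H σ j = _root_.comp G H (pairEquiv n h) (nodeSet (n * h) σ i) k' := by
      ext x
      simp only [origin, Set.mem_ofPred_eq]
      rw [mem_comp_iff_rep_eq hk'P, hrep', h₁, h₂, Nat.add_right_cancel_iff]
    rw [h₁, this]
  exact ⟨hA.subset, hA.nonneg, hA.single,
    fun i hi k hk l q hq => key i hi k hk q hq _ l (.inl rfl),
    fun i hi k hk l q hq => key i hi k hk q hq _ l (.inr rfl)⟩

end Backward

end RealRAM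

/-! ### Colorings and independent sets of pairs -/

section Coloring

variable {V W ι : Type} {G : SimpleGraph V} {H : SimpleGraph W} (e : ι ≃ V × W)

/-- The pairs of a vertex and its color. -/
def coloringPairs (φ : V → Option W) : Set ι := {x | φ (e x).1 = some (e x).2}

open Classical in
/-- The coloring with the given pairs of a vertex and its color. -/
noncomputable def pairsColoring (S : Set ι) (u : V) : Option W :=
  if h : ∃ a, e.symm (u, a) ∈ S then some h.choose else none

variable {e}

theorem IsPartialColoring.indep {φ : V → Option W} (hφ : IsPartialColoring G H φ) :
    Indep G H e (coloringPairs e φ) := by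
  rintro x hx y hy (⟨h₁, h₂⟩ | ⟨h₁, h₂⟩)
  · have hx' : φ (e x).1 = some (e x).2 := hx
    have hy' : φ (e y).1 = some (e y).2 := hy
    rw [h₁, hy'] at hx'
    exact h₂ (Option.some.inj hx').symm
  · exact h₂ (hφ _ _ _ _ h₁ hx hy)

/-- Two colors at one vertex would be in conflict, so the choice in `pairsColoring` is forced. -/
theorem Indep.pairsColoring_eq_some {S : Set ι} (hS : Indep G H e S) {u : V} {a : W} :
    pairsColoring e S u = some a ↔ e.symm (u, a) ∈ S := by
  have huniq : ∀ b, e.symm (u, b) ∈ S → e.symm (u, a) ∈ S → b = a := fun b hb ha => by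
    by_contra hne
    exact hS _ hb _ ha (.inl (by simpa using hne))
  unfold pairsColoring
  constructor
  · intro h
    split_ifs at h with hex
    exact Option.some.inj h ▸ hex.choose_spec
  · intro h
    have hex : ∃ a, e.symm (u, a) ∈ S := ⟨a, h⟩
    rw [dif_pos hex, huniq _ hex.choose_spec h]

theorem Indep.coloringPairs_eq {S : Set ι} (hS : Indep G H e S) :
    coloringPairs e (pairsColoring e S) = S := by
  ext x
  change pairsColoring e S (e x).1 = some (e x).2 ↔ _
  rw [hS.pairsColoring_eq_some]
  simp

theorem Indep.isPartialColoring {S : Set ι} (hS : Indep G H e S) :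
    IsPartialColoring G H (pairsColoring e S) := by
  intro u u' a a' hG ha ha'
  rw [hS.pairsColoring_eq_some] at ha ha'
  by_contra hH
  exact hS _ ha _ ha' (.inr (by simpa using ⟨hG, hH⟩))

theorem weight_coloringPairs [Fintype V] [Fintype W] [Fintype ι] (rev : V → W → ℝ)
    (φ : V → Option W) :
    weight (fun x => rev (e x).1 (e x).2) (coloringPairs e φ) = revenue rev φ := by
  classical
  rw [weight, revenue, ← e.symm.sum_comp, Fintype.sum_prod_type]
  refine Finset.sum_congr rfl fun u _ => ?_
  simp only [Set.indicator_apply, coloringPairs, Set.mem_ofPred_eq, Equiv.apply_symm_apply]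
  rcases hu : φ u with _ | b
  · simp
  · simp

end Coloring

/-! ### Computing the tables from the input. -/

namespace RealRAM

section Tables

variable {s : ℕ} {σ : State} {Q : State → Prop}

/-- Store the first `K` values of a fixed function in the array `A`. -/
def tableProg (A : ℕ) (f : ℕ → ℕ) : ℕ → Program
  | 0 => .skip
  | K + 1 => .seq (tableProg A f K) (.setNat A (.const K) (.const (f K)))

theorem wp_tableProg {A : ℕ} {f : ℕ → ℕ} {K : ℕ}
    (hQ : ∀ τ, Frame [A] σ τ → (∀ k < K, τ.nat A k = f k) → Q τ) :
    Wp s (tableProg A f K) Q σ := by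
  induction K generalizing Q with
  | zero => exact .skip (hQ σ (Frame.refl _ _) (by simp))
  | succ K ih =>
    refine .seq (ih fun τ hF hτ => .setNat (hQ _ (hF.setNat (by simp) _ _) fun k hk => ?_))
    simp only [NatExpr.eval, State.setNat_nat_self, Function.update_apply]
    split_ifs with h
    · rw [h]
    · exact hτ k (by omega)

variable {n h : ℕ} {G : SimpleGraph (Fin n)} (H : SimpleGraph (Fin h)) {rev : Fin n → Fin h → ℝ}

open Classical in
/-- The adjacency matrix of `H`, row by row. -/
noncomputable def pattern (k : ℕ) : ℕ :=
  if hk : k < h * h then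
    if H.Adj (finProdFinEquiv.symm ⟨k, hk⟩).1 (finProdFinEquiv.symm ⟨k, hk⟩).2 then 1 else 0
  else 0

/-- Compute the tables. -/
noncomputable def tablesProg : Program :=
  .seq (.setNat aPairs (.const 0) ((reg aVerts).smul h))
  -- Row starts come from repeated addition, and quotients and remainders modulo `h` from the
  -- entries `h` places earlier, since the machine neither multiplies nor divides.
  (.seq (.forLoop rX (reg aVerts) (.setNat aRow (.add (.const 1) (reg rX))
    (.add (.read aRow (reg rX)) (reg aVerts))))
  (.seq (.forLoop rX (reg aPairs) (.branch (.natLe (.const h) (reg rX))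
    (.setNat aVert (reg rX) (.add (.read aVert (.sub (reg rX) (.const h))) (.const 1)))
    (.setNat aVert (reg rX) (.const 0))))
  (.seq (.forLoop rX (reg aPairs) (.branch (.natLe (.const h) (reg rX))
    (.setNat aCol (reg rX) (.read aCol (.sub (reg rX) (.const h))))
    (.setNat aCol (reg rX) (reg rX))))
  (tableProg aPat (pattern H) (h * h)))))

open Classical in
theorem inputState_adj (u v : Fin n) :
    (inputState G rev).nat aAdj (u * n + v) = if G.Adj u v then 1 else 0 := by
  have hlt : (u : ℕ) * n + v < n * n := row_lt u.2 v.2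
  have hx : (⟨u * n + v, hlt⟩ : Fin (n * n)) = finProdFinEquiv (u, v) :=
    Fin.ext (by simp [finProdFinEquiv, mul_comm, add_comm])
  have h₁ : ((⟨u * n + v, hlt⟩ : Fin (n * n)).divNat, (⟨u * n + v, hlt⟩ : Fin (n * n)).modNat) =
      (u, v) := by
    change finProdFinEquiv.symm _ = _
    rw [hx, Equiv.symm_apply_apply]
  have h₂ := congrArg Prod.fst h₁
  have h₃ := congrArg Prod.snd h₁
  simp only at h₂ h₃
  simp [inputState, hlt, h₂, h₃]

open Classical in
theorem pattern_apply (a b : Fin h) : pattern H (h * a + b) = if H.Adj a b then 1 else 0 := by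
  have hlt : h * (a : ℕ) + b < h * h := by
    rw [mul_comm]
    exact row_lt a.2 b.2
  have hx : (⟨h * a + b, hlt⟩ : Fin (h * h)) = finProdFinEquiv (a, b) :=
    Fin.ext (by simp [finProdFinEquiv, add_comm])
  rw [pattern, dif_pos hlt, hx, Equiv.symm_apply_apply]

theorem wp_tablesProg (hns : n ≤ s) (hms : n * h ≤ s)
    (hQ : ∀ τ, Frame [aPairs, aRow, aVert, aCol, aPat, rX] (inputState G rev) τ →
      Env G H (fun x => rev (pairEquiv n h x).1 (pairEquiv n h x).2) τ → Q τ) :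
    Wp s (tablesProg H) Q (inputState G rev) := by
  set σ := inputState G rev with hσ
  have hverts : ∀ τ W, Frame W σ τ → aVerts ∉ W → τ.nat aVerts 0 = n := fun τ W hF hW => by
    rw [hF.1 aVerts hW]
    simp [hσ, inputState]
  have hzero : ∀ A y, 2 ≤ A → σ.nat A y = 0 := fun A y hA => by
    simp [hσ, inputState, show A ≠ 0 by omega, show A ≠ 1 by omega]
  refine .seq (.setNat ?_)
  set σ₁ := σ.setNat aPairs ((NatExpr.const 0).eval σ) (((reg aVerts).smul h).eval σ) with hσ₁
  have hF₁ : Frame [aPairs] σ σ₁ := (Frame.refl _ _).setNat (by decide) _ _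
  have hpairs₁ : σ₁.nat aPairs 0 = n * h := by
    rw [hσ₁, State.setNat_nat_self, NatExpr.eval_smul]
    simp only [NatExpr.eval, hverts σ [] (Frame.refl _ _) (by simp), mul_comm h,
      Function.update_self]
  refine .seq (.fill (A := aRow) (x := rX) (W := []) 1 (fun j => (j + 1) * n) hns (by decide)
    (by decide) (fun τ hF => hverts τ [aPairs, aRow, rX]
      ((hF₁.mono (by decide)).trans (hF.mono (by decide))) (by decide))
    (fun j hj τ hF hx hI hO => .setNat ⟨(Frame.refl _ _).setNat (by simp) _ _, ?_⟩)
    fun σ₂ hF₂ hrow hrow' => ?_)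
  · have hv : τ.nat aVerts 0 = n := hverts τ [aPairs, aRow, rX]
      ((hF₁.mono (by decide)).trans (hF.mono (by decide))) (by decide)
    have hr : τ.nat aRow j = j * n := by
      -- Entry 0 of `aRow` is never written and keeps its initial value 0.
      rcases j with _ | j
      · rw [hO 0 (.inl one_pos), hF₁.1 aRow (by decide), hzero aRow 0 (by decide), zero_mul]
      · rw [add_comm, hI j (by omega), add_comm]
    simp only [NatExpr.eval, hx, hv, hr, State.setNat_nat_self, Nat.succ_mul]
  have hrow₂ : ∀ u < n, σ₂.nat aRow u = u * n := by
    rintro (_ | u) hu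
    · rw [hrow' 0 (.inl one_pos), hF₁.1 aRow (by decide), hzero aRow 0 (by decide), zero_mul]
    · rw [add_comm, hrow u (by omega), add_comm]
  have hF₂' : Frame [aPairs, aRow, rX] σ σ₂ :=
    (hF₁.mono (by decide)).trans (hF₂.mono (by decide))
  have hpairs₂ : σ₂.nat aPairs 0 = n * h := by rw [hF₂.1 aPairs (by decide), hpairs₁]
  refine .seq (.fill (A := aVert) (x := rX) (W := []) 0 (fun j => j / h) hms (by decide)
    (by decide) (fun τ hF => by rw [NatExpr.eval, NatExpr.eval, hF.1 aPairs (by decide), hpairs₂])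
    (fun j hj τ hF hx hI hO => ?_) fun σ₃ hF₃ hvert _ => ?_)
  · have hh : 0 < h := Nat.pos_of_ne_zero fun h0 => by simp [h0] at hj
    refine .branch (fun hb => .setNat ⟨(Frame.refl _ _).setNat (by simp) _ _, ?_⟩) fun hb =>
      .setNat ⟨(Frame.refl _ _).setNat (by simp) _ _, ?_⟩ <;>
    simp only [Test.Holds, NatExpr.eval, hx, not_le] at hb
    · have := hI (j - h) (by omega)
      rw [zero_add] at this
      simp only [NatExpr.eval, hx, this, State.setNat_nat_self, zero_add]
      rw [Nat.div_eq_sub_div hh hb]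
    · simp only [NatExpr.eval, hx, State.setNat_nat_self, zero_add, Nat.div_eq_of_lt hb]
  have hF₃' : Frame [aPairs, aRow, aVert, rX] σ σ₃ :=
    (hF₂'.mono (by decide)).trans (hF₃.mono (by decide))
  have hpairs₃ : σ₃.nat aPairs 0 = n * h := by rw [hF₃.1 aPairs (by decide), hpairs₂]
  refine .seq (.fill (A := aCol) (x := rX) (W := []) 0 (fun j => j % h) hms (by decide)
    (by decide) (fun τ hF => by rw [NatExpr.eval, NatExpr.eval, hF.1 aPairs (by decide), hpairs₃])
    (fun j hj τ hF hx hI hO => ?_) fun σ₄ hF₄ hcol _ => wp_tableProg fun τ hFτ hpat => ?_)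
  · refine .branch (fun hb => .setNat ⟨(Frame.refl _ _).setNat (by simp) _ _, ?_⟩) fun hb =>
      .setNat ⟨(Frame.refl _ _).setNat (by simp) _ _, ?_⟩ <;>
    simp only [Test.Holds, NatExpr.eval, hx, not_le] at hb
    · have hh : 0 < h := Nat.pos_of_ne_zero fun h0 => by simp [h0] at hj
      have := hI (j - h) (by omega)
      rw [zero_add] at this
      simp only [NatExpr.eval, hx, this, State.setNat_nat_self, zero_add]
      rw [Nat.mod_eq_sub_mod hb]
    · simp only [NatExpr.eval, hx, State.setNat_nat_self, zero_add, Nat.mod_eq_of_lt hb]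
  have hFτ' : Frame [aPairs, aRow, aVert, aCol, aPat, rX] σ τ :=
    ((hF₃'.mono (by decide)).trans (hF₄.mono (by decide))).trans (hFτ.mono (by decide))
  refine hQ τ hFτ' ⟨hverts τ _ hFτ' (by decide), fun u v => ?_, ?_, fun u hu => ?_, fun k hk => ?_,
    fun k hk => ?_, fun a b => ?_, fun x => ?_⟩
  · rw [hFτ'.1 aAdj (by decide), inputState_adj]
  · rw [hFτ.1 aPairs (by decide), hF₄.1 aPairs (by decide), hpairs₃]
  · rw [hFτ.1 aRow (by decide), hF₄.1 aRow (by decide), hF₃.1 aRow (by decide), hrow₂ u hu]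
  · rw [hFτ.1 aVert (by decide), hF₄.1 aVert (by decide), ← hvert k hk, zero_add]
  · rw [hFτ.1 aCol (by decide), ← hcol k hk, zero_add]
  · rw [hpat _ (by rw [mul_comm]; exact row_lt a.2 b.2), pattern_apply]
  · rw [hFτ'.2]
    simp [hσ, inputState]

end Tables

/-! ### The root of the search tree. -/

section Root

variable {n h : ℕ} {G : SimpleGraph (Fin n)} {H : SimpleGraph (Fin h)} {rev : Fin (n * h) → ℝ}
  {s : ℕ} {σ : State} {Q : State → Prop}

/-- Create the root of the search tree. -/
def rootProg (c : ℕ) : Program :=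
  .seq (.forLoop rX (reg aPairs) (.setNat aMask (reg rX) (.const 1)))
  (.seq (.forLoop rX (reg aVerts) (.setNat aBudget (reg rX) (.const c))) pushProg)

theorem wp_rootProg (hns : n ≤ s) (hms : n * h ≤ s) (c : ℕ) (hσ : Env G H rev σ)
    (hzero : ∀ A ∈ [aNode, aCount, aComp, aSol, aMaskPtr, aBudgetPtr], ∀ y, σ.nat A y = 0)
    (hQ : ∀ τ, Frame [aMask, aBudget, rX, aCount, aParent, aKey, aMaskPtr, aBudgetPtr] σ τ →
      Forest G H rev c 0 1 τ → Q τ) : Wp s (rootProg c) Q σ := by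
  refine .seq (.fill (A := aMask) (x := rX) (W := []) 0 (fun _ => 1) hms (by decide)
    (by decide) (fun τ hF => (hσ.frame hF).pairs)
    (fun j hj τ hF hx _ _ => .setNat ⟨(Frame.refl _ _).setNat (by simp) _ _, ?_⟩)
    fun σ₁ hF₁ hmask _ => ?_)
  · simp only [NatExpr.eval, hx, State.setNat_nat_self, zero_add]
  have hσ₁ := hσ.frame hF₁
  refine .seq (.fill (A := aBudget) (x := rX) (W := []) 0 (fun _ => c) hns (by decide)
    (by decide) (fun τ hF => (hσ₁.frame hF).verts)
    (fun j hj τ hF hx _ _ => .setNat ⟨(Frame.refl _ _).setNat (by simp) _ _, ?_⟩)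
    fun σ₂ hF₂ hbud _ => ?_)
  · simp only [NatExpr.eval, hx, State.setNat_nat_self, zero_add]
  have hσ₂ := hσ₁.frame hF₂
  have hF : Frame [aMask, aBudget, rX] σ σ₂ :=
    (hF₁.mono (by decide)).trans (hF₂.mono (by decide))
  have hnodes : Nodes n (n * h) 0 σ₂ := by
    refine ⟨?_, fun j hj => ?_, fun j hj => ?_, fun j hj => by omega⟩
    · rw [hF.1 aCount (by decide), hzero _ (by simp)]
    · obtain rfl := Nat.le_zero.1 hj
      rw [hF.1 aMaskPtr (by decide), hzero _ (by simp), zero_mul]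
    · obtain rfl := Nat.le_zero.1 hj
      rw [hF.1 aBudgetPtr (by decide), hzero _ (by simp), zero_mul]
  refine wp_pushProg hσ₂.verts hσ₂.pairs hnodes (P := Set.univ) (B := fun _ => c) (fun x => ?_)
    (fun v => ?_) fun τ hFτ hG => ?_
  · rw [zero_mul, hF₂.1 aMask (by decide), hmask x x.2]
    simp
  · rw [zero_mul, hbud v v.2]
  · have hFτ' : Frame [aMask, aBudget, rX, aCount, aParent, aKey, aMaskPtr, aBudgetPtr] σ τ :=
      (hF.mono (by decide)).trans (hFτ.mono (by decide))
    obtain ⟨-, -, hP, hB⟩ := hG.new 0 le_rfl one_pos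
    refine hQ τ hFτ' ⟨?_, zero_le_one, one_pos, hG.nodes, hP, hB, fun j h₁ h₂ => by omega,
      fun i hi => by omega, fun i hi => by omega, fun y _ => ?_, fun i hi => by omega,
      fun y _ => ?_⟩
    · rw [hFτ'.1 aNode (by decide), hzero _ (by simp)]
    · rw [hFτ'.1 aComp (by decide), hzero _ (by simp)]
    · rw [hFτ'.1 aSol (by decide), hzero _ (by simp)]

end Root

/-! ### Writing the coloring. -/

section Output

variable {n h : ℕ} {G : SimpleGraph (Fin n)} {H : SimpleGraph (Fin h)} {rev : Fin (n * h) → ℝ}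
  {s : ℕ} {σ : State} {Q : State → Prop}

/-- Output the answer of the root. -/
def outputProg : Program :=
  .forLoop rX (reg aPairs) (.branch (.natLe (.const 1) (.read aSol (reg rX)))
    (.setNat aOut (.read aVert (reg rX)) (.add (.read aCol (reg rX)) (.const 1))) .skip)

/-- An independent `S` has at most one pair at each vertex, so no entry is written twice; the other
vertices keep the initial 0. -/
theorem wp_outputProg (hms : n * h ≤ s) (hσ : Env G H rev σ) {S : Set (Fin (n * h))}
    (hS : Indep G H (pairEquiv n h) S) (hmask : IsMask (σ.nat aSol) 0 S)
    (hzero : ∀ y, σ.nat aOut y = 0)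
    (hQ : ∀ τ, Outputs τ (pairsColoring (pairEquiv n h) S) → Q τ) : Wp s outputProg Q σ := by
  classical
  refine .forLoop hms (fun j τ => Frame [aOut, rX] σ τ ∧
    (∀ x ∈ S, (x : ℕ) < j → τ.nat aOut (pairEquiv n h x).1 = (pairEquiv n h x).2 + 1) ∧
    ∀ u : Fin n, (∀ x ∈ S, (x : ℕ) < j → (pairEquiv n h x).1 ≠ u) → τ.nat aOut u = 0) ?_
    (fun j τ hτ => (hσ.frame hτ.1).pairs) ?_ ?_
  · refine ⟨(Frame.refl _ _).setNat (by decide) _ _, fun x _ hx => by omega, fun u _ => ?_⟩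
    rw [State.setNat_nat_of_ne _ (by decide), hzero]
  · rintro j hj τ hx ⟨hF, hin, hout⟩
    have hE := hσ.frame hF
    have e₁ : τ.nat aSol j = if (⟨j, hj⟩ : Fin (n * h)) ∈ S then 1 else 0 := by
      rw [hF.1 aSol (by decide), ← hmask ⟨j, hj⟩, zero_add]
    have e₂ := hE.eval_vert (k := reg rX) (x := ⟨j, hj⟩) (by simpa [NatExpr.eval] using hx)
    have e₃ := hE.eval_col (k := reg rX) (x := ⟨j, hj⟩) (by simpa [NatExpr.eval] using hx)
    have hiff : (Test.natLe (.const 1) (.read aSol (reg rX))).Holds τ ↔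
        (⟨j, hj⟩ : Fin (n * h)) ∈ S := by
      simp only [Test.Holds, NatExpr.eval, hx, e₁]
      split_ifs <;> simp_all
    refine .branch (fun hb => .setNat ?_) fun hb => .skip ?_
    · rw [hiff] at hb
      rw [e₂, NatExpr.eval, e₃, NatExpr.eval]
      refine ⟨by simpa using hx, (hF.setNat (by decide) _ _).setNat (by decide) _ _,
        fun x hxS hxj => ?_, fun u hu => ?_⟩
      · rw [State.setNat_nat_of_ne _ (by decide), State.setNat_nat_self, Function.update_apply]
        by_cases hxx : x = ⟨j, hj⟩
        · simp [hxx]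
        · have hne : (pairEquiv n h x).1 ≠ (pairEquiv n h ⟨j, hj⟩).1 := fun h₁ =>
            hS x hxS _ hb (.inl ⟨h₁, fun h₂ => hxx ((pairEquiv n h).injective (Prod.ext h₁ h₂))⟩)
          rw [if_neg fun h' => hne (Fin.ext h')]
          have : (x : ℕ) ≠ j := fun h' => hxx (Fin.ext h')
          exact hin x hxS (by omega)
      · rw [State.setNat_nat_of_ne _ (by decide), State.setNat_nat_self, Function.update_apply,
          if_neg fun h' => hu _ hb (Nat.lt_succ_self j) (Fin.ext h'.symm)]
        exact hout u fun x hxS hxj => hu x hxS (by omega)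
    · rw [hiff] at hb
      refine ⟨hx, hF.setNat (by decide) _ _, fun x hxS hxj => ?_, fun u hu => ?_⟩
      · rw [State.setNat_nat_of_ne _ (by decide)]
        have : (x : ℕ) ≠ j := fun h' => hb (by rwa [show (⟨j, hj⟩ : Fin (n * h)) = x from
          Fin.ext h'.symm])
        exact hin x hxS (by omega)
      · rw [State.setNat_nat_of_ne _ (by decide)]
        exact hout u fun x hxS hxj => hu x hxS (by omega)
  · rintro τ ⟨-, hin, hout⟩
    refine hQ τ fun u => ?_
    rcases hu : pairsColoring (pairEquiv n h) S u with _ | a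
    · refine hout u fun x hxS _ hxu => ?_
      have := (hS.pairsColoring_eq_some (u := u) (a := (pairEquiv n h x).2)).2
        (by rwa [← hxu, Prod.mk.eta, Equiv.symm_apply_apply])
      rw [hu] at this
      cases this
    · rw [hS.pairsColoring_eq_some] at hu
      have := hin _ hu (Fin.is_lt _)
      rw [Equiv.apply_symm_apply] at this
      exact this

end Output

end RealRAM

/-! ### The running time -/

/-- For n ≥ 2, constants in the base are absorbed by k ≤ n^k, and constants in the exponent by ω ≥
1. For n ≤ 1 the left side is bounded by a constant. -/
theorem exists_le_mul_pow_cliqueNum (h c c₁ d₁ : ℕ) : ∃ C, ∀ (n : ℕ) (G : SimpleGraph (Fin n)),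
    c₁ * ((2 * n * (n * h) * (n * h) + 1) ^ (c * G.cliqueNum) + n * h + n + 1) ^ d₁ ≤
      C * n ^ (C * G.cliqueNum) := by
  set A := 2 * h * h + 1 with hA
  set D := (A + 3) * c + h + 3 with hD
  -- The first summand settles n ≤ 1 and dominates the factor `c₁`; the second is the exponent for n
  -- ≥ 2.
  refine ⟨c₁ * (A ^ c + h + 2) ^ d₁ + D * d₁, fun n G => ?_⟩
  set C := c₁ * (A ^ c + h + 2) ^ d₁ + D * d₁ with hC
  set w := G.cliqueNum with hw
  have hwn : w ≤ n := by
    obtain ⟨T, hT⟩ := G.exists_isNClique_cliqueNum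
    simpa [← hw, hT.card_eq] using T.card_le_univ
  have hw0 : 0 < n → 0 < w := fun hn => by
    have : G.IsClique (({⟨0, hn⟩} : Finset (Fin n)) : Set (Fin n)) := by simp
    exact (Finset.card_singleton _).symm.trans_le this.card_le_cliqueNum
  have hconst : n ≤ 1 → c₁ * ((2 * n * (n * h) * (n * h) + 1) ^ (c * w) + n * h + n + 1) ^ d₁ ≤
      C := fun hn => by
    refine le_trans ?_ (Nat.le_add_right _ _)
    have h₁ : (2 * n * (n * h) * (n * h) + 1) ^ (c * w) ≤ A ^ c :=
      calc (2 * n * (n * h) * (n * h) + 1) ^ (c * w)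
          ≤ (2 * 1 * (1 * h) * (1 * h) + 1) ^ (c * w) := by gcongr
        _ = A ^ (c * w) := by rw [hA]; ring
        _ ≤ A ^ c := Nat.pow_le_pow_right (by omega)
          ((Nat.mul_le_mul_left c (hwn.trans hn)).trans_eq (mul_one c))
    have h₂ : n * h ≤ h := (Nat.mul_le_mul_right h hn).trans_eq (one_mul h)
    refine Nat.mul_le_mul_left _ (Nat.pow_le_pow_left ?_ _)
    omega
  rcases lt_or_ge n 2 with hn | hn
  · refine (hconst (by omega)).trans (Nat.le_mul_of_pos_right _ ?_)
    obtain rfl | rfl : n = 0 ∨ n = 1 := by omega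
    -- The empty graph has clique number 0, so the convention 0^0 = 1 enters here.
    · simp [Nat.le_zero.1 hwn]
    · simp
  · have hw1 := hw0 (by omega)
    have hpos : 0 < n := by omega
    have hself : ∀ k, k ≤ n ^ k := fun k => (Nat.lt_pow_self (by omega)).le
    set E := (A + 3) * (c * w) + h + 1 with hE
    have h₁ : (2 * n * (n * h) * (n * h) + 1) ^ (c * w) ≤ n ^ E := by
      have hb : 2 * n * (n * h) * (n * h) + 1 ≤ n ^ (A + 3) :=
        calc 2 * n * (n * h) * (n * h) + 1 ≤ 2 * n * (n * h) * (n * h) + n ^ 3 :=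
            Nat.add_le_add_left (Nat.one_le_pow _ _ hpos) _
          _ = A * n ^ 3 := by rw [hA]; ring
          _ ≤ n ^ A * n ^ 3 := Nat.mul_le_mul_right _ (hself A)
          _ = n ^ (A + 3) := (pow_add _ _ _).symm
      calc _ ≤ (n ^ (A + 3)) ^ (c * w) := Nat.pow_le_pow_left hb _
        _ = n ^ ((A + 3) * (c * w)) := (pow_mul _ _ _).symm
        _ ≤ n ^ E := Nat.pow_le_pow_right hpos (by omega)
    have h₂ : n * h ≤ n ^ E :=
      calc n * h ≤ n * n ^ h := Nat.mul_le_mul_left _ (hself h)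
        _ = n ^ (h + 1) := by ring
        _ ≤ n ^ E := Nat.pow_le_pow_right hpos (by omega)
    have h₃ : n ≤ n ^ E := Nat.le_self_pow (by omega) n
    have h₄ : (2 * n * (n * h) * (n * h) + 1) ^ (c * w) + n * h + n + 1 ≤ n ^ (D * w) :=
      calc _ ≤ n ^ E * 4 := by omega
        _ ≤ n ^ E * n ^ 2 := Nat.mul_le_mul_left _ (Nat.pow_le_pow_left hn 2)
        _ = n ^ (E + 2) := (pow_add _ _ _).symm
        _ ≤ n ^ (D * w) := Nat.pow_le_pow_right hpos (by
          have : h + 3 ≤ (h + 3) * w := Nat.le_mul_of_pos_right _ hw1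
          calc E + 2 = (A + 3) * (c * w) + (h + 3) := by omega
            _ ≤ (A + 3) * (c * w) + (h + 3) * w := by omega
            _ = D * w := by rw [hD]; ring)
    calc _ ≤ c₁ * (n ^ (D * w)) ^ d₁ := by gcongr
      _ = c₁ * n ^ (D * d₁ * w) := by rw [← pow_mul]; ring_nf
      _ ≤ C * n ^ (C * w) := by
        refine Nat.mul_le_mul ?_ (Nat.pow_le_pow_right hpos (Nat.mul_le_mul_right _ (by omega)))
        exact (Nat.le_mul_of_pos_right _ (by positivity)).trans (Nat.le_add_right _ _)

/-! ### Assembling the program. -/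

namespace RealRAM

/-- Solve Max Partial `H`-Coloring by means of a search tree whose moves are restricted by the
budget `c` at every vertex. -/
noncomputable def solveProg {h : ℕ} (H : SimpleGraph (Fin h)) (c : ℕ) : Program :=
  .seq (tablesProg H) (.seq (rootProg c) (.seq (forwardProg h) (.seq backwardProg outputProg)))

theorem wp_solveProg {n h : ℕ} {G : SimpleGraph (Fin n)} {H : SimpleGraph (Fin h)} {s c : ℕ}
    (rev : Fin n → Fin h → ℝ) (hns : n ≤ s) (hms : n * h ≤ s)
    (hs : (2 * n * (n * h) * (n * h) + 1) ^ (c * G.cliqueNum) ≤ s)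
    (hG : ∀ X, Indep G H (pairEquiv n h) X →
      Isolable G H (pairEquiv n h) (c * G.cliqueNum) Set.univ X) :
    Wp s (solveProg H c)
      (fun σ => ∃ φ : Fin n → Option (Fin h), IsOptimumSolution G H rev φ ∧ Outputs σ φ)
      (inputState G rev) := by
  have hzero : ∀ A y, 2 ≤ A → (inputState G rev).nat A y = 0 := fun A y hA => by
    simp [inputState, show A ≠ 0 by omega, show A ≠ 1 by omega]
  refine .seq (wp_tablesProg H hns hms fun σ₁ hF₁ hE₁ => .seq (wp_rootProg hns hms c hE₁ ?_
    fun σ₂ hF₂ hT₂ => .seq ?_))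
  · intro A hA y
    rw [hF₁.1 A, hzero A y]
    · fin_cases hA <;> decide
    · fin_cases hA <;> decide
  have hE₂ := hE₁.frame hF₂
  refine wp_forwardProg hms hns hE₂ hT₂ hs fun σ₃ N hN hF₃ hT₃ => .seq ?_
  have hE₃ := hE₂.frame hF₃
  refine wp_backwardProg hms hN hE₃ hT₃ fun σ₄ hF₄ hmask hA => ?_
  have hE₄ := hE₃.frame hF₄
  set S := nodeSol (n * h) σ₄ 0
  have hS : Indep G H (pairEquiv n h) S := hA.indep 0 hT₃.pos
  refine wp_outputProg hms hE₄ hS hmask (fun y => ?_) fun τ hτ => ⟨_, ⟨?_, fun ψ hψ => ?_⟩, hτ⟩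
  · rw [hF₄.1 aOut (by decide), hF₃.1 aOut (by decide), hF₂.1 aOut (by decide),
      hF₁.1 aOut (by decide), hzero _ _ le_rfl]
  · exact hS.isPartialColoring
  · rw [← weight_coloringPairs (e := pairEquiv n h), ← weight_coloringPairs (e := pairEquiv n h),
      hS.coloringPairs_eq]
    refine (hT₃.searchTree hA).weight_le (c * G.cliqueNum) hT₃.pos ?_ ?_ ?_
    · rw [hT₃.root]
      exact hG _ hψ.indep
    · rw [hT₃.root]
      exact Set.subset_univ _
    · rw [hT₃.rootBudget]
      exact exists_clique_sum_const c

theorem exists_solvesMaxPartialColoring (s t : ℕ) {h : ℕ} (H : SimpleGraph (Fin h)) :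
    ∃ (p : Program) (C : ℕ), SolvesMaxPartialColoring p H
      (fun _ G => InducedFree (SimpleGraph.pathGraph 6) G ∧
        InducedFree (subdividedStarWithClique s) G ∧ InducedFree (subdividedStar t) G)
      (fun n G => C * n ^ (C * G.cliqueNum)) := by
  obtain ⟨c, hc⟩ := exists_isolable s t h
  obtain ⟨c₁, d₁, hbound⟩ := (solveProg H c).exists_bound_le
  obtain ⟨C, hC⟩ := exists_le_mul_pow_cliqueNum h c c₁ d₁
  refine ⟨solveProg H c, C, fun n G ⟨hP, hL, hS⟩ rev => ?_⟩
  obtain ⟨σ, k, hr, hk, hφ⟩ := wp_solveProg (H := H) (c := c) (G := G)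
    -- The first summand bounds the number of nodes, the next two the lengths of the counting loops,
    -- and the last ensures `1 ≤ s`.
    (s := (2 * n * (n * h) * (n * h) + 1) ^ (c * G.cliqueNum) + n * h + n + 1) rev (by omega)
    (by omega) (by omega) fun X hX => by
      have := hc (e := pairEquiv n h) (Fintype.card_fin h) hP hL hS G.cliqueNum
        (X := X) (K := Set.univ) hX fun T hT _ => hT.card_le_cliqueNum
      rwa [Set.inter_univ] at this
  exact ⟨σ, k, hr, (hk.trans (hbound _ (by omega))).trans (hC n G), hφ⟩

end RealRAM

theorem mainTheorem3 :
    (∀ (s t h : ℕ) (H : SimpleGraph (Fin h)),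
      ∃ (p : RealRAM.Program) (C : ℕ),
        RealRAM.SolvesMaxPartialColoring p H
          (fun _ G => InducedFree (SimpleGraph.pathGraph 6) G ∧
            InducedFree (subdividedStarWithClique s) G ∧ InducedFree (subdividedStar t) G)
          (fun n G => C * n ^ (C * G.cliqueNum))) ∧
    (∀ (h : ℕ) (H : SimpleGraph (Fin h)),
      ∃ (p : RealRAM.Program) (C : ℕ),
        RealRAM.SolvesMaxPartialColoring p H
          (fun _ G => InducedFree (SimpleGraph.pathGraph 5) G)
          (fun n G => C * n ^ (C * G.cliqueNum))) := by
  refine ⟨fun s t h H => RealRAM.exists_solvesMaxPartialColoring s t H, fun h H => ?_⟩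
  -- `L_3` and `S_2` both contain an induced path on five vertices; the latter is that path.
  obtain ⟨p, C, hp⟩ := RealRAM.exists_solvesMaxPartialColoring 3 2 H
  exact ⟨p, C, fun n G hG => hp n G
    ⟨fun hF => hG (pathGraph_five_isIndContained_six.trans hF),
      fun hF => hG (pathGraph_five_isIndContained_subdividedStarWithClique.trans hF),
      fun hF => hG (pathGraph_five_isIndContained_subdividedStar.trans hF)⟩⟩
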